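/- Consider $N=20$ identical point vortices on the unit sphere $S^2\subset\mathbb R^3$, with equations of motion $$\dot v_j=\sum_{i\ne j}\frac{v_i\times v_j}{|v_j-v_i|^2},\qquad j=1,\dots,20, \tag{E}$$ and Hamiltonian (energy) $H(v)=-\frac12\sum_{i<j}\ln|v_j-v_i|^2$. Let $\mathbb T<\mathrm{SO}(3)$ be the tetrahedral group of order $12$ generated by $\begin{pmatrix}0&1&0\\0&0&1\\1&0&0\end{pmatrix}$ and $\mathrm{diag}(1,-1,-1)$. Let $\mathcal T_1=\frac1{\sqrt3}\{(1,1,1),(-1,-1,1),(-1,1,-1),(1,-1,-1)\}$ and $\mathcal T_2=-\mathcal T_1$ (the vertices of two tetrahedra), let $F=\mathcal T_1\cup\mathcal T_2$ (the vertices of a cube), and let $\mathcal O=\{(\pm1,0,0),(0,\pm1,0),(0,0,\pm1)\}$ (the vertices of the dual octahedron). Fix enumerations $g_1,\dots,g_{12}$ of $\mathbb T$ and $f_1,\dots,f_8$ of $F$, and for $u\in S^2$ put $\rho(u)=(g_1u,\dots,g_{12}u,f_1,\dots,f_8)$. For $u_0\in S^2$ and an interval $I$ of energies, a *$\mathbb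 T$-symmetric periodic family at $\rho(u_0)$, parametrised by the energy $h\in I$*, means a family of collision-free solutions of (E), defined for all $t\in\mathbb R$, of the form $v_h(t)=\rho(u_h(t))$ with $H(v_h(t))=h$ for all $h\in I$ and $t\in\mathbb R$, with $u_h(t)$ jointly continuous in $(h,t)$, such that each $v_h$ is periodic and non-constant with minimal period $\tau(h)>0$. Thus eight vortices stay fixed at the vertices of the cube, and the other twelve trajectories are at each instant the images of a single one under $\mathbb T$. Moreover, for every $h\in I$ the vortex $g_ju_h(t)$ traverses, once in each period $\tau(h)$, a simple closed loop on $S^2$ around $g_ju_0$ (that is, the loop avoids $\pm g_ju_0$ and separates $g_ju_0$ from $-g_ju_0$); vortices with the same $g_ju_0$ travel along the same loop, and the loops of vortices with distinct $g_ju_0$ are disjoint. Then: 1. Let $u_0$ be any of the $24$ points obtained by permuting the entries of $\frac1{\sqrt3}(\pm\phi,\pm\phi^{-1},0)$, $\phi=\frac{1+\sqrt5}2$. Then $\rho(u_0)$ is a (collision-free) equilibrium of (E) whose $20$ vortices occupy the vertices of a regular dodecahedron inscribed in $S^2$. With $h_0=H(\rho(u_0))$, there are $\varepsilon>0$ and a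 $\mathbb T$-symmetric periodic family at $\rho(u_0)$, parametrised by $h\in(h_0,h_0+\varepsilon)$, that emanates from this equilibrium: $v_h(t)\to\rho(u_0)$ uniformly in $t$ as $h\to h_0^+$. 2. (Tetrahedral–cube collision.) Let $i\in\{1,2\}$ and $u_0\in\mathcal T_i$. Then for each of the four vertices $p$ of $\mathcal T_i$ exactly three of the indices $j\in\{1,\dots,12\}$ satisfy $g_ju_0=p$. There are $h_1\in\mathbb R$ and a $\mathbb T$-symmetric periodic family at $\rho(u_0)$, parametrised by $h\in(h_1,\infty)$, such that $v_h(t)\to\rho(u_0)$ uniformly in $t$ and $\tau(h)\to0$ as $h\to\infty$. (So a triple of vortices travels along a loop around each vertex of the tetrahedron $\mathcal T_i$.) 3. (Octahedral–cube collision.) Let $u_0\in\mathcal O$. Then for each of the six vertices $p\in\mathcal O$ exactly two of the indices $j\in\{1,\dots,12\}$ satisfy $g_ju_0=p$. There are $h_1\in\mathbb R$ and a $\mathbb T$-symmetric periodic family at $\rho(u_0)$, parametrised by $h\in(h_1,\infty)$, such that $v_h(t)\to\rho(u_0)$ uniformly in $t$ and $\tau(h)\to0$ as $h\to\infty$. (So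 a pair of vortices travels along a loop around each vertex of the octahedron.) -/

import Mathlib

open Set Filter Topology

noncomputable section

namespace SphereVortex

/-! ### The equations of motion of `N` identical vortices on the unit sphere -/

/-- Euclidean three-space. -/
abbrev E3 : Type := EuclideanSpace ℝ (Fin 3)

/-- The unit sphere of `E3`. -/
abbrev S2 : Set E3 := Metric.sphere (0 : E3) 1

/-- The vector product. -/
def cross (x y : E3) : E3 := WithLp.toLp 2 (crossProduct x.ofLp y.ofLp)

/-- The right-hand side `∑_{i ≠ j} (v_i × v_j) / |v_j - v_i|²` of the equation of motion of the
`j`-th vortex. -/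
def vortexField {N : ℕ} (v : Fin N → E3) (j : Fin N) : E3 :=
  ∑ i ∈ Finset.univ.erase j, (‖v j - v i‖ ^ 2)⁻¹ • cross (v i) (v j)

/-- The Hamiltonian `H(v) = -(1/2) ∑_{i<j} ln |v_j - v_i|²`. -/
def energy {N : ℕ} (v : Fin N → E3) : ℝ :=
  -(1 / 2) * ∑ j : Fin N, ∑ i ∈ Finset.univ.filter (fun i => i < j), Real.log (‖v j - v i‖ ^ 2)

/-- A collision-free configuration: all vortices on the sphere, at pairwise distinct positions. -/
def IsCollisionFree {N : ℕ} (v : Fin N → E3) : Prop :=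
  (∀ j, v j ∈ S2) ∧ Function.Injective v

/-- A (collision-free, globally defined) solution of the equations of motion. -/
def IsSolution {N : ℕ} (v : ℝ → Fin N → E3) : Prop :=
  ∀ t : ℝ, IsCollisionFree (v t) ∧
    ∀ j : Fin N, HasDerivAt (fun s : ℝ => v s j) (vortexField (v t) j) t

/-- A (collision-free) equilibrium of the equations of motion. -/
def IsEquilibrium {N : ℕ} (v : Fin N → E3) : Prop :=
  IsCollisionFree v ∧ ∀ j, vortexField v j = 0

/-! ### The tetrahedral group and the polyhedra -/

/-- The rotation group `SO(3)`. -/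
abbrev SO3 : Type := Matrix.specialOrthogonalGroup (Fin 3) ℝ

/-- The action of a rotation on a vector. -/
def rot (g : SO3) (x : E3) : E3 := WithLp.toLp 2 (Matrix.mulVec (g : Matrix (Fin 3) (Fin 3) ℝ) x.ofLp)

lemma genA_mem : (!![0, 1, 0; 0, 0, 1; 1, 0, 0] : Matrix (Fin 3) (Fin 3) ℝ) ∈
    Matrix.specialOrthogonalGroup (Fin 3) ℝ := by
  rw [Matrix.mem_specialOrthogonalGroup_iff, Matrix.mem_orthogonalGroup_iff]
  refine ⟨?_, ?_⟩
  · ext i j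
    fin_cases i <;> fin_cases j <;> simp [Matrix.mul_apply, Fin.sum_univ_three]
  · simp [Matrix.det_fin_three]

lemma genB_mem : (!![1, 0, 0; 0, -1, 0; 0, 0, -1] : Matrix (Fin 3) (Fin 3) ℝ) ∈
    Matrix.specialOrthogonalGroup (Fin 3) ℝ := by
  rw [Matrix.mem_specialOrthogonalGroup_iff, Matrix.mem_orthogonalGroup_iff]
  refine ⟨?_, ?_⟩
  · ext i j
    fin_cases i <;> fin_cases j <;> simp [Matrix.mul_apply, Fin.sum_univ_three]
  · simp [Matrix.det_fin_three]

/-- The tetrahedral group `𝕋 < SO(3)`, of order 12. -/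
def tetrahedralGroup : Subgroup SO3 :=
  Subgroup.closure {⟨_, genA_mem⟩, ⟨_, genB_mem⟩}

/-- The vertices of the first tetrahedron: the points `(±1, ±1, ±1)/√3` with an even number of
minus signs. -/
def tetrahedron₁ : Set E3 :=
  {(1 / √3 : ℝ) • !₂[1, 1, 1], (1 / √3 : ℝ) • !₂[-1, -1, 1],
    (1 / √3 : ℝ) • !₂[-1, 1, -1], (1 / √3 : ℝ) • !₂[1, -1, -1]}

/-- The vertices of the antipodal tetrahedron. -/
def tetrahedron₂ : Set E3 :=
  {(1 / √3 : ℝ) • !₂[-1, -1, -1], (1 / √3 : ℝ) • !₂[1, 1, -1],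
    (1 / √3 : ℝ) • !₂[1, -1, 1], (1 / √3 : ℝ) • !₂[-1, 1, 1]}

/-- The eight vertices of the cube made up of the two tetrahedra. -/
def cube : Set E3 := tetrahedron₁ ∪ tetrahedron₂

/-- The six vertices of the octahedron dual to the cube. -/
def octahedron : Set E3 :=
  {!₂[1, 0, 0], !₂[-1, 0, 0], !₂[0, 1, 0], !₂[0, -1, 0], !₂[0, 0, 1], !₂[0, 0, -1]}

/-- The 24 points obtained from `(±φ, ±φ⁻¹, 0)/√3` by permuting the entries, where `φ` is the golden
ratio. -/
def dodecahedralPoints : Set E3 :=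
  {x | ∃ σ : Equiv.Perm (Fin 3), |x (σ 0)| = Real.goldenRatio / √3 ∧
    |x (σ 1)| = Real.goldenRatio⁻¹ / √3 ∧ x (σ 2) = 0}

/-- The 20 vertices of the standard regular dodecahedron inscribed in the unit sphere:
`(±1, ±1, ±1)/√3` and the cyclic permutations of `(0, ±φ⁻¹, ±φ)/√3`. -/
def standardDodecahedron : Set E3 :=
  cube ∪ {x | ∃ i : Fin 3, x i = 0 ∧ |x (i + 1)| = Real.goldenRatio⁻¹ / √3 ∧
    |x (i + 2)| = Real.goldenRatio / √3}

/-- `S` is the vertex set of a regular dodecahedron inscribed in the unit sphere. -/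
def IsRegularDodecahedron (S : Set E3) : Prop :=
  ∃ A : E3 ≃ₗᵢ[ℝ] E3, A '' standardDodecahedron = S

/-! ### Symmetric configurations and families of periodic solutions -/

/-- The `(𝕋, cube)`-symmetric configuration `ρ(u) = (g₁u, …, g₁₂u, f₁, …, f₈)` of 20 vortices
attached to an ordering `g` of the group `𝕋`, an ordering `f` of the vertices of the cube, and a
point `u` of the sphere. -/
def symConfig (g : Fin 12 ≃ tetrahedralGroup) (f : Fin 8 ≃ cube) (u : E3) : Fin 20 → E3 :=
  Fin.append (m := 12) (n := 8) (fun j => rot (g j) u) (fun k => (f k : E3))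

/-- `γ`, of period `τ`, traverses once per period a simple closed curve on the sphere
which goes around `p`, that is, which separates `p` from the antipodal point `-p`. -/
structure IsLoopAround (γ : ℝ → E3) (τ : ℝ) (p : E3) : Prop where
  pos : 0 < τ
  continuous : Continuous γ
  mem_sphere : ∀ t, γ t ∈ S2
  periodic : Function.Periodic γ τ
  simple : InjOn γ (Ico 0 τ)
  avoids : p ∉ range γ
  avoids_neg : -p ∉ range γ
  separates : -p ∉ connectedComponentIn (S2 \ range γ) p

/-- The solutions `v_h(t) = ρ(u_h(t))`, `h ∈ I`, form a one-parameter family of periodic solutions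
of the equations of motion of 20 vortices, with minimal periods `τ h`, parametrised by
their energy `h`, and converging to the configuration `ρ(u₀)` as `h` tends to its limiting value
(described by the filter `l`). Every one of the 12 moving vortices travels along a
simple closed loop around its limiting position; two vortices with the same limiting position share
their loop, and the loops of two vortices with distinct limiting positions are disjoint. -/
structure IsPeriodicFamily (g : Fin 12 ≃ tetrahedralGroup) (f : Fin 8 ≃ cube) (u₀ : E3)
    (I : Set ℝ) (l : Filter ℝ) (u : ℝ → ℝ → E3) (τ : ℝ → ℝ) : Prop where
  solution : ∀ h ∈ I, IsSolution (fun t => symConfig g f (u h t))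
  energy_eq : ∀ h ∈ I, ∀ t, energy (symConfig g f (u h t)) = h
  period : ∀ h ∈ I,
    IsLeast {s : ℝ | 0 < s ∧ Function.Periodic (fun t => symConfig g f (u h t)) s} (τ h)
  continuousOn : ContinuousOn (fun q : ℝ × ℝ => u q.1 q.2) (I ×ˢ univ)
  limit : TendstoUniformly (fun h t => symConfig g f (u h t)) (fun _ => symConfig g f u₀) l
  loop : ∀ h ∈ I, ∀ j, IsLoopAround (fun t => rot (g j) (u h t)) (τ h) (rot (g j) u₀)
  same_loop : ∀ h ∈ I, ∀ j k, rot (g j) u₀ = rot (g k) u₀ →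
    range (fun t => rot (g j) (u h t)) = range (fun t => rot (g k) (u h t))
  disjoint_loops : ∀ h ∈ I, ∀ j k, rot (g j) u₀ ≠ rot (g k) u₀ →
    Disjoint (range fun t => rot (g j) (u h t)) (range fun t => rot (g k) (u h t))

end SphereVortex

end

open SphereVortex

noncomputable section

namespace SphereVortex

/-! ### The vector product and the action of rotations -/

/-! By symmetry the system reduces to a single vortex. The velocity field induced by `ρ(u)` commutes
with `𝕋`, so the twelve moving vortices copy the motion of `u`; at a cube vertex the field is
tangent to the sphere and invariant under the order-three rotation about that vertex, hence zero
(`symField_cube`). Every non-trivial rotation `R` in `𝕋` has one of seven axes `a`, and `|u - Ru|²`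
is a constant times `1 - ⟨a, u⟩²`. The energy is therefore `12 ψ(u) + C` for an explicit `ψ`
(`exists_energy_eq`), and `u` obeys `u' = ∇ψ(u) × u` (`symField_self`). This is a Hamiltonian system
on the sphere with one degree of freedom: its orbits lie on the level curves of `ψ`.

Suppose that `ηψ`, with `η = ±1`, increases along every geodesic leaving `u₀` (`IsPolarExtremum`).
In geodesic polar coordinates the nearby levels are graphs `r = R(θ)` (`PolarData.exists_level`),
and on such a graph `θ' = Λ / sin r > 0`, with `Λ` the radial derivative of `ηψ`. This is solved by
quadrature, jointly continuously in the level (`exists_circle_flow`, `IsPolarExtremum.exists_flow`).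
A polar graph is a simple loop separating the poles. The stabiliser of `u₀` preserves each level,
and discs about distinct orbit points are disjoint, which gives the statements about shared and
disjoint loops (`exists_periodicFamily`).

There are two sources of such points. On a rotation axis `ψ` has a logarithmic pole, the energy
tends to `+∞`, and the angular velocity is at least a constant over `sin² r`, so the periods tend to
`0` (`exists_periodicFamily_of_axis`). A dodecahedral point has coordinates `p, q, 0` up to a cyclic
shift, with `p² + q² = 1` and `p²q² = 1/9`. These two relations suffice to show that the gradient is
radial and that the second derivative in a unit tangent direction with last component `c` is `45/8 -
7c²/4 > 0`; the point is a nondegenerate minimum (`exists_periodicFamily_of_min`). -/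

lemma cross_apply_zero (x y : E3) : cross x y 0 = x 1 * y 2 - x 2 * y 1 := by
  simp [cross, cross_apply]

lemma cross_apply_one (x y : E3) : cross x y 1 = x 2 * y 0 - x 0 * y 2 := by
  simp [cross, cross_apply]

lemma cross_apply_two (x y : E3) : cross x y 2 = x 0 * y 1 - x 1 * y 0 := by
  simp [cross, cross_apply]

lemma ext_three {x y : E3} (h0 : x 0 = y 0) (h1 : x 1 = y 1) (h2 : x 2 = y 2) : x = y := by
  ext i
  fin_cases i <;> assumption

lemma inner_eq (x y : E3) : inner ℝ x y = x 0 * y 0 + x 1 * y 1 + x 2 * y 2 := by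
  simp [PiLp.inner_apply, Fin.sum_univ_three, mul_comm]

lemma norm_sq_eq (x : E3) : ‖x‖ ^ 2 = x 0 ^ 2 + x 1 ^ 2 + x 2 ^ 2 := by
  rw [EuclideanSpace.norm_sq_eq]
  simp [Fin.sum_univ_three]

lemma mem_S2_iff {x : E3} : x ∈ S2 ↔ ‖x‖ = 1 := by simp

lemma mem_S2_iff_coord {x : E3} : x ∈ S2 ↔ x 0 ^ 2 + x 1 ^ 2 + x 2 ^ 2 = 1 := by
  rw [mem_S2_iff, ← norm_sq_eq]
  constructor
  · intro h; simp [h]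
  · intro h
    nlinarith [norm_nonneg x]

lemma cross_self_eq (x : E3) : cross x x = 0 := by
  apply ext_three <;> simp only [cross_apply_zero, cross_apply_one, cross_apply_two] <;> simp <;> ring

lemma cross_smul_left (c : ℝ) (x y : E3) : cross (c • x) y = c • cross x y := by
  apply ext_three <;> simp [cross_apply_zero, cross_apply_one, cross_apply_two] <;> ring

lemma cross_add_left (x x' y : E3) : cross (x + x') y = cross x y + cross x' y := by
  apply ext_three <;> simp [cross_apply_zero, cross_apply_one, cross_apply_two] <;> ring

lemma cross_smul_right (c : ℝ) (x y : E3) : cross x (c • y) = c • cross x y := by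
  apply ext_three <;> simp [cross_apply_zero, cross_apply_one, cross_apply_two] <;> ring

lemma cross_add_right (x y y' : E3) : cross x (y + y') = cross x y + cross x y' := by
  apply ext_three <;> simp [cross_apply_zero, cross_apply_one, cross_apply_two] <;> ring

lemma cross_sum_left {ι : Type*} (s : Finset ι) (F : ι → E3) (y : E3) :
    cross (∑ i ∈ s, F i) y = ∑ i ∈ s, cross (F i) y := by
  classical
  induction s using Finset.induction_on with
  | empty =>
    apply ext_three <;> simp [cross_apply_zero, cross_apply_one, cross_apply_two]
  | insert a s ha ih => rw [Finset.sum_insert ha, Finset.sum_insert ha, cross_add_left, ih]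

lemma cross_anticomm_eq (x y : E3) : cross x y = -cross y x := by
  apply ext_three <;> simp [cross_apply_zero, cross_apply_one, cross_apply_two] <;> ring

/-- The triple product expansion `a × (b × c) = ⟨a, c⟩ b - ⟨a, b⟩ c`. -/
lemma cross_cross_eq (a b c : E3) :
    cross a (cross b c) = inner ℝ a c • b - inner ℝ a b • c := by
  apply ext_three <;>
    simp only [cross_apply_zero, cross_apply_one, cross_apply_two, inner_eq, PiLp.sub_apply,
      PiLp.smul_apply, smul_eq_mul] <;> ring

lemma inner_cross_self (x y : E3) : inner ℝ (cross x y) y = 0 := by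
  simp only [cross_apply_zero, cross_apply_one, cross_apply_two, inner_eq]
  ring

lemma rot_apply (g : SO3) (x : E3) (i : Fin 3) :
    rot g x i = ∑ j, (g : Matrix (Fin 3) (Fin 3) ℝ) i j * x j := by
  simp [rot, Matrix.mulVec, dotProduct]

lemma rot_one (x : E3) : rot 1 x = x := by
  simp [rot]

lemma rot_mul (g h : SO3) (x : E3) : rot (g * h) x = rot g (rot h x) := by
  simp [rot, Matrix.mulVec_mulVec]

lemma rot_add (g : SO3) (x y : E3) : rot g (x + y) = rot g x + rot g y := by
  simp [rot, Matrix.mulVec_add]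

lemma rot_smul (g : SO3) (c : ℝ) (x : E3) : rot g (c • x) = c • rot g x := by
  simp [rot, Matrix.mulVec_smul]

lemma rot_neg (g : SO3) (x : E3) : rot g (-x) = -rot g x := by
  simpa using rot_smul g (-1) x

lemma rot_sub (g : SO3) (x y : E3) : rot g (x - y) = rot g x - rot g y := by
  rw [sub_eq_add_neg, rot_add, rot_neg, sub_eq_add_neg]

lemma rot_zero (g : SO3) : rot g 0 = 0 := by
  simpa using rot_smul g 0 0

lemma rot_sum {ι : Type*} (g : SO3) (s : Finset ι) (F : ι → E3) :
    rot g (∑ i ∈ s, F i) = ∑ i ∈ s, rot g (F i) := by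
  classical
  induction s using Finset.induction_on with
  | empty => simp [rot_zero]
  | insert a s ha ih => rw [Finset.sum_insert ha, Finset.sum_insert ha, rot_add, ih]

lemma rot_inv_rot (g : SO3) (x : E3) : rot g⁻¹ (rot g x) = x := by
  rw [← rot_mul, inv_mul_cancel, rot_one]

lemma rot_rot_inv (g : SO3) (x : E3) : rot g (rot g⁻¹ x) = x := by
  rw [← rot_mul, mul_inv_cancel, rot_one]

lemma rot_injective (g : SO3) : Function.Injective (rot g) := fun x y h => by
  rw [← rot_inv_rot g x, h, rot_inv_rot]

lemma eq_of_rot_eq {g h : SO3} (H : ∀ x, rot g x = rot h x) : g = h := by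
  apply Subtype.ext
  ext i j
  have := congrArg (fun v : E3 => v i) (H (EuclideanSpace.single j 1))
  simpa [rot_apply, PiLp.single_apply] using this

/-! ### The elements of the tetrahedral group -/

/-- The rotation by `2π/3` about `(1, 1, 1)`. -/
def genA : SO3 := ⟨_, genA_mem⟩

/-- The rotation by `π` about the first coordinate axis. -/
def genB : SO3 := ⟨_, genB_mem⟩


/-- The four sign vectors with an even number of minus signs. -/
def sgn : Fin 4 → Fin 3 → ℤ := ![![1, 1, 1], ![1, -1, -1], ![-1, 1, -1], ![-1, -1, 1]]

/-- The three powers of the rotation by `2π/3` about `(1, 1, 1)`. -/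
def tetCyc : Fin 3 → SO3 := ![1, genA, genA * genA]

/-- The four diagonal elements of the tetrahedral group. -/
def tetDiag : Fin 4 → SO3 :=
  ![1, genB, genA * genA * genB * genA,
    genA * genB * (genA * genA)]

/-- The elements of the tetrahedral group. -/
def tetElt (p : Fin 3 × Fin 4) : SO3 := tetDiag p.2 * tetCyc p.1

lemma rot_genA (x : E3) (i : Fin 3) : rot genA x i = x (i + 1) := by
  rw [rot_apply]
  fin_cases i <;> simp [Fin.sum_univ_three, genA]

lemma rot_genB (x : E3) (i : Fin 3) : rot genB x i = sgn 1 i * x i := by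
  rw [rot_apply]
  fin_cases i <;> simp [Fin.sum_univ_three, sgn, genB]

lemma rot_tetCyc (k : Fin 3) (x : E3) (i : Fin 3) : rot (tetCyc k) x i = x (i + k) := by
  fin_cases k
  · simp [tetCyc, rot_one]
  · simp [tetCyc, rot_genA]
  · simp [tetCyc, rot_mul, rot_genA, add_assoc]

lemma rot_tetDiag (a : Fin 4) (x : E3) (i : Fin 3) : rot (tetDiag a) x i = sgn a i * x i := by
  fin_cases a
  · fin_cases i <;> simp [tetDiag, rot_one, sgn]
  · simp [tetDiag, rot_genB]
  · fin_cases i <;> simp [tetDiag, rot_mul, rot_genA, rot_genB, sgn]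
  · fin_cases i <;> simp [tetDiag, rot_mul, rot_genA, rot_genB, sgn]

lemma rot_tetElt (p : Fin 3 × Fin 4) (x : E3) (i : Fin 3) :
    rot (tetElt p) x i = sgn p.2 i * x (i + p.1) := by
  rw [tetElt, rot_mul, rot_tetDiag, rot_tetCyc]

lemma tetElt_mem (p : Fin 3 × Fin 4) : tetElt p ∈ tetrahedralGroup := by
  have hA : (genA : SO3) ∈ tetrahedralGroup := Subgroup.subset_closure (by simp [genA])
  have hB : (genB : SO3) ∈ tetrahedralGroup := Subgroup.subset_closure (by simp [genB])
  apply mul_mem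
  · obtain ⟨k, a⟩ := p
    fin_cases a
    · exact one_mem _
    · exact hB
    · exact mul_mem (mul_mem (mul_mem hA hA) hB) hA
    · exact mul_mem (mul_mem hA hB) (mul_mem hA hA)
  · obtain ⟨k, a⟩ := p
    fin_cases k
    · exact one_mem _
    · exact hA
    · exact mul_mem hA hA

lemma sgn_mul_sgn : ∀ (a b : Fin 4) (k : Fin 3), ∃ c, ∀ i, sgn a i * sgn b (i + k) = sgn c i := by
  decide

lemma sgn_sub : ∀ (a : Fin 4) (k : Fin 3), ∃ c, ∀ i, sgn a (i - k) = sgn c i := by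
  decide

lemma sgn_mul_self : ∀ (a : Fin 4) (i : Fin 3), sgn a i * sgn a i = 1 := by
  decide

lemma sgn_mul_self_real (a : Fin 4) (i : Fin 3) : (sgn a i : ℝ) * sgn a i = 1 := by
  exact_mod_cast sgn_mul_self a i

/-- The normal form "cyclic shift followed by an even sign change" holds for both generators and is
stable under products and inverses, by `sgn_mul_sgn` and `sgn_sub`. -/
lemma exists_tetElt {g : SO3} (hg : g ∈ tetrahedralGroup) : ∃ p, tetElt p = g := by
  suffices h : ∃ p : Fin 3 × Fin 4, ∀ (x : E3) i, rot g x i = sgn p.2 i * x (i + p.1) by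
    obtain ⟨p, hp⟩ := h
    refine ⟨p, eq_of_rot_eq fun x => ?_⟩
    ext i
    rw [hp, rot_tetElt]
  induction hg using Subgroup.closure_induction with
  | mem g hg =>
    rcases hg with rfl | rfl
    · exact ⟨(1, 0), fun x i => by rw [← genA, rot_genA]; fin_cases i <;> simp [sgn]⟩
    · exact ⟨(0, 1), fun x i => by rw [← genB, rot_genB]; simp⟩
  | one => exact ⟨(0, 0), fun x i => by rw [rot_one]; fin_cases i <;> simp [sgn]⟩
  | mul g h _ _ ihg ihh =>
    obtain ⟨⟨k, a⟩, hp⟩ := ihg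
    obtain ⟨⟨l, b⟩, hq⟩ := ihh
    obtain ⟨c, hc⟩ := sgn_mul_sgn a b k
    refine ⟨(k + l, c), fun x i => ?_⟩
    rw [rot_mul, hp, hq, ← mul_assoc, ← Int.cast_mul]
    simp only
    rw [hc, add_assoc]
  | inv g _ ih =>
    obtain ⟨⟨k, a⟩, hp⟩ := ih
    obtain ⟨c, hc⟩ := sgn_sub a k
    refine ⟨(-k, c), fun x i => ?_⟩
    have h := hp (rot g⁻¹ x) (i - k)
    rw [rot_rot_inv] at h
    simp only [sub_add_cancel] at h
    simp only
    rw [← hc, ← sub_eq_add_neg, h, ← mul_assoc, sgn_mul_self_real, one_mul]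

lemma tetElt_injective : Function.Injective tetElt := by
  -- The vector `(1, 2, 4)` has distinct positive entries, so its image determines both the shift
  -- and the signs.
  have key : ∀ p q : Fin 3 × Fin 4,
      (∀ i, sgn p.2 i * (![1, 2, 4] : Fin 3 → ℤ) (i + p.1) = sgn q.2 i * ![1, 2, 4] (i + q.1)) →
      p = q := by decide
  intro p q h
  apply key
  intro i
  have h1 := rot_tetElt p (WithLp.toLp 2 fun j => ((![1, 2, 4] : Fin 3 → ℤ) j : ℝ)) i
  rw [h, rot_tetElt] at h1
  simp only at h1
  exact_mod_cast h1.symm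

/-- The enumeration of the tetrahedral group. -/
def tetEquiv : Fin 3 × Fin 4 ≃ tetrahedralGroup :=
  Equiv.ofBijective (fun p => ⟨tetElt p, tetElt_mem p⟩)
    ⟨fun p q h => tetElt_injective (congrArg Subtype.val h),
      fun g => by
        obtain ⟨p, hp⟩ := exists_tetElt g.2
        exact ⟨p, Subtype.ext hp⟩⟩

lemma coe_tetEquiv (p : Fin 3 × Fin 4) : (tetEquiv p : SO3) = tetElt p := rfl

lemma inner_rot {g : SO3} (hg : g ∈ tetrahedralGroup) (x y : E3) :
    inner ℝ (rot g x) (rot g y) = inner ℝ x y := by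
  obtain ⟨⟨k, a⟩, rfl⟩ := exists_tetElt hg
  simp only [inner_eq, rot_tetElt]
  have h0 := sgn_mul_self_real a 0
  have h1 := sgn_mul_self_real a 1
  have h2 := sgn_mul_self_real a 2
  have e : ∀ (s : ℝ), s * s = 1 → ∀ u v : ℝ, s * u * (s * v) = u * v := fun s hs u v => by
    linear_combination u * v * hs
  rw [e _ h0, e _ h1, e _ h2]
  fin_cases k <;> simp <;> ring

lemma norm_rot {g : SO3} (hg : g ∈ tetrahedralGroup) (x : E3) : ‖rot g x‖ = ‖x‖ := by
  rw [@norm_eq_sqrt_real_inner _ _ _ (rot g x), inner_rot hg, ← norm_eq_sqrt_real_inner]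

lemma norm_rot_sub {g : SO3} (hg : g ∈ tetrahedralGroup) (x y : E3) :
    ‖rot g x - rot g y‖ = ‖x - y‖ := by
  rw [← rot_sub, norm_rot hg]

lemma dist_rot {g : SO3} (hg : g ∈ tetrahedralGroup) (x y : E3) :
    dist (rot g x) (rot g y) = dist x y := by
  rw [dist_eq_norm, dist_eq_norm, norm_rot_sub hg]

lemma rot_mem_S2 {g : SO3} (hg : g ∈ tetrahedralGroup) {x : E3} (hx : x ∈ S2) : rot g x ∈ S2 := by
  rw [mem_S2_iff] at *
  rw [norm_rot hg, hx]

lemma cross_rot {g : SO3} (hg : g ∈ tetrahedralGroup) (x y : E3) :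
    cross (rot g x) (rot g y) = rot g (cross x y) := by
  obtain ⟨⟨k, a⟩, rfl⟩ := exists_tetElt hg
  fin_cases k <;> fin_cases a <;> apply ext_three <;>
    simp [cross_apply_zero, cross_apply_one, cross_apply_two, rot_tetElt, sgn] <;> ring

lemma continuous_rot (g : SO3) : Continuous (rot g) := by
  unfold rot
  fun_prop

end SphereVortex

namespace SphereVortex

/-! ### The vertices of the cube -/

/-- The vertices of the first tetrahedron. -/
def vert (a : Fin 4) : E3 := (1 / √3 : ℝ) • WithLp.toLp 2 fun i => (sgn a i : ℝ)

lemma vert_apply (a : Fin 4) (i : Fin 3) : vert a i = (1 / √3) * sgn a i := by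
  simp [vert]

lemma one_div_sqrt_three_sq : (1 / √3 : ℝ) ^ 2 = 1 / 3 := by
  rw [div_pow, Real.sq_sqrt (by norm_num)]; norm_num

lemma inner_vert_vert (a b : Fin 4) :
    inner ℝ (vert a) (vert b) = if a = b then 1 else -1 / 3 := by
  have h := one_div_sqrt_three_sq
  simp only [inner_eq, vert_apply]
  fin_cases a <;> fin_cases b <;> simp [sgn] <;> field_simp <;> norm_num

lemma vert_zero : vert 0 = (1 / √3 : ℝ) • !₂[1, 1, 1] := by
  apply ext_three <;> simp [vert_apply, sgn]

lemma vert_one : vert 1 = (1 / √3 : ℝ) • !₂[1, -1, -1] := by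
  apply ext_three <;> simp [vert_apply, sgn]

lemma vert_two : vert 2 = (1 / √3 : ℝ) • !₂[-1, 1, -1] := by
  apply ext_three <;> simp [vert_apply, sgn]

lemma vert_three : vert 3 = (1 / √3 : ℝ) • !₂[-1, -1, 1] := by
  apply ext_three <;> simp [vert_apply, sgn]

lemma range_vert : range vert = tetrahedron₁ := by
  ext x
  simp only [mem_range, Fin.exists_fin_succ, tetrahedron₁, mem_insert_iff, mem_singleton_iff]
  simp only [Fin.succ_zero_eq_one, Fin.succ_one_eq_two, IsEmpty.exists_iff, or_false]
  rw [show (Fin.succ 2 : Fin 4) = 3 from rfl, vert_zero, vert_one, vert_two, vert_three]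
  tauto

lemma range_neg_vert : (range fun a => -vert a) = tetrahedron₂ := by
  ext x
  simp only [mem_range, Fin.exists_fin_succ, tetrahedron₂, mem_insert_iff, mem_singleton_iff]
  simp only [Fin.succ_zero_eq_one, Fin.succ_one_eq_two, IsEmpty.exists_iff, or_false]
  rw [show (Fin.succ 2 : Fin 4) = 3 from rfl, vert_zero, vert_one, vert_two, vert_three,
    ← smul_neg, ← smul_neg, ← smul_neg, ← smul_neg]
  have e : ∀ a b c : ℝ, -!₂[a, b, c] = !₂[-a, -b, -c] := fun a b c => by
    apply ext_three <;> simp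
  simp only [e, neg_neg]
  tauto

/-- The vertices of the cube. -/
def cubeVert : Fin 4 ⊕ Fin 4 → E3 := Sum.elim vert fun a => -vert a

lemma range_cubeVert : range cubeVert = cube := by
  rw [cubeVert, Sum.elim_range, range_vert, range_neg_vert, cube]

lemma cubeVert_injective : Function.Injective cubeVert := by
  have key : ∀ a b : Fin 4, inner ℝ (vert a) (vert b) = (1 : ℝ) → a = b := fun a b h => by
    by_contra hne
    rw [inner_vert_vert, if_neg hne] at h
    norm_num at h
  have key' : ∀ a b : Fin 4, inner ℝ (vert a) (vert b) ≠ (-1 : ℝ) := fun a b h => by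
    rw [inner_vert_vert] at h
    split_ifs at h <;> norm_num at h
  have self : ∀ a, inner ℝ (vert a) (vert a) = (1 : ℝ) := fun a => by
    rw [inner_vert_vert, if_pos rfl]
  rintro (a | a) (b | b) h
  · rw [key a b (by rw [show vert a = vert b from h, self])]
  · exact (key' a b (by rw [show vert a = -vert b from h, inner_neg_left, self])).elim
  · exact (key' a b (by rw [show vert b = -vert a from h.symm, inner_neg_right, self])).elim
  · rw [key a b (by rw [show vert a = vert b from neg_injective h, self])]

/-- The enumeration of the vertices of the cube. -/
def cubeEquiv : Fin 4 ⊕ Fin 4 ≃ cube :=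
  Equiv.ofBijective (fun c => ⟨cubeVert c, range_cubeVert ▸ mem_range_self c⟩)
    ⟨fun p q h => cubeVert_injective (congrArg Subtype.val h),
      fun x => by
        obtain ⟨c, hc⟩ : (x : E3) ∈ range cubeVert := by rw [range_cubeVert]; exact x.2
        exact ⟨c, Subtype.ext hc⟩⟩

lemma rot_vert {g : SO3} (hg : g ∈ tetrahedralGroup) (a : Fin 4) : ∃ b, rot g (vert a) = vert b := by
  obtain ⟨⟨k, c⟩, rfl⟩ := exists_tetElt hg
  obtain ⟨b, hb⟩ := sgn_mul_sgn c a k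
  refine ⟨b, ?_⟩
  ext i
  rw [rot_tetElt, vert_apply, vert_apply, ← hb]
  push_cast
  ring

lemma rot_mem_cube {g : SO3} (hg : g ∈ tetrahedralGroup) {x : E3} (hx : x ∈ cube) :
    rot g x ∈ cube := by
  rw [← range_cubeVert] at *
  obtain ⟨a | a, rfl⟩ := hx
  · obtain ⟨b, hb⟩ := rot_vert hg a
    exact ⟨Sum.inl b, hb.symm⟩
  · obtain ⟨b, hb⟩ := rot_vert hg a
    exact ⟨Sum.inr b, by simp [cubeVert, rot_neg, hb]⟩

/-- The permutation of the vertices of the cube given by a rotation in the tetrahedral group. -/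
def cubePerm (γ : tetrahedralGroup) : cube ≃ cube where
  toFun x := ⟨rot γ x, rot_mem_cube γ.2 x.2⟩
  invFun x := ⟨rot γ⁻¹ x, rot_mem_cube (inv_mem γ.2) x.2⟩
  left_inv _ := Subtype.ext (rot_inv_rot _ _)
  right_inv _ := Subtype.ext (rot_rot_inv _ _)

lemma norm_vert (a : Fin 4) : ‖vert a‖ = 1 := by
  rw [norm_eq_sqrt_real_inner (vert a), inner_vert_vert, if_pos rfl, Real.sqrt_one]

lemma cube_subset_S2 : cube ⊆ S2 := by
  intro x hx
  rw [← range_cubeVert] at hx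
  obtain ⟨a | a, rfl⟩ := hx <;> simp [cubeVert, norm_vert]

/-! ### Sums over symmetric configurations -/

variable (g : Fin 12 ≃ tetrahedralGroup) (f : Fin 8 ≃ cube)

lemma symConfig_castAdd (u : E3) (j : Fin 12) :
    symConfig g f u (Fin.castAdd 8 j) = rot (g j) u := by
  simp [symConfig]

lemma symConfig_natAdd (u : E3) (k : Fin 8) :
    symConfig g f u (Fin.natAdd 12 k) = f k := by
  simp [symConfig]

lemma sum_fin_twenty {M : Type*} [AddCommMonoid M] (F : Fin 20 → M) :
    ∑ i, F i = ∑ j : Fin 12, F (Fin.castAdd 8 j) + ∑ k : Fin 8, F (Fin.natAdd 12 k) :=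
  Fin.sum_univ_add (a := 12) (b := 8) F

/-- Left translation serves the equivariance of the field; right translation (`sum_mul_right`)
serves the invariance of the energy when `u` is replaced by `rot γ u`. -/
lemma sum_mul_left {M : Type*} [AddCommMonoid M] (γ : tetrahedralGroup)
    (F : tetrahedralGroup → M) : ∑ j, F (γ * g j) = ∑ j, F (g j) := by
  rw [← Equiv.sum_comp ((g.trans (Equiv.mulLeft γ)).trans g.symm) fun j => F (g j)]
  simp

lemma sum_mul_right {M : Type*} [AddCommMonoid M] (γ : tetrahedralGroup)
    (F : tetrahedralGroup → M) : ∑ j, F (g j * γ) = ∑ j, F (g j) := by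
  rw [← Equiv.sum_comp ((g.trans (Equiv.mulRight γ)).trans g.symm) fun j => F (g j)]
  simp

lemma sum_tet {M : Type*} [AddCommMonoid M] (F : tetrahedralGroup → M) :
    ∑ j, F (g j) = ∑ p, F (tetEquiv p) := by
  rw [← Equiv.sum_comp (g.trans tetEquiv.symm) fun p => F (tetEquiv p)]
  simp

lemma sum_cubePerm {M : Type*} [AddCommMonoid M] (γ : tetrahedralGroup) (F : E3 → M) :
    ∑ k, F (rot γ (f k)) = ∑ k, F (f k) := by
  rw [← Equiv.sum_comp ((f.trans (cubePerm γ)).trans f.symm) fun k => F (f k)]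
  simp [cubePerm]

lemma sum_cube {M : Type*} [AddCommMonoid M] (F : E3 → M) :
    ∑ k, F (f k) = ∑ a, (F (vert a) + F (-vert a)) := by
  rw [Finset.sum_add_distrib]
  have := Equiv.sum_comp (f.trans cubeEquiv.symm) fun c => F (cubeEquiv c)
  rw [Fintype.sum_sum_type] at this
  simpa [cubeEquiv, cubeVert] using this

/-! ### The vector field of a symmetric configuration -/

/-- The diagonal term may be included because `v × v = 0`, whatever value the inverse of `0` takes.
-/
lemma vortexField_eq_sum {N : ℕ} (v : Fin N → E3) (j : Fin N) :
    vortexField v j = ∑ i, (‖v j - v i‖ ^ 2)⁻¹ • cross (v i) (v j) := by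
  rw [vortexField, ← Finset.add_sum_erase _ _ (Finset.mem_univ j), cross_self_eq, smul_zero,
    zero_add]

/-- The velocity which the configuration `ρ(u)` induces at a point `w`. -/
def symField (u w : E3) : E3 :=
  ∑ j, (‖w - rot (g j) u‖ ^ 2)⁻¹ • cross (rot (g j) u) w +
    ∑ k, (‖w - f k‖ ^ 2)⁻¹ • cross (f k) w

lemma vortexField_symConfig (u : E3) (j : Fin 20) :
    vortexField (symConfig g f u) j = symField g f u (symConfig g f u j) := by
  rw [vortexField_eq_sum, sum_fin_twenty, symField]
  simp only [symConfig_castAdd, symConfig_natAdd]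

lemma symField_rot (γ : tetrahedralGroup) (u w : E3) :
    symField g f u (rot γ w) = rot γ (symField g f u w) := by
  simp only [symField, rot_add, rot_sum]
  congr 1
  · rw [← sum_mul_left g γ fun δ : tetrahedralGroup =>
      (‖rot γ w - rot δ u‖ ^ 2)⁻¹ • cross (rot δ u) (rot γ w)]
    refine Finset.sum_congr rfl fun j _ => ?_
    rw [Subgroup.coe_mul, rot_mul, norm_rot_sub γ.2, cross_rot γ.2, rot_smul]
  · rw [← sum_cubePerm f γ fun x => (‖rot γ w - x‖ ^ 2)⁻¹ • cross x (rot γ w)]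
    refine Finset.sum_congr rfl fun j _ => ?_
    rw [norm_rot_sub γ.2, cross_rot γ.2, rot_smul]

lemma inner_symField (u w : E3) : inner ℝ (symField g f u w) w = 0 := by
  simp [symField, inner_add_left, sum_inner, inner_smul_left, inner_cross_self]

/-- With these signs the shift by one fixes `vert a`: it is a rotation of order three about that
vertex. -/
lemma exists_sgn_stabilizer : ∀ a : Fin 4, ∃ c, ∀ i, sgn c i = sgn a i * sgn a (i + 1) := by
  decide

/-- The fixed vectors of the order-three rotation about `vert a` are the multiples of `vert a`. -/
lemma eq_zero_of_rot_eq {a c : Fin 4} (hc : ∀ i, sgn c i = sgn a i * sgn a (i + 1)) {V : E3}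
    (hV : rot (tetElt (1, c)) V = V) (hin : inner ℝ V (vert a) = 0) : V = 0 := by
  have h : ∀ i, V i = sgn a i * sgn a (i + 1) * V (i + 1) := fun i => by
    have := rot_tetElt (1, c) V i
    rw [hV, hc] at this
    simpa using this
  have h0 := h 0
  have h1 := h 1
  have s0 := sgn_mul_self_real a 0
  have s1 := sgn_mul_self_real a 1
  have s2 := sgn_mul_self_real a 2
  simp only [zero_add, show (1 + 1 : Fin 3) = 2 from rfl, inner_eq, vert_apply] at *
  have hpos : (1 / √3 : ℝ) ≠ 0 := by positivity
  have h3 : V 0 * sgn a 0 + V 1 * sgn a 1 + V 2 * sgn a 2 = 0 := by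
    apply mul_left_cancel₀ hpos
    linear_combination hin
  have e0 : sgn a 0 * V 0 = sgn a 1 * V 1 := by
    linear_combination (sgn a 0 : ℝ) * h0 + s0 * sgn a 1 * V 1
  have e1 : sgn a 1 * V 1 = sgn a 2 * V 2 := by
    linear_combination (sgn a 1 : ℝ) * h1 + s1 * sgn a 2 * V 2
  have z2 : sgn a 2 * V 2 = 0 := by linarith
  have z1 : sgn a 1 * V 1 = 0 := by linarith
  have z0 : sgn a 0 * V 0 = 0 := by linarith
  apply ext_three
  · simpa using show V 0 = 0 by linear_combination (sgn a 0 : ℝ) * z0 - s0 * V 0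
  · simpa using show V 1 = 0 by linear_combination (sgn a 1 : ℝ) * z1 - s1 * V 1
  · simpa using show V 2 = 0 by linear_combination (sgn a 2 : ℝ) * z2 - s2 * V 2

/-- The stabiliser of a cube vertex fixes the field there by equivariance, and the field is tangent
to the sphere, so `eq_zero_of_rot_eq` applies. The argument is pure symmetry and holds for every
`u`. -/
lemma symField_cube (u : E3) (x : cube) : symField g f u x = 0 := by
  have hx : (x : E3) ∈ range cubeVert := by rw [range_cubeVert]; exact x.2
  obtain ⟨a, ε, hε, hx⟩ : ∃ a, ∃ ε : ℝ, ε ≠ 0 ∧ (x : E3) = ε • vert a := by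
    obtain ⟨a | a, hx⟩ := hx
    · exact ⟨a, 1, one_ne_zero, by rw [← hx]; simp [cubeVert]⟩
    · exact ⟨a, -1, by norm_num, by rw [← hx]; simp [cubeVert]⟩
  obtain ⟨c, hc⟩ := exists_sgn_stabilizer a
  apply eq_zero_of_rot_eq hc
  · have := symField_rot g f (tetEquiv (1, c)) u x
    rw [coe_tetEquiv] at this
    rw [← this]
    congr 1
    rw [hx, rot_smul]
    congr 1
    ext i
    rw [rot_tetElt, vert_apply, vert_apply, hc]
    push_cast
    linear_combination (1 / √3) * (sgn a i : ℝ) * sgn_mul_self_real a (i + 1)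
  · have := inner_symField g f u x
    rw [hx, inner_smul_right] at this
    rw [hx]
    exact (mul_eq_zero.1 this).resolve_left hε

lemma vortexField_natAdd (u : E3) (k : Fin 8) :
    vortexField (symConfig g f u) (Fin.natAdd 12 k) = 0 := by
  rw [vortexField_symConfig, symConfig_natAdd, symField_cube]

lemma vortexField_castAdd (u : E3) (j : Fin 12) :
    vortexField (symConfig g f u) (Fin.castAdd 8 j) = rot (g j) (symField g f u u) := by
  rw [vortexField_symConfig, symConfig_castAdd, symField_rot]

end SphereVortex

namespace SphereVortex

/-! ### The reduced Hamiltonian -/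

/-- The seven rotation axes of the tetrahedral group. -/
def axis : Fin 3 ⊕ Fin 4 → E3 := Sum.elim (fun i => EuclideanSpace.single i 1) vert

/-- The weights with which the axes enter into the reduced Hamiltonian. -/
def weight : Fin 3 ⊕ Fin 4 → ℝ := Sum.elim (fun _ => 1 / 4) fun _ => 1

/-- The reduced Hamiltonian, up to a factor and an additive constant. -/
def psi (u : E3) : ℝ := -∑ k, weight k * Real.log (1 - inner ℝ (axis k) u ^ 2)

/-- The gradient of the reduced Hamiltonian. -/
def gradPsi (u : E3) : E3 :=
  ∑ k, (2 * weight k * inner ℝ (axis k) u / (1 - inner ℝ (axis k) u ^ 2)) • axis k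

/-- The points of the sphere off all the rotation axes. -/
def IsRegular (u : E3) : Prop := u ∈ S2 ∧ ∀ k, inner ℝ (axis k) u ^ 2 < 1

lemma weight_pos (k : Fin 3 ⊕ Fin 4) : 0 < weight k := by
  rcases k with i | a <;> simp [weight]

lemma norm_axis (k : Fin 3 ⊕ Fin 4) : ‖axis k‖ = 1 := by
  rcases k with i | a
  · simp [axis]
  · exact norm_vert a

lemma inner_vert (a : Fin 4) (u : E3) :
    inner ℝ (vert a) u = 1 / √3 * (sgn a 0 * u 0 + sgn a 1 * u 1 + sgn a 2 * u 2) := by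
  rw [inner_eq]
  simp only [vert_apply]
  ring

lemma inner_vert_sq (a : Fin 4) (u : E3) :
    inner ℝ (vert a) u ^ 2 = (sgn a 0 * u 0 + sgn a 1 * u 1 + sgn a 2 * u 2) ^ 2 / 3 := by
  rw [inner_vert, mul_pow, one_div_sqrt_three_sq]
  ring

lemma inner_axis_inl (i : Fin 3) (u : E3) : inner ℝ (axis (Sum.inl i)) u = u i := by
  simp [axis, EuclideanSpace.inner_single_left]

lemma inner_axis_inr (a : Fin 4) (u : E3) : inner ℝ (axis (Sum.inr a)) u = inner ℝ (vert a) u := rfl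

lemma norm_sub_vert_sq {u : E3} (hu : u ∈ S2) (a : Fin 4) :
    ‖u - vert a‖ ^ 2 = 2 * (1 - inner ℝ (vert a) u) := by
  rw [norm_sub_sq_real, norm_vert, mem_S2_iff.1 hu, real_inner_comm]
  ring

lemma norm_sub_neg_vert_sq {u : E3} (hu : u ∈ S2) (a : Fin 4) :
    ‖u - -vert a‖ ^ 2 = 2 * (1 + inner ℝ (vert a) u) := by
  rw [norm_sub_sq_real, norm_neg, norm_vert, mem_S2_iff.1 hu, inner_neg_right, real_inner_comm]
  ring

/-- The axis of a nontrivial element of the tetrahedral group. -/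
def tetAxis : Fin 3 → Fin 4 → Fin 3 ⊕ Fin 4 :=
  ![![Sum.inl 0, Sum.inl 0, Sum.inl 1, Sum.inl 2], ![Sum.inr 0, Sum.inr 3, Sum.inr 1, Sum.inr 2],
    ![Sum.inr 0, Sum.inr 2, Sum.inr 3, Sum.inr 1]]

/-- The squared chord of a rotation about an axis, at a point orthogonal to the axis. -/
def chord : Fin 3 → Fin 4 → ℝ := ![![0, 4, 4, 4], ![3, 3, 3, 3], ![3, 3, 3, 3]]

/-- A rotation by angle `α` about `a` moves the component of `u` orthogonal to `a` along a chord of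
squared length `2(1 - cos α)(1 - ⟨a, u⟩²)`; the factor is `4` for a half-turn and `3` for a third of
a turn. The identity is covered by `chord 0 0 = 0` and an arbitrary axis. -/
lemma norm_sub_tetElt_sq {u : E3} (hu : u ∈ S2) (k : Fin 3) (a : Fin 4) :
    ‖u - rot (tetElt (k, a)) u‖ ^ 2 =
      chord k a * (1 - inner ℝ (axis (tetAxis k a)) u ^ 2) := by
  rw [mem_S2_iff_coord] at hu
  rw [norm_sq_eq]
  simp only [PiLp.sub_apply, rot_tetElt]
  fin_cases k <;> fin_cases a <;>
    simp [chord, tetAxis, inner_axis_inl, inner_axis_inr, inner_vert_sq, sgn]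
  · linear_combination 4 * hu
  · linear_combination 4 * hu
  · linear_combination 4 * hu
  all_goals linear_combination 3 * hu

lemma sum_prod_three_four {M : Type*} [AddCommMonoid M] (F : Fin 3 × Fin 4 → M) :
    ∑ p, F p = (F (0, 0) + F (0, 1) + F (0, 2) + F (0, 3)) +
      (F (1, 0) + F (1, 1) + F (1, 2) + F (1, 3)) +
      (F (2, 0) + F (2, 1) + F (2, 2) + F (2, 3)) := by
  rw [Fintype.sum_prod_type, Fin.sum_univ_three, Fin.sum_univ_four, Fin.sum_univ_four,
    Fin.sum_univ_four]

variable (g : Fin 12 ≃ tetrahedralGroup) (f : Fin 8 ≃ cube)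

/-- Each coordinate axis carries one half-turn, each vertex axis two rotations of order three. The
identity contributes `log 0 = 0`. -/
lemma sum_tet_log {u : E3} (hu : IsRegular u) :
    ∑ j, Real.log (‖u - rot (g j) u‖ ^ 2) =
      ∑ i : Fin 3, Real.log (1 - inner ℝ (axis (Sum.inl i)) u ^ 2) +
        2 * ∑ a : Fin 4, Real.log (1 - inner ℝ (axis (Sum.inr a)) u ^ 2) +
        (3 * Real.log 4 + 8 * Real.log 3) := by
  have hlog : ∀ (c : ℝ) (k), c ≠ 0 → Real.log (c * (1 - inner ℝ (axis k) u ^ 2)) =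
      Real.log c + Real.log (1 - inner ℝ (axis k) u ^ 2) := fun c k hc =>
    Real.log_mul hc (by linarith [hu.2 k])
  rw [sum_tet g fun γ => Real.log (‖u - rot γ u‖ ^ 2), sum_prod_three_four]
  simp only [coe_tetEquiv, norm_sub_tetElt_sq hu.1, chord, tetAxis, Matrix.cons_val]
  rw [hlog 4 _ (by norm_num), hlog 4 _ (by norm_num), hlog 4 _ (by norm_num),
    hlog 3 _ (by norm_num), hlog 3 _ (by norm_num), hlog 3 _ (by norm_num), hlog 3 _ (by norm_num),
    Fin.sum_univ_three, Fin.sum_univ_four, zero_mul, Real.log_zero]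
  ring

/-- Antipodal vertices combine: `|u - v|² |u + v|² = 4(1 - ⟨v, u⟩²)`. -/
lemma sum_cube_log {u : E3} (hu : IsRegular u) :
    ∑ k, Real.log (‖u - f k‖ ^ 2) =
      ∑ a : Fin 4, Real.log (1 - inner ℝ (axis (Sum.inr a)) u ^ 2) + 4 * Real.log 4 := by
  rw [sum_cube f fun x => Real.log (‖u - x‖ ^ 2)]
  have : ∀ a, Real.log (‖u - vert a‖ ^ 2) + Real.log (‖u - -vert a‖ ^ 2) =
      Real.log (1 - inner ℝ (axis (Sum.inr a)) u ^ 2) + Real.log 4 := fun a => by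
    have h := abs_lt.1 ((sq_lt_one_iff_abs_lt_one _).1 (hu.2 (Sum.inr a)))
    rw [inner_axis_inr] at h
    rw [norm_sub_vert_sq hu.1, norm_sub_neg_vert_sq hu.1,
      ← Real.log_mul (by linarith [h.1, h.2]) (by linarith [h.1, h.2]), inner_axis_inr,
      ← Real.log_mul (by nlinarith [h.1, h.2]) (by norm_num)]
    ring_nf
  simp only [this, Finset.sum_add_distrib]
  simp

/-- Ordered pairs count each unordered pair twice, and the diagonal adds `log 0 = 0`. -/
lemma energy_eq_sum {N : ℕ} (v : Fin N → E3) :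
    energy v = -(1 / 4) * ∑ j, ∑ i, Real.log (‖v j - v i‖ ^ 2) := by
  have h : ∑ j, ∑ i, Real.log (‖v j - v i‖ ^ 2) =
      ∑ j, ∑ i ∈ Finset.univ.filter (fun i => i < j), Real.log (‖v j - v i‖ ^ 2) +
      ∑ j, ∑ i ∈ Finset.univ.filter (fun i => j < i), Real.log (‖v j - v i‖ ^ 2) := by
    rw [← Finset.sum_add_distrib]
    refine Finset.sum_congr rfl fun j _ => ?_
    simp only [Finset.sum_filter]
    rw [← Finset.sum_add_distrib]
    refine Finset.sum_congr rfl fun i _ => ?_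
    rcases lt_trichotomy i j with h | rfl | h
    · simp [h, h.not_gt]
    · simp
    · simp [h, h.not_gt]
  have h' : ∑ j, ∑ i ∈ Finset.univ.filter (fun i => j < i), Real.log (‖v j - v i‖ ^ 2) =
      ∑ j, ∑ i ∈ Finset.univ.filter (fun i => i < j), Real.log (‖v j - v i‖ ^ 2) := by
    simp only [Finset.sum_filter]
    rw [Finset.sum_comm]
    simp only [norm_sub_rev]
  rw [h, h', energy]
  ring

/-- All twelve moving vortices see the same configuration up to a rotation, whence `-3 = -12/4`;
moving-fixed pairs occur in both orders, whence `-6 = -2 · 12/4`. -/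
lemma energy_symConfig_eq_sum (u : E3) :
    energy (symConfig g f u) = -3 * ∑ j, Real.log (‖u - rot (g j) u‖ ^ 2) -
      6 * ∑ k, Real.log (‖u - f k‖ ^ 2) -
      1 / 4 * ∑ k, ∑ l, Real.log (‖(f k : E3) - f l‖ ^ 2) := by
  have h1 : ∀ j, ∑ i, Real.log (‖rot (g j) u - rot (g i) u‖ ^ 2) =
      ∑ i, Real.log (‖u - rot (g i) u‖ ^ 2) := fun j => by
    rw [← sum_mul_left g (g j) fun δ : tetrahedralGroup => Real.log (‖rot (g j) u - rot δ u‖ ^ 2)]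
    simp only [Subgroup.coe_mul, rot_mul, norm_rot_sub (g j).2]
  have h2 : ∀ j, ∑ k, Real.log (‖rot (g j) u - f k‖ ^ 2) = ∑ k, Real.log (‖u - f k‖ ^ 2) :=
    fun j => by
      rw [← sum_cubePerm f (g j) fun x => Real.log (‖rot (g j) u - x‖ ^ 2)]
      simp only [norm_rot_sub (g j).2]
  have h3 : ∑ k, ∑ j, Real.log (‖f k - rot (g j) u‖ ^ 2) = 12 * ∑ k, Real.log (‖u - f k‖ ^ 2) := by
    rw [Finset.sum_comm]
    simp only [norm_sub_rev _ (rot _ u)]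
    simp only [h2]
    simp
  rw [energy_eq_sum, sum_fin_twenty]
  simp only [sum_fin_twenty fun i => Real.log (‖_ - symConfig g f u i‖ ^ 2), symConfig_castAdd,
    symConfig_natAdd, Finset.sum_add_distrib]
  rw [h3]
  simp only [h1, h2, Finset.sum_const, Finset.card_univ, Fintype.card_fin]
  simp only [nsmul_eq_mul]
  push_cast
  ring

lemma exists_energy_eq : ∃ C, ∀ u, IsRegular u → energy (symConfig g f u) = 12 * psi u + C := by
  refine ⟨-3 * (3 * Real.log 4 + 8 * Real.log 3) - 24 * Real.log 4 -
    1 / 4 * ∑ k, ∑ l, Real.log (‖(f k : E3) - f l‖ ^ 2), fun u hu => ?_⟩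
  rw [energy_symConfig_eq_sum, sum_tet_log g hu, sum_cube_log f hu, psi, Fintype.sum_sum_type]
  simp only [weight, Sum.elim_inl, Sum.elim_inr, ← Finset.mul_sum]
  ring

/-- Replacing `u` by `rot γ u` only permutes the moving vortices. It follows that the stabiliser of
`u₀` preserves the level curves around `u₀`. -/
lemma energy_symConfig_rot (γ : tetrahedralGroup) (u : E3) :
    energy (symConfig g f (rot γ u)) = energy (symConfig g f u) := by
  have h1 : ∑ j, ∑ i, Real.log (‖rot (g j) (rot γ u) - rot (g i) (rot γ u)‖ ^ 2) =
      ∑ j, ∑ i, Real.log (‖rot (g j) u - rot (g i) u‖ ^ 2) := by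
    simp only [← rot_mul, ← Subgroup.coe_mul]
    rw [sum_mul_right g γ fun δ : tetrahedralGroup =>
      ∑ i, Real.log (‖rot δ u - rot (g i * γ : tetrahedralGroup) u‖ ^ 2)]
    refine Finset.sum_congr rfl fun j _ => ?_
    rw [sum_mul_right g γ fun δ : tetrahedralGroup => Real.log (‖rot (g j) u - rot δ u‖ ^ 2)]
  have h2 : ∀ x : E3, ∑ j, Real.log (‖rot (g j) (rot γ u) - x‖ ^ 2) =
      ∑ j, Real.log (‖rot (g j) u - x‖ ^ 2) := fun x => by
    simp only [← rot_mul, ← Subgroup.coe_mul]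
    rw [sum_mul_right g γ fun δ : tetrahedralGroup => Real.log (‖rot δ u - x‖ ^ 2)]
  rw [energy_eq_sum, energy_eq_sum, sum_fin_twenty, sum_fin_twenty]
  simp only [sum_fin_twenty fun i => Real.log (‖_ - symConfig g f _ i‖ ^ 2), symConfig_castAdd,
    symConfig_natAdd, Finset.sum_add_distrib]
  have h3 : ∑ j, ∑ k, Real.log (‖rot (g j) (rot γ u) - f k‖ ^ 2) =
      ∑ j, ∑ k, Real.log (‖rot (g j) u - f k‖ ^ 2) := by
    rw [Finset.sum_comm, Finset.sum_congr rfl fun k _ => h2 (f k), Finset.sum_comm]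
  rw [h1, h3]
  simp only [fun k j v => norm_sub_rev (f k : E3) (rot (g j : SO3) v), h2]

/-! ### Collision-free symmetric configurations -/

lemma tetElt_zero : tetElt (0, 0) = 1 := by simp [tetElt, tetDiag, tetCyc]

lemma eq_one_of_rot_eq {u : E3} (hu : IsRegular u) {γ : tetrahedralGroup} (h : rot γ u = u) :
    γ = 1 := by
  obtain ⟨⟨k, a⟩, rfl⟩ := tetEquiv.surjective γ
  rw [coe_tetEquiv] at h
  have h1 := norm_sub_tetElt_sq hu.1 k a
  rw [h, sub_self, norm_zero] at h1
  have h2 := hu.2 (tetAxis k a)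
  have h3 : chord k a = 0 := by
    rcases mul_eq_zero.1 (h1.symm.trans (by norm_num)) with h | h
    · exact h
    · linarith
  have h4 : (k, a) = (0, 0) := by
    fin_cases k <;> fin_cases a <;> simp [chord] at h3 ⊢
  rw [h4]
  exact Subtype.ext tetElt_zero

lemma IsRegular.notMem_cube {u : E3} (hu : IsRegular u) : u ∉ cube := by
  rw [← range_cubeVert]
  rintro ⟨a | a, rfl⟩ <;> simpa [inner_axis_inr, cubeVert, norm_vert] using hu.2 (Sum.inr a)

/-- A point off all the axes has trivial stabiliser and is not a cube vertex, so neither kind of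
coincidence can occur. -/
lemma IsRegular.isCollisionFree {u : E3} (hu : IsRegular u) :
    IsCollisionFree (symConfig g f u) := by
  have hne : ∀ j k, rot (g j) u ≠ f k := fun j k h => by
    apply hu.notMem_cube
    rw [← rot_inv_rot (g j) u, h]
    exact rot_mem_cube (inv_mem (g j).2) (f k).2
  constructor
  · refine Fin.addCases (m := 12) (n := 8) (fun j => ?_) fun k => ?_
    · rw [symConfig_castAdd]
      exact rot_mem_S2 (g j).2 hu.1
    · rw [symConfig_natAdd]
      exact cube_subset_S2 (f k).2
  · refine Fin.addCases (m := 12) (n := 8) (fun j => ?_) fun k => ?_ <;>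
      refine Fin.addCases (m := 12) (n := 8) (fun i => ?_) fun l => ?_ <;>
      intro h
    · rw [symConfig_castAdd, symConfig_castAdd] at h
      have : (g i)⁻¹ * g j = 1 := eq_one_of_rot_eq hu (by
        rw [Subgroup.coe_mul, rot_mul, h]; exact rot_inv_rot _ _)
      rw [inv_mul_eq_one, g.injective.eq_iff] at this
      rw [this]
    · rw [symConfig_castAdd, symConfig_natAdd] at h
      exact (hne _ _ h).elim
    · rw [symConfig_castAdd, symConfig_natAdd] at h
      exact (hne _ _ h.symm).elim
    · rw [symConfig_natAdd, symConfig_natAdd] at h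
      rw [f.injective (Subtype.ext h)]

/-! ### The reduced equation of motion -/

lemma two_sub_inv_sub {q : ℝ} (hq : q ^ 2 < 1) :
    (2 * (1 - q))⁻¹ - (2 * (1 + q))⁻¹ = q / (1 - q ^ 2) := by
  have h := abs_lt.1 ((sq_lt_one_iff_abs_lt_one _).1 hq)
  have h1 : 1 - q ≠ 0 := by linarith [h.2]
  have h2 : 1 + q ≠ 0 := by linarith [h.1]
  have h3 : 1 - q ^ 2 ≠ 0 := by linarith
  field_simp
  ring

lemma sum_cube_cross {u : E3} (hu : IsRegular u) :
    ∑ k, (‖u - f k‖ ^ 2)⁻¹ • cross (f k) u =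
      ∑ a : Fin 4, (inner ℝ (axis (Sum.inr a)) u / (1 - inner ℝ (axis (Sum.inr a)) u ^ 2)) •
        cross (axis (Sum.inr a)) u := by
  rw [sum_cube f fun x => (‖u - x‖ ^ 2)⁻¹ • cross x u]
  refine Finset.sum_congr rfl fun a _ => ?_
  rw [norm_sub_vert_sq hu.1, norm_sub_neg_vert_sq hu.1,
    show -vert a = (-1 : ℝ) • vert a by simp, cross_smul_left, ← two_sub_inv_sub (hu.2 _),
    smul_smul, ← add_smul]
  congr 1
  rw [inner_axis_inr]
  ring

/-- A half-turn gives `Ru = -u + 2⟨a, u⟩a`, and a rotation of order three gives `Ru + R⁻¹u = -u +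
3⟨a, u⟩a`; the multiples of `u` drop out of the product with `u`. The `1` subtracted on vertex axes
is the share supplied by the cube in `sum_cube_cross`. -/
lemma sum_tet_cross {u : E3} (hu : IsRegular u) :
    ∑ j, (‖u - rot (g j) u‖ ^ 2)⁻¹ • cross (rot (g j) u) u =
      ∑ k, ((2 * weight k - Sum.elim (fun _ => 0) (fun _ => 1) k) *
        inner ℝ (axis k) u / (1 - inner ℝ (axis k) u ^ 2)) • cross (axis k) u := by
  rw [sum_tet g fun γ => (‖u - rot γ u‖ ^ 2)⁻¹ • cross (rot γ u) u, sum_prod_three_four]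
  simp only [coe_tetEquiv, norm_sub_tetElt_sq hu.1, chord, tetAxis, Matrix.cons_val]
  rw [Fintype.sum_sum_type, Fin.sum_univ_three, Fin.sum_univ_four]
  simp only [weight, Sum.elim_inl, Sum.elim_inr, div_eq_mul_inv, mul_inv]
  generalize (1 - inner ℝ (axis (Sum.inl 0)) u ^ 2)⁻¹ = x0
  generalize (1 - inner ℝ (axis (Sum.inl 1)) u ^ 2)⁻¹ = x1
  generalize (1 - inner ℝ (axis (Sum.inl 2)) u ^ 2)⁻¹ = x2
  generalize (1 - inner ℝ (axis (Sum.inr 0)) u ^ 2)⁻¹ = y0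
  generalize (1 - inner ℝ (axis (Sum.inr 1)) u ^ 2)⁻¹ = y1
  generalize (1 - inner ℝ (axis (Sum.inr 2)) u ^ 2)⁻¹ = y2
  generalize (1 - inner ℝ (axis (Sum.inr 3)) u ^ 2)⁻¹ = y3
  have hq : ∀ a (X : ℝ), inner ℝ (vert a) u * (1 / √3 * X) =
      (sgn a 0 * u 0 + sgn a 1 * u 1 + sgn a 2 * u 2) / 3 * X := fun a X => by
    rw [inner_vert]
    linear_combination
      (sgn a 0 * u 0 + sgn a 1 * u 1 + sgn a 2 * u 2) * X * one_div_sqrt_three_sq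
  have hc : ∀ a, inner ℝ (vert a) u • cross (vert a) u =
      ((sgn a 0 * u 0 + sgn a 1 * u 1 + sgn a 2 * u 2) / 3) •
        cross (WithLp.toLp 2 fun i => (sgn a i : ℝ)) u := fun a => by
    have : vert a = (1 / √3 : ℝ) • WithLp.toLp 2 fun i => (sgn a i : ℝ) := rfl
    rw [← cross_smul_left, ← cross_smul_left]
    congr 1
    ext i
    simp only [PiLp.smul_apply, vert_apply, smul_eq_mul]
    exact hq a _
  have hm : ∀ (a : Fin 4) (c y : ℝ),
      (c * inner ℝ (axis (Sum.inr a)) u * y) • cross (axis (Sum.inr a)) u =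
      (c * y) • (((sgn a 0 * u 0 + sgn a 1 * u 1 + sgn a 2 * u 2) / 3) •
        cross (WithLp.toLp 2 fun i => (sgn a i : ℝ)) u) := fun a c y => by
    rw [← hc, smul_smul]
    congr 1
    rw [inner_axis_inr]
    ring
  rw [hm, hm, hm, hm]
  simp only [inner_axis_inl]
  apply ext_three <;>
    simp [cross_apply_zero, cross_apply_one, cross_apply_two, rot_tetElt, sgn, axis] <;> ring

lemma symField_self {u : E3} (hu : IsRegular u) : symField g f u u = cross (gradPsi u) u := by
  rw [symField, sum_tet_cross g hu, sum_cube_cross f hu, gradPsi, cross_sum_left,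
    Fintype.sum_sum_type, Fintype.sum_sum_type, add_assoc, ← Finset.sum_add_distrib]
  simp only [cross_smul_left, ← add_smul, Sum.elim_inl, Sum.elim_inr]
  congr 1
  · simp
  · refine Finset.sum_congr rfl fun a _ => ?_
    congr 1
    ring

end SphereVortex

namespace SphereVortex

/-! ### Flows on the level curves of a function in polar coordinates -/

/-- The solution `y` of `F x (y x) = c x`, for `F x` strictly increasing, depends continuously
on the parameter. -/
lemma continuousOn_of_strictMonoOn {X : Type*} [TopologicalSpace X] {S : Set X} {F : X → ℝ → ℝ}
    {D : Set ℝ} (hD : IsOpen D) (hF : ∀ r ∈ D, ContinuousOn (fun x => F x r) S)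
    (hmono : ∀ x ∈ S, StrictMonoOn (F x) D) {c y : X → ℝ} (hc : ContinuousOn c S)
    (hy : ∀ x ∈ S, y x ∈ D) (hFy : ∀ x ∈ S, F x (y x) = c x) : ContinuousOn y S := by
  intro x₀ hx₀
  have hDn := hD.mem_nhds (hy x₀ hx₀)
  refine tendsto_order.2 ⟨fun a ha => ?_, fun a ha => ?_⟩
  · obtain ⟨r, hrD, har, hr⟩ : ∃ r, r ∈ D ∧ a < r ∧ r < y x₀ :=
      (Filter.Eventually.and (nhdsWithin_le_nhds hDn) (Ioo_mem_nhdsLT ha)).exists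
    have h1 := hmono x₀ hx₀ hrD (hy x₀ hx₀) hr
    rw [hFy x₀ hx₀] at h1
    filter_upwards [(hF r hrD x₀ hx₀).eventually_lt (hc x₀ hx₀) h1, self_mem_nhdsWithin]
      with x hx hxS
    rw [← hFy x hxS, (hmono x hxS).lt_iff_lt hrD (hy x hxS)] at hx
    exact har.trans hx
  · obtain ⟨r, hrD, hr, har⟩ : ∃ r, r ∈ D ∧ y x₀ < r ∧ r < a :=
      (Filter.Eventually.and (nhdsWithin_le_nhds hDn) (Ioo_mem_nhdsGT ha)).exists
    have h1 := hmono x₀ hx₀ (hy x₀ hx₀) hrD hr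
    rw [hFy x₀ hx₀] at h1
    filter_upwards [(hc x₀ hx₀).eventually_lt (hF r hrD x₀ hx₀) h1, self_mem_nhdsWithin]
      with x hx hxS
    rw [← hFy x hxS, (hmono x hxS).lt_iff_lt (hy x hxS) hrD] at hx
    exact hx.trans har

/-- The linear automorphism `(x, y) ↦ (a x + b y, y)` of the plane. -/
def shearEquiv (a b : ℝ) (ha : a ≠ 0) : (ℝ × ℝ) ≃L[ℝ] (ℝ × ℝ) :=
  ContinuousLinearEquiv.equivOfInverse
    ((a • ContinuousLinearMap.fst ℝ ℝ ℝ + b • ContinuousLinearMap.snd ℝ ℝ ℝ).prod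
      (ContinuousLinearMap.snd ℝ ℝ ℝ))
    ((a⁻¹ • ContinuousLinearMap.fst ℝ ℝ ℝ - (b / a) • ContinuousLinearMap.snd ℝ ℝ ℝ).prod
      (ContinuousLinearMap.snd ℝ ℝ ℝ))
    (fun p => by ext <;> simp; field_simp; ring)
    (fun p => by ext <;> simp; field_simp; ring)

lemma shearEquiv_symm_apply (a b : ℝ) (ha : a ≠ 0) (p : ℝ × ℝ) :
    (shearEquiv a b ha).symm p = (a⁻¹ * p.1 - b / a * p.2, p.2) := rfl

section PolarFlow

variable {E Er Eθ Ω : ℝ → ℝ → ℝ} {r₀ : ℝ} {J : Set ℝ}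

/-- The function `E` has partial derivatives `Er > 0` and `Eθ` in the punctured disc of radius
`r₀`. -/
structure PolarData (E Er Eθ : ℝ → ℝ → ℝ) (r₀ : ℝ) : Prop where
  hasFDerivAt : ∀ r ∈ Ioo 0 r₀, ∀ θ, HasFDerivAt (fun p : ℝ × ℝ => E p.1 p.2)
    (Er r θ • ContinuousLinearMap.fst ℝ ℝ ℝ + Eθ r θ • ContinuousLinearMap.snd ℝ ℝ ℝ) (r, θ)
  pos : ∀ r ∈ Ioo 0 r₀, ∀ θ, 0 < Er r θ
  periodic : ∀ r θ, E r (θ + 2 * Real.pi) = E r θ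

lemma PolarData.continuousOn (hE : PolarData E Er Eθ r₀) :
    ContinuousOn (fun p : ℝ × ℝ => E p.1 p.2) (Ioo 0 r₀ ×ˢ univ) := fun p hp =>
  (hE.hasFDerivAt p.1 hp.1 p.2).continuousAt.continuousWithinAt

lemma PolarData.hasDerivAt (hE : PolarData E Er Eθ r₀) {r : ℝ} (hr : r ∈ Ioo 0 r₀) (θ : ℝ) :
    HasDerivAt (fun r => E r θ) (Er r θ) r := by
  have h := (hE.hasFDerivAt r hr θ).comp_hasDerivAt r
    ((hasDerivAt_id r).prodMk (hasDerivAt_const r θ))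
  exact h.congr_deriv (by simp)

lemma PolarData.strictMonoOn (hE : PolarData E Er Eθ r₀) (θ : ℝ) :
    StrictMonoOn (fun r => E r θ) (Ioo 0 r₀) := by
  apply strictMonoOn_of_deriv_pos (convex_Ioo _ _)
  · exact fun r hr => (hE.hasDerivAt hr θ).continuousAt.continuousWithinAt
  · intro r hr
    rw [interior_Ioo] at hr
    rw [(hE.hasDerivAt hr θ).deriv]
    exact hE.pos r hr θ

/-- The level curves of a function which increases along the rays are graphs in polar
coordinates. -/
lemma PolarData.exists_level (hE : PolarData E Er Eθ r₀) (hJ : IsOpen J)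
    (hlow : ∀ s ∈ J, ∀ θ, ∃ r ∈ Ioo 0 r₀, E r θ < s)
    (hhigh : ∀ s ∈ J, ∀ θ, ∃ r ∈ Ioo 0 r₀, s < E r θ) :
    ∃ R : ℝ → ℝ → ℝ, (∀ s ∈ J, ∀ θ, R s θ ∈ Ioo 0 r₀ ∧ E (R s θ) θ = s) ∧
      (∀ s ∈ J, ∀ θ, R s (θ + 2 * Real.pi) = R s θ) ∧
      ContinuousOn (fun p : ℝ × ℝ => R p.1 p.2) (J ×ˢ univ) ∧
      ∀ s ∈ J, ∀ θ, HasDerivAt (R s) (-(Eθ (R s θ) θ / Er (R s θ) θ)) θ := by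
  have hex : ∀ s θ, s ∈ J → ∃ r ∈ Ioo 0 r₀, E r θ = s := fun s θ hs => by
    obtain ⟨a, ha, has⟩ := hlow s hs θ
    obtain ⟨b, hb, hbs⟩ := hhigh s hs θ
    have hab : a < b := ((hE.strictMonoOn θ).lt_iff_lt ha hb).1 (has.trans hbs)
    have hsub : Icc a b ⊆ Ioo 0 r₀ := fun x hx => ⟨ha.1.trans_le hx.1, hx.2.trans_lt hb.2⟩
    obtain ⟨r, hr, hrs⟩ := intermediate_value_Icc hab.le
      (f := fun r => E r θ)
      (fun r hr => (hE.hasDerivAt (hsub hr) θ).continuousAt.continuousWithinAt)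
      ⟨has.le, hbs.le⟩
    exact ⟨r, hsub hr, hrs⟩
  choose! R hRmem hRE using hex
  have hcont : ContinuousOn (fun p : ℝ × ℝ => R p.1 p.2) (J ×ˢ univ) := by
    refine continuousOn_of_strictMonoOn (F := fun p r => E r p.2) (c := fun p => p.1)
      (D := Ioo 0 r₀) isOpen_Ioo ?_ ?_ ?_ ?_ ?_
    · intro r hr
      exact hE.continuousOn.comp (f := fun p : ℝ × ℝ => (r, p.2)) (by fun_prop)
        fun p _ => ⟨hr, mem_univ _⟩
    · exact fun p _ => hE.strictMonoOn p.2
    · fun_prop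
    · exact fun p hp => hRmem p.1 p.2 hp.1
    · exact fun p hp => hRE p.1 p.2 hp.1
  refine ⟨R, fun s hs θ => ⟨hRmem s θ hs, hRE s θ hs⟩, fun s hs θ => ?_, hcont, fun s hs θ => ?_⟩
  · apply (hE.strictMonoOn θ).injOn (hRmem s _ hs) (hRmem s _ hs)
    simp only
    rw [hRE s θ hs, ← hE.periodic, hRE s _ hs]
  · have hpos := hE.pos _ (hRmem s θ hs) θ
    have hopen : IsOpen (J ×ˢ (univ : Set ℝ)) := hJ.prod isOpen_univ
    have hmem : J ×ˢ (univ : Set ℝ) ∈ 𝓝 (s, θ) := hopen.mem_nhds ⟨hs, mem_univ _⟩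
    -- The map `(r, θ) ↦ (E r θ, θ)` has an invertible shear as derivative, and `(s, θ) ↦ (R s θ,
    -- θ)` is its continuous local inverse, so `R` is differentiable by inversion of the shear.
    have h1 : HasFDerivAt (fun p : ℝ × ℝ => (E p.1 p.2, p.2))
        (shearEquiv (Er (R s θ) θ) (Eθ (R s θ) θ) hpos.ne' : (ℝ × ℝ) →L[ℝ] (ℝ × ℝ))
        (R s θ, θ) :=
      (hE.hasFDerivAt _ (hRmem s θ hs) θ).prodMk hasFDerivAt_snd
    have h2 := HasFDerivAt.of_local_left_inverse (g := fun p : ℝ × ℝ => (R p.1 p.2, p.2))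
      (a := (s, θ)) ((hcont.continuousAt hmem).prodMk continuousAt_snd) h1 (by
        filter_upwards [hmem] with p hp
        rw [hRE p.1 p.2 hp.1])
    have h3 := h2.fst.comp_hasDerivAt θ ((hasDerivAt_const θ s).prodMk (hasDerivAt_id θ))
    exact h3.congr_deriv (by simp [shearEquiv_symm_apply])

/-- The autonomous equation on a circle with positive velocity `q⁻¹`, depending continuously on a
parameter, is solved by quadrature. -/
lemma exists_circle_flow {q : ℝ → ℝ → ℝ}
    (hq : ContinuousOn (fun p : ℝ × ℝ => q p.1 p.2) (J ×ˢ univ))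
    (hpos : ∀ s ∈ J, ∀ θ, 0 < q s θ) (hper : ∀ s ∈ J, ∀ θ, q s (θ + 2 * Real.pi) = q s θ) :
    ∃ (Θ : ℝ → ℝ → ℝ) (τ : ℝ → ℝ),
      ContinuousOn (fun p : ℝ × ℝ => Θ p.1 p.2) (J ×ˢ univ) ∧
      ∀ s ∈ J, 0 < τ s ∧ (∀ B, (∀ θ, q s θ ≤ B) → τ s ≤ 2 * Real.pi * B) ∧
        StrictMono (Θ s) ∧ Function.Surjective (Θ s) ∧
        (∀ t, Θ s (t + τ s) = Θ s t + 2 * Real.pi) ∧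
        ∀ t, HasDerivAt (Θ s) (q s (Θ s t))⁻¹ t := by
  -- `T s θ` is the time needed to reach the angle `θ`. The motion `Θ s` is its inverse function,
  -- and the period is `T s (2π)`.
  set T : ℝ → ℝ → ℝ := fun s θ => ∫ φ in (0 : ℝ)..θ, q s φ with hT
  have hqs : ∀ s ∈ J, Continuous (q s) := fun s hs =>
    hq.comp_continuous (f := fun φ : ℝ => (s, φ)) (by fun_prop) fun φ => ⟨hs, mem_univ _⟩
  have hint : ∀ s ∈ J, ∀ a b, IntervalIntegrable (q s) MeasureTheory.volume a b := fun s hs a b =>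
    (hqs s hs).intervalIntegrable a b
  have hTder : ∀ s ∈ J, ∀ θ, HasDerivAt (T s) (q s θ) θ := fun s hs θ =>
    ((hqs s hs).integral_hasStrictDerivAt 0 θ).hasDerivAt
  have hTmono : ∀ s ∈ J, StrictMono (T s) := fun s hs => by
    apply strictMono_of_deriv_pos
    intro θ
    rw [(hTder s hs θ).deriv]
    exact hpos s hs θ
  have hTper : ∀ s ∈ J, ∀ θ, T s (θ + 2 * Real.pi) = T s θ + T s (2 * Real.pi) := fun s hs θ => by
    simp only [hT]
    rw [← intervalIntegral.integral_add_adjacent_intervals (hint s hs 0 θ)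
      (hint s hs θ (θ + 2 * Real.pi))]
    congr 1
    have := Function.Periodic.intervalIntegral_add_eq (f := q s) (hper s hs) θ 0
    rwa [zero_add] at this
  have hTsurj : ∀ s ∈ J, Function.Surjective (T s) := fun s hs => by
    have hc : Continuous (T s) := continuous_iff_continuousAt.2 fun θ => (hTder s hs θ).continuousAt
    exact hc.surjective
      (Function.Periodic.tendsto_atTop_intervalIntegral_of_pos' (hper s hs) (hint s hs _ _)
        (hpos s hs) Real.two_pi_pos)
      (Function.Periodic.tendsto_atBot_intervalIntegral_of_pos' (hper s hs) (hint s hs _ _)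
        (hpos s hs) Real.two_pi_pos)
  set Θ : ℝ → ℝ → ℝ := fun s => Function.invFun (T s) with hΘ
  have hTΘ : ∀ s ∈ J, ∀ t, T s (Θ s t) = t := fun s hs t =>
    Function.rightInverse_invFun (hTsurj s hs) t
  have hTcont : Continuous fun p : J × ℝ => T p.1 p.2 := by
    apply intervalIntegral.continuous_parametric_intervalIntegral_of_continuous
      (f := fun (p : J × ℝ) φ => q p.1 φ) (s := fun p => p.2)
    · exact hq.comp_continuous (f := fun x : (J × ℝ) × ℝ => ((x.1.1 : ℝ), x.2)) (by fun_prop)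
        fun x => ⟨x.1.1.2, mem_univ _⟩
    · fun_prop
  have hΘcont : Continuous fun p : J × ℝ => Θ p.1 p.2 := by
    rw [← continuousOn_univ]
    refine continuousOn_of_strictMonoOn (F := fun (p : J × ℝ) θ => T p.1 θ) (c := fun p => p.2)
      isOpen_univ ?_ ?_ ?_ ?_ ?_
    · intro θ _
      rw [continuousOn_univ]
      exact hTcont.comp (f := fun p : J × ℝ => (p.1, θ)) (by fun_prop)
    · exact fun p _ => (hTmono p.1 p.1.2).strictMonoOn _
    · fun_prop
    · exact fun _ _ => mem_univ _
    · exact fun p _ => hTΘ p.1 p.1.2 p.2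
  refine ⟨Θ, fun s => T s (2 * Real.pi), ?_, fun s hs => ⟨?_, ?_, ?_, ?_, ?_, ?_⟩⟩
  · rw [continuousOn_iff_continuous_domRestrict]
    exact hΘcont.comp (f := fun x : (J ×ˢ (univ : Set ℝ) : Set (ℝ × ℝ)) =>
      ((⟨x.1.1, x.2.1⟩ : J), x.1.2)) (by fun_prop)
  · have := hTmono s hs Real.two_pi_pos
    simpa [hT] using this
  · intro B hB
    have := intervalIntegral.integral_mono_on Real.two_pi_pos.le (hint s hs 0 (2 * Real.pi))
      (intervalIntegrable_const (c := B)) fun θ _ => hB θ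
    simpa using this
  · intro a b hab
    rw [← (hTmono s hs).lt_iff_lt, hTΘ s hs, hTΘ s hs]
    exact hab
  · intro θ
    exact ⟨T s θ, Function.leftInverse_invFun (hTmono s hs).injective θ⟩
  · intro t
    apply (hTmono s hs).injective
    rw [hTΘ s hs, hTper s hs, hTΘ s hs]
  · intro t
    apply HasDerivAt.of_local_left_inverse (f := T s)
    · exact (hΘcont.comp (f := fun t : ℝ => ((⟨s, hs⟩ : J), t)) (by fun_prop)).continuousAt
    · exact hTder s hs _
    · exact (hpos s hs _).ne'
    · exact Eventually.of_forall (hTΘ s hs)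

end PolarFlow

end SphereVortex

namespace SphereVortex

/-! ### Geodesic polar coordinates on the sphere -/

/-- An orthonormal frame `u₀, e₁, e₂`, of orientation `σ`. -/
structure IsFrame (u₀ e₁ e₂ : E3) (σ : ℝ) : Prop where
  norm₀ : ‖u₀‖ = 1
  norm₁ : ‖e₁‖ = 1
  norm₂ : ‖e₂‖ = 1
  inner₀₁ : inner ℝ u₀ e₁ = 0
  inner₀₂ : inner ℝ u₀ e₂ = 0
  inner₁₂ : inner ℝ e₁ e₂ = 0
  cross₁₂ : cross e₁ e₂ = σ • u₀
  cross₂₀ : cross e₂ u₀ = σ • e₁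
  cross₀₁ : cross u₀ e₁ = σ • e₂

/-- The unit vectors orthogonal to `u₀`. -/
def tangentCircle (u₀ : E3) : Set E3 := {e | e ∈ S2 ∧ inner ℝ u₀ e = 0}

lemma exists_mem_tangentCircle (u₀ : E3) : (tangentCircle u₀).Nonempty := by
  obtain ⟨v, hv, hin⟩ : ∃ v : E3, v ≠ 0 ∧ inner ℝ u₀ v = 0 := by
    by_cases h : u₀ 0 = 0 ∧ u₀ 1 = 0
    · refine ⟨!₂[1, 0, 0], fun h0 => ?_, by simp [inner_eq, h.1]⟩
      simpa using congrArg (fun x : E3 => x 0) h0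
    · refine ⟨!₂[-u₀ 1, u₀ 0, 0], fun h0 => h ⟨?_, ?_⟩, by simp [inner_eq]; ring⟩
      · simpa using congrArg (fun x : E3 => x 1) h0
      · simpa using congrArg (fun x : E3 => x 0) h0
  refine ⟨‖v‖⁻¹ • v, ?_, ?_⟩
  · rw [mem_S2_iff, norm_smul, norm_inv, norm_norm, inv_mul_cancel₀ (norm_ne_zero_iff.2 hv)]
  · rw [inner_smul_right, hin, mul_zero]

lemma norm_cross_of_orthonormal {x y : E3} (hx : ‖x‖ = 1) (hy : ‖y‖ = 1) (hxy : inner ℝ x y = 0) :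
    ‖cross x y‖ = 1 := by
  have h : ‖cross x y‖ ^ 2 + inner ℝ x y ^ 2 = ‖x‖ ^ 2 * ‖y‖ ^ 2 := by
    simp only [norm_sq_eq, inner_eq, cross_apply_zero, cross_apply_one, cross_apply_two]
    ring
  rw [hx, hy, hxy] at h
  nlinarith [norm_nonneg (cross x y)]

lemma exists_isFrame {u₀ : E3} (hu : u₀ ∈ S2) {σ : ℝ} (hσ : σ ^ 2 = 1) :
    ∃ e₁ e₂, IsFrame u₀ e₁ e₂ σ := by
  obtain ⟨e, he, hin⟩ := exists_mem_tangentCircle u₀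
  rw [mem_S2_iff] at hu he
  have hσ' : ‖σ‖ = 1 := by
    rw [Real.norm_eq_abs]
    nlinarith [abs_nonneg σ, sq_abs σ]
  refine ⟨e, σ • cross u₀ e, hu, he, ?_, hin, ?_, ?_, ?_, ?_, ?_⟩
  · rw [norm_smul, hσ', norm_cross_of_orthonormal hu he hin, one_mul]
  · rw [inner_smul_right, cross_anticomm_eq, inner_neg_right, real_inner_comm, inner_cross_self]
    simp
  · rw [inner_smul_right, real_inner_comm, inner_cross_self, mul_zero]
  · rw [cross_smul_right, cross_cross_eq, real_inner_self_eq_norm_sq, he, real_inner_comm, hin]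
    simp
  · rw [cross_smul_left, cross_anticomm_eq, cross_cross_eq, real_inner_self_eq_norm_sq, hu, hin]
    simp
  · rw [smul_smul, ← sq, hσ, one_smul]

/-- The point at distance `r` from `u₀` on the geodesic with initial direction `e`. -/
def geo (u₀ e : E3) (r : ℝ) : E3 := Real.cos r • u₀ + Real.sin r • e

/-- The velocity of a geodesic. -/
def geoDir (u₀ e : E3) (r : ℝ) : E3 := -Real.sin r • u₀ + Real.cos r • e

/-- The unit vector at angle `θ` in the plane spanned by `e₁` and `e₂`. -/
def circ (e₁ e₂ : E3) (θ : ℝ) : E3 := Real.cos θ • e₁ + Real.sin θ • e₂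

lemma inner_geo {u₀ e : E3} (hu : u₀ ∈ S2) (he : e ∈ tangentCircle u₀) (r : ℝ) :
    inner ℝ u₀ (geo u₀ e r) = Real.cos r := by
  rw [geo, inner_add_right, inner_smul_right, inner_smul_right, he.2,
    real_inner_self_eq_norm_sq, mem_S2_iff.1 hu]
  ring

lemma geo_mem_S2 {u₀ e : E3} (hu : u₀ ∈ S2) (he : e ∈ tangentCircle u₀) (r : ℝ) :
    geo u₀ e r ∈ S2 := by
  have h : ‖geo u₀ e r‖ ^ 2 = 1 := by
    rw [geo, norm_add_sq_real, norm_smul, norm_smul, mem_S2_iff.1 hu, mem_S2_iff.1 he.1,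
      inner_smul_left, inner_smul_right, he.2]
    simp
  rw [mem_S2_iff]
  nlinarith [norm_nonneg (geo u₀ e r)]

lemma dist_geo_le {u₀ e : E3} (hu : u₀ ∈ S2) (he : e ∈ tangentCircle u₀) {r : ℝ} (hr : 0 ≤ r) :
    dist (geo u₀ e r) u₀ ≤ r := by
  rw [dist_eq_norm]
  apply abs_le_of_sq_le_sq' _ hr |>.2
  rw [norm_sub_sq_real, real_inner_comm, inner_geo hu he, mem_S2_iff.1 hu,
    mem_S2_iff.1 (geo_mem_S2 hu he r)]
  linarith [Real.one_sub_sq_div_two_le_cos (x := r)]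

variable {u₀ e₁ e₂ : E3} {σ : ℝ}

namespace IsFrame

lemma mem_S2 (h : IsFrame u₀ e₁ e₂ σ) : u₀ ∈ S2 := mem_S2_iff.2 h.norm₀

lemma circ_mem (h : IsFrame u₀ e₁ e₂ σ) (θ : ℝ) : circ e₁ e₂ θ ∈ tangentCircle u₀ := by
  constructor
  · have : ‖circ e₁ e₂ θ‖ ^ 2 = 1 := by
      rw [circ, norm_add_sq_real, norm_smul, norm_smul, h.norm₁, h.norm₂, inner_smul_left,
        inner_smul_right, h.inner₁₂]
      simp
    rw [mem_S2_iff]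
    nlinarith [norm_nonneg (circ e₁ e₂ θ)]
  · rw [circ, inner_add_right, inner_smul_right, inner_smul_right, h.inner₀₁, h.inner₀₂]
    simp

lemma σ_ne_zero (h : IsFrame u₀ e₁ e₂ σ) : σ ≠ 0 := by
  rintro rfl
  have := norm_cross_of_orthonormal h.norm₁ h.norm₂ h.inner₁₂
  simp [h.cross₁₂] at this

/-- The remainder `y` is orthogonal to `e₁` and `e₂`, so `y × (e₁ × e₂) = 0` and `y` is parallel to
`u₀`; it is also orthogonal to `u₀`, so `u₀ × (y × u₀) = y` vanishes. -/
lemma eq_sum (h : IsFrame u₀ e₁ e₂ σ) (x : E3) :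
    x = inner ℝ u₀ x • u₀ + (inner ℝ e₁ x • e₁ + inner ℝ e₂ x • e₂) := by
  rw [← sub_eq_zero]
  set y := x - (inner ℝ u₀ x • u₀ + (inner ℝ e₁ x • e₁ + inner ℝ e₂ x • e₂)) with hy
  have h0 : inner ℝ u₀ y = 0 := by
    simp [hy, inner_sub_right, inner_add_right, inner_smul_right, h.inner₀₁, h.inner₀₂, h.norm₀]
  have h1 : inner ℝ y e₁ = 0 := by
    rw [real_inner_comm]
    simp [hy, inner_sub_right, inner_add_right, inner_smul_right, h.inner₁₂, h.norm₁,
      real_inner_comm u₀ e₁, h.inner₀₁]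
  have h2 : inner ℝ y e₂ = 0 := by
    rw [real_inner_comm]
    simp [hy, inner_sub_right, inner_add_right, inner_smul_right, real_inner_comm e₁ e₂, h.inner₁₂,
      h.norm₂, real_inner_comm u₀ e₂, h.inner₀₂]
  have h3 : cross y (cross e₁ e₂) = 0 := by rw [cross_cross_eq, h1, h2]; simp
  rw [h.cross₁₂, cross_smul_right, smul_eq_zero, or_iff_right h.σ_ne_zero] at h3
  have h4 := cross_cross_eq u₀ y u₀
  rw [h3, real_inner_self_eq_norm_sq, h.norm₀, h0] at h4
  rw [show (0 : E3) = cross u₀ 0 by simpa using (cross_smul_right 0 u₀ 0).symm, h4]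
  simp

/-- The angle is the argument of the complex number formed by the two tangential components. At the
poles that number is `0` and its conventional argument does no harm. -/
lemma exists_polar (h : IsFrame u₀ e₁ e₂ σ) {x : E3} (hx : x ∈ S2) :
    ∃ r ∈ Icc 0 Real.pi, ∃ θ ∈ Icc (-Real.pi) Real.pi, geo u₀ (circ e₁ e₂ θ) r = x := by
  set z : ℂ := ⟨inner ℝ e₁ x, inner ℝ e₂ x⟩ with hz
  have hsum := h.eq_sum x
  have hn : inner ℝ u₀ x ^ 2 + (inner ℝ e₁ x ^ 2 + inner ℝ e₂ x ^ 2) = 1 := by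
    have h1 : inner ℝ x x = (1 : ℝ) := by
      rw [real_inner_self_eq_norm_sq, mem_S2_iff.1 hx]; norm_num
    nth_rewrite 1 [hsum] at h1
    simp only [inner_add_left, inner_smul_left] at h1
    simp only [RCLike.conj_to_real] at h1
    linarith
  have hle : -1 ≤ inner ℝ u₀ x ∧ inner ℝ u₀ x ≤ 1 := abs_le.1 ((sq_le_one_iff_abs_le_one _).1
    (by nlinarith [sq_nonneg (inner ℝ e₁ x), sq_nonneg (inner ℝ e₂ x)]))
  refine ⟨Real.arccos (inner ℝ u₀ x), ⟨Real.arccos_nonneg _, Real.arccos_le_pi _⟩, z.arg,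
    ⟨(Complex.neg_pi_lt_arg z).le, Complex.arg_le_pi z⟩, ?_⟩
  have hs : Real.sin (Real.arccos (inner ℝ u₀ x)) = ‖z‖ := by
    rw [Real.sin_arccos, Complex.norm_def, Complex.normSq_apply]
    congr 1
    linarith
  rw [geo, circ, Real.cos_arccos hle.1 hle.2, hs, smul_add, smul_smul, smul_smul,
    Complex.norm_mul_cos_arg, Complex.norm_mul_sin_arg]
  exact hsum.symm

lemma geo_inj (h : IsFrame u₀ e₁ e₂ σ) {r r' θ θ' : ℝ} (hr : r ∈ Icc 0 Real.pi)
    (hr' : r' ∈ Icc 0 Real.pi) (heq : geo u₀ (circ e₁ e₂ θ) r = geo u₀ (circ e₁ e₂ θ') r') :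
    r = r' ∧ (r ∈ Ioo 0 Real.pi → circ e₁ e₂ θ = circ e₁ e₂ θ') := by
  have h1 : Real.cos r = Real.cos r' := by
    rw [← inner_geo h.mem_S2 (h.circ_mem θ), heq, inner_geo h.mem_S2 (h.circ_mem θ')]
  have h2 : r = r' := Real.injOn_cos hr hr' h1
  subst h2
  refine ⟨rfl, fun hr0 => ?_⟩
  rw [geo, geo, add_right_inj] at heq
  exact smul_right_injective _ (Real.sin_pos_of_mem_Ioo hr0).ne' heq

lemma cos_sub_of_circ_eq (h : IsFrame u₀ e₁ e₂ σ) {θ θ' : ℝ} (heq : circ e₁ e₂ θ = circ e₁ e₂ θ') :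
    Real.cos (θ' - θ) = 1 := by
  have h1 : inner ℝ (circ e₁ e₂ θ) (circ e₁ e₂ θ') = (1 : ℝ) := by
    rw [heq, real_inner_self_eq_norm_sq, mem_S2_iff.1 (h.circ_mem θ').1]; norm_num
  simp only [circ, inner_add_left, inner_add_right, inner_smul_left, inner_smul_right,
    real_inner_comm e₁ e₂, h.inner₁₂, real_inner_self_eq_norm_sq, h.norm₁, h.norm₂] at h1
  rw [Real.cos_sub]
  simp at h1
  linarith

lemma eq_of_circ_eq (h : IsFrame u₀ e₁ e₂ σ) {θ θ' : ℝ} (heq : circ e₁ e₂ θ = circ e₁ e₂ θ')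
    (h1 : θ' - θ < 2 * Real.pi) (h2 : -(2 * Real.pi) < θ' - θ) : θ = θ' := by
  have := (Real.cos_eq_one_iff_of_lt_of_lt h2 h1).1 (h.cos_sub_of_circ_eq heq)
  linarith

lemma apply_eq_of_circ_eq (h : IsFrame u₀ e₁ e₂ σ) {ρ : ℝ → ℝ}
    (hper : Function.Periodic ρ (2 * Real.pi)) {θ θ' : ℝ}
    (heq : circ e₁ e₂ θ = circ e₁ e₂ θ') : ρ θ = ρ θ' := by
  obtain ⟨n, hn⟩ := (Real.cos_eq_one_iff _).1 (h.cos_sub_of_circ_eq heq)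
  rw [show θ' = θ + n * (2 * Real.pi) by linarith, hper.int_mul n]

lemma exists_circ_eq (h : IsFrame u₀ e₁ e₂ σ) {e : E3} (he : e ∈ tangentCircle u₀) :
    ∃ θ, circ e₁ e₂ θ = e := by
  obtain ⟨r, hr, θ, -, heq⟩ := h.exists_polar he.1
  have h1 := inner_geo h.mem_S2 (h.circ_mem θ) r
  rw [heq, he.2] at h1
  have h2 : r = Real.pi / 2 := Real.injOn_cos hr ⟨by positivity, by linarith [Real.pi_pos]⟩
    (by rw [← h1, Real.cos_pi_div_two])
  refine ⟨θ, ?_⟩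
  rw [← heq, geo, h2]
  simp

/-! ### Star-shaped loops -/

/-- A curve which is a graph in polar coordinates separates the two poles. -/
lemma notMem_connectedComponentIn (h : IsFrame u₀ e₁ e₂ σ) {ρ : ℝ → ℝ} (hρ : Continuous ρ)
    (hmem : ∀ θ, ρ θ ∈ Ioo 0 Real.pi) (hper : Function.Periodic ρ (2 * Real.pi)) :
    -u₀ ∉ connectedComponentIn (S2 \ range fun θ => geo u₀ (circ e₁ e₂ θ) (ρ θ)) u₀ := by
  intro hneg
  set C : Set E3 := range fun θ => geo u₀ (circ e₁ e₂ θ) (ρ θ) with hC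
  have hcpt : IsCompact (Icc (0 : ℝ) 1 ×ˢ Icc (-Real.pi) Real.pi) := isCompact_Icc.prod isCompact_Icc
  -- `A` and `B` are the closed regions on or inside and on or outside the curve; they are compact
  -- images of rectangles.
  set A : Set E3 := (fun p : ℝ × ℝ => geo u₀ (circ e₁ e₂ p.2) (p.1 * ρ p.2)) ''
    (Icc (0 : ℝ) 1 ×ˢ Icc (-Real.pi) Real.pi) with hA
  set B : Set E3 := (fun p : ℝ × ℝ => geo u₀ (circ e₁ e₂ p.2) (ρ p.2 + p.1 * (Real.pi - ρ p.2))) ''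
    (Icc (0 : ℝ) 1 ×ˢ Icc (-Real.pi) Real.pi) with hB
  have hAc : IsClosed A := (hcpt.image (by unfold geo circ; fun_prop)).isClosed
  have hBc : IsClosed B := (hcpt.image (by unfold geo circ; fun_prop)).isClosed
  have hAB : S2 ⊆ A ∪ B := fun x hx => by
    obtain ⟨r, hr, θ, hθ, rfl⟩ := h.exists_polar hx
    have hm := hmem θ
    rcases le_total r (ρ θ) with hle | hle
    · refine Or.inl ⟨(r / ρ θ, θ), ⟨⟨div_nonneg hr.1 hm.1.le, (div_le_one hm.1).2 hle⟩, hθ⟩, ?_⟩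
      simp only
      rw [div_mul_cancel₀ _ hm.1.ne']
    · have hpos : 0 < Real.pi - ρ θ := by linarith [hm.2]
      refine Or.inr ⟨((r - ρ θ) / (Real.pi - ρ θ), θ), ⟨⟨div_nonneg (by linarith) hpos.le,
        (div_le_one hpos).2 (by linarith [hr.2])⟩, hθ⟩, ?_⟩
      simp only
      rw [div_mul_cancel₀ _ hpos.ne', add_sub_cancel]
  have hint : A ∩ B ⊆ C := by
    rintro x ⟨⟨⟨l, θ⟩, ⟨hl, -⟩, rfl⟩, ⟨⟨m, θ'⟩, ⟨hm, -⟩, heq⟩⟩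
    simp only at hl hm heq ⊢
    have h1 := hmem θ
    have h2 := hmem θ'
    have hb1 : 0 ≤ m * (Real.pi - ρ θ') := mul_nonneg hm.1 (by linarith [h2.2])
    have hb2 : m * (Real.pi - ρ θ') ≤ Real.pi - ρ θ' :=
      mul_le_of_le_one_left (by linarith [h2.2]) hm.2
    have ha1 : 0 ≤ l * ρ θ := mul_nonneg hl.1 h1.1.le
    have ha2 : l * ρ θ ≤ ρ θ := mul_le_of_le_one_left h1.1.le hl.2
    obtain ⟨e1, e2⟩ := h.geo_inj ⟨by linarith [h2.1], by linarith⟩ ⟨ha1, by linarith [h1.2]⟩ heq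
    have e3 := h.apply_eq_of_circ_eq hper (e2 ⟨by linarith [h2.1], by linarith [h1.2]⟩)
    refine ⟨θ, ?_⟩
    simp only
    congr 1
    linarith
  have hu : u₀ ∈ S2 := h.mem_S2
  have huA : u₀ ∈ A := ⟨(0, 0), ⟨by simp, by simp [Real.pi_pos.le]⟩, by simp [geo]⟩
  have huB : -u₀ ∈ B := ⟨(1, 0), ⟨by simp, by simp [Real.pi_pos.le]⟩, by simp [geo]⟩
  have hsub := connectedComponentIn_subset (S2 \ C) u₀
  have hmem₀ : u₀ ∈ S2 \ C := by
    by_contra hcon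
    rw [connectedComponentIn_eq_empty hcon] at hneg
    exact hneg
  -- A connected set containing `u₀ ∈ A` and `-u₀ ∈ B` and covered by the two closed sets must meet
  -- `A ∩ B`, which lies in the curve.
  obtain ⟨x, hx, hxAB⟩ := isPreconnected_closed_iff.1
    (isPreconnected_connectedComponentIn (F := S2 \ C) (x := u₀)) A B hAc hBc
    (fun x hx => hAB (hsub hx).1) ⟨u₀, mem_connectedComponentIn hmem₀, huA⟩ ⟨-u₀, hneg, huB⟩
  exact (hsub hx).2 (hint hxAB)

lemma isLoopAround (h : IsFrame u₀ e₁ e₂ σ) {ρ Θ : ℝ → ℝ} {τ : ℝ} (hρ : Continuous ρ)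
    (hmem : ∀ θ, ρ θ ∈ Ioo 0 Real.pi) (hper : Function.Periodic ρ (2 * Real.pi))
    (hΘ : Continuous Θ) (hmono : StrictMono Θ) (hsurj : Function.Surjective Θ) (hτ : 0 < τ)
    (hΘτ : ∀ t, Θ (t + τ) = Θ t + 2 * Real.pi) :
    IsLoopAround (fun t => geo u₀ (circ e₁ e₂ (Θ t)) (ρ (Θ t))) τ u₀ := by
  have hcos : ∀ t, inner ℝ u₀ (geo u₀ (circ e₁ e₂ (Θ t)) (ρ (Θ t))) = Real.cos (ρ (Θ t)) :=
    fun t => inner_geo h.mem_S2 (h.circ_mem _) _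
  have hpi := Real.pi_pos
  have hself : inner ℝ u₀ u₀ = (1 : ℝ) := by
    rw [real_inner_self_eq_norm_sq, h.norm₀]; norm_num
  refine ⟨hτ, by unfold geo circ; fun_prop, fun t => geo_mem_S2 h.mem_S2 (h.circ_mem _) _,
    fun t => ?_, fun t ht t' ht' heq => ?_, ?_, ?_, ?_⟩
  · simp only [hΘτ, hper (Θ t)]
    simp only [circ, Real.cos_add_two_pi, Real.sin_add_two_pi]
  · have hm := hmem (Θ t)
    have hm' := hmem (Θ t')
    have hc := (h.geo_inj ⟨hm.1.le, hm.2.le⟩ ⟨hm'.1.le, hm'.2.le⟩ heq).2 hm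
    -- Within one period the angle stays in a half-open interval of length `2π`, so equal directions
    -- force equal angles.
    have b : ∀ s ∈ Ico 0 τ, Θ 0 ≤ Θ s ∧ Θ s < Θ 0 + 2 * Real.pi := fun s hs =>
      ⟨hmono.monotone hs.1, by rw [← hΘτ]; exact hmono (by linarith [hs.2])⟩
    have b1 := b t ht
    have b2 := b t' ht'
    exact hmono.injective (h.eq_of_circ_eq hc (by linarith) (by linarith))
  · rintro ⟨t, ht⟩
    have h1 := hcos t
    simp only at ht
    rw [ht, hself] at h1
    have h2 := Real.injOn_cos ⟨(hmem (Θ t)).1.le, (hmem (Θ t)).2.le⟩ ⟨le_rfl, hpi.le⟩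
      (h1.symm.trans Real.cos_zero.symm)
    exact (hmem (Θ t)).1.ne' h2
  · rintro ⟨t, ht⟩
    have h1 := hcos t
    simp only at ht
    rw [ht, inner_neg_right, hself] at h1
    have h2 := Real.injOn_cos ⟨(hmem (Θ t)).1.le, (hmem (Θ t)).2.le⟩ ⟨hpi.le, le_rfl⟩
      (h1.symm.trans Real.cos_pi.symm)
    exact (hmem (Θ t)).2.ne h2
  · have := h.notMem_connectedComponentIn hρ hmem hper
    rwa [← hsurj.range_comp] at this

end IsFrame

/-- Rotations map loops to loops. -/
lemma isLoopAround_rot {γ : ℝ → E3} {τ : ℝ} {p : E3} (h : IsLoopAround γ τ p) {g : SO3}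
    (hg : g ∈ tetrahedralGroup) : IsLoopAround (fun t => rot g (γ t)) τ (rot g p) := by
  have hrange : (range fun t => rot g (γ t)) = rot g '' range γ :=
    range_comp (rot g) γ
  refine ⟨h.pos, (continuous_rot g).comp h.continuous, fun t => rot_mem_S2 hg (h.mem_sphere t),
    fun t => ?_, fun t ht t' ht' heq => h.simple ht ht' (rot_injective g heq), ?_, ?_, ?_⟩
  · simp only [h.periodic t]
  · rintro ⟨t, ht⟩
    exact h.avoids ⟨t, rot_injective g ht⟩
  · rintro ⟨t, ht⟩
    rw [← rot_neg] at ht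
    exact h.avoids_neg ⟨t, rot_injective g ht⟩
  · intro hmem
    apply h.separates
    rw [hrange] at hmem
    have hp : rot g p ∈ S2 \ rot g '' range γ := by
      by_contra hcon
      rw [connectedComponentIn_eq_empty hcon] at hmem
      exact hmem
    have h1 := (continuous_rot g⁻¹).continuousOn.image_connectedComponentIn_subset hp
      (mem_image_of_mem _ hmem)
    rw [rot_inv_rot, ← rot_neg, rot_inv_rot] at h1
    refine connectedComponentIn_mono _ ?_ h1
    rintro _ ⟨x, ⟨hx1, hx2⟩, rfl⟩
    refine ⟨rot_mem_S2 (inv_mem hg) hx1, fun hx => hx2 ?_⟩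
    exact ⟨_, hx, rot_rot_inv g x⟩

end SphereVortex

namespace SphereVortex

/-! ### The reduced Hamiltonian in polar coordinates -/

/-- This is the gradient in the ambient space; its radial part plays no role, since it disappears in
the product with `x` and against tangent directions. -/
lemma hasFDerivAt_psi {x : E3} (hx : IsRegular x) :
    HasFDerivAt psi (innerSL ℝ (gradPsi x)) x := by
  have h1 : ∀ k, HasFDerivAt (fun y : E3 => weight k * Real.log (1 - inner ℝ (axis k) y ^ 2))
      (weight k • ((1 - inner ℝ (axis k) x ^ 2)⁻¹ •
        -((2 * inner ℝ (axis k) x) • innerSL ℝ (axis k)))) x := fun k => by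
    have h2 : HasFDerivAt (fun y : E3 => inner ℝ (axis k) y) (innerSL ℝ (axis k)) x :=
      (innerSL ℝ (axis k)).hasFDerivAt
    have h3 := ((h2.pow 2).const_sub 1).log (by linarith [hx.2 k] : 1 - inner ℝ (axis k) x ^ 2 ≠ 0)
    refine (h3.const_mul (weight k)).congr_fderiv ?_
    simp
  refine (HasFDerivAt.fun_sum (u := Finset.univ) fun k _ => h1 k).neg.congr_fderiv ?_
  ext w
  simp only [neg_apply, sum_apply, gradPsi, innerSL_apply_apply,
    sum_inner, inner_smul_left, smul_apply, ← Finset.sum_neg_distrib]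
  refine Finset.sum_congr rfl fun k _ => ?_
  simp
  ring

lemma continuousOn_coeff (k : Fin 3 ⊕ Fin 4) :
    ContinuousOn (fun x : E3 => 2 * weight k * inner ℝ (axis k) x / (1 - inner ℝ (axis k) x ^ 2))
      {x | inner ℝ (axis k) x ^ 2 < 1} := by
  refine ContinuousOn.div (by fun_prop) (by fun_prop) fun x hx => ?_
  have : inner ℝ (axis k) x ^ 2 < 1 := hx
  linarith

lemma continuousOn_gradPsi : ContinuousOn gradPsi {x | ∀ k, inner ℝ (axis k) x ^ 2 < 1} := by
  unfold gradPsi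
  exact continuousOn_finsetSum _ fun k _ =>
    ((continuousOn_coeff k).mono fun x (hx : ∀ k, inner ℝ (axis k) x ^ 2 < 1) => hx k).smul continuousOn_const

/-- The derivative of `circ`. -/
def circDir (e₁ e₂ : E3) (θ : ℝ) : E3 := -Real.sin θ • e₁ + Real.cos θ • e₂

lemma hasFDerivAt_polar (u₀ e₁ e₂ : E3) (p : ℝ × ℝ) :
    HasFDerivAt (fun p : ℝ × ℝ => geo u₀ (circ e₁ e₂ p.2) p.1)
      ((ContinuousLinearMap.fst ℝ ℝ ℝ).smulRight (geoDir u₀ (circ e₁ e₂ p.2) p.1) +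
        (ContinuousLinearMap.snd ℝ ℝ ℝ).smulRight (Real.sin p.1 • circDir e₁ e₂ p.2)) p := by
  have h1 : HasFDerivAt (fun p : ℝ × ℝ => p.1) (ContinuousLinearMap.fst ℝ ℝ ℝ) p := hasFDerivAt_fst
  have h2 : HasFDerivAt (fun p : ℝ × ℝ => p.2) (ContinuousLinearMap.snd ℝ ℝ ℝ) p := hasFDerivAt_snd
  refine ((h1.cos.smul_const u₀).add (h1.sin.smul
    ((h2.cos.smul_const e₁).add (h2.sin.smul_const e₂)))).congr_fderiv ?_
  apply ContinuousLinearMap.ext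
  intro w
  simp [geoDir, circDir, circ]
  module

variable {u₀ e₁ e₂ : E3} {σ : ℝ}

/-- It expresses the position as a product of the angular and radial unit vectors, so that the
triple product formula splits `∇ψ × u` into its polar components. -/
lemma IsFrame.cross_circDir_geoDir (h : IsFrame u₀ e₁ e₂ σ) (r θ : ℝ) :
    cross (circDir e₁ e₂ θ) (geoDir u₀ (circ e₁ e₂ θ) r) = -σ • geo u₀ (circ e₁ e₂ θ) r := by
  have h1 : cross e₁ u₀ = -(σ • e₂) := by rw [cross_anticomm_eq, h.cross₀₁]
  have h2 : cross e₂ e₁ = -(σ • u₀) := by rw [cross_anticomm_eq, h.cross₁₂]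
  have hcs := Real.sin_sq_add_cos_sq θ
  simp only [circDir, geoDir, geo, circ, cross_add_left, cross_add_right, cross_smul_left,
    cross_smul_right, h1, h2, h.cross₁₂, h.cross₂₀, cross_self_eq]
  have : σ • u₀ = (Real.sin θ ^ 2 + Real.cos θ ^ 2) • σ • u₀ := by rw [hcs, one_smul]
  match_scalars
  · ring
  · ring
  · linear_combination (-σ * Real.cos r) * hcs

/-- The rotation, as a continuous linear map. -/
def rotL (g : SO3) : E3 →L[ℝ] E3 :=
  LinearMap.toContinuousLinearMap
    { toFun := rot g, map_add' := rot_add g, map_smul' := fun c x => rot_smul g c x }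

lemma rot_geo (g : SO3) (u₀ e : E3) (r : ℝ) : rot g (geo u₀ e r) = geo (rot g u₀) (rot g e) r := by
  simp only [geo, rot_add, rot_smul]

lemma rot_mem_tangentCircle {g : SO3} (hg : g ∈ tetrahedralGroup) {e : E3}
    (he : e ∈ tangentCircle u₀) (hu : rot g u₀ = u₀) : rot g e ∈ tangentCircle u₀ := by
  refine ⟨rot_mem_S2 hg he.1, ?_⟩
  rw [← hu, inner_rot hg, he.2]

/-! ### Families of periodic solutions around an extremum of the reduced Hamiltonian -/

/-- In the punctured disc of radius `r₀` about `u₀` the function `η ψ`, where `η = ±1`, increases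
along the geodesics from `u₀`. -/
structure IsPolarExtremum (u₀ : E3) (η r₀ : ℝ) : Prop where
  mem_S2 : u₀ ∈ S2
  sq_eq : η ^ 2 = 1
  pos : 0 < r₀
  lt_pi : r₀ < Real.pi
  regular : ∀ e ∈ tangentCircle u₀, ∀ r ∈ Ioo 0 r₀, IsRegular (geo u₀ e r)
  increasing : ∀ e ∈ tangentCircle u₀, ∀ r ∈ Ioo 0 r₀,
    0 < η * inner ℝ (gradPsi (geo u₀ e r)) (geoDir u₀ e r)

lemma IsPolarExtremum.mono {η r₀ r₁ : ℝ} (h : IsPolarExtremum u₀ η r₀) (h0 : 0 < r₁)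
    (h1 : r₁ ≤ r₀) : IsPolarExtremum u₀ η r₁ where
  mem_S2 := h.mem_S2
  sq_eq := h.sq_eq
  pos := h0
  lt_pi := h1.trans_lt h.lt_pi
  regular e he r hr := h.regular e he r ⟨hr.1, hr.2.trans_le h1⟩
  increasing e he r hr := h.increasing e he r ⟨hr.1, hr.2.trans_le h1⟩

/-- The factor `12` and the constant `C` are kept so that the function is exactly `η` times the
energy on the punctured disc. -/
lemma IsPolarExtremum.polarData {η r₀ : ℝ} (h : IsPolarExtremum u₀ η r₀)
    (hf : IsFrame u₀ e₁ e₂ σ) (C : ℝ) :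
    PolarData (fun r θ => η * (12 * psi (geo u₀ (circ e₁ e₂ θ) r) + C))
      (fun r θ => 12 * (η * inner ℝ (gradPsi (geo u₀ (circ e₁ e₂ θ) r))
        (geoDir u₀ (circ e₁ e₂ θ) r)))
      (fun r θ => 12 * (η * inner ℝ (gradPsi (geo u₀ (circ e₁ e₂ θ) r))
        (Real.sin r • circDir e₁ e₂ θ))) r₀ where
  hasFDerivAt r hr θ := by
    have h1 := (hasFDerivAt_psi (h.regular _ (hf.circ_mem θ) r hr)).comp (r, θ)
      (hasFDerivAt_polar u₀ e₁ e₂ (r, θ))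
    refine (((h1.const_mul 12).add_const C).const_mul η).congr_fderiv ?_
    apply ContinuousLinearMap.ext
    intro w
    simp [inner_smul_right]
    ring
  pos r hr θ := mul_pos (by norm_num) (h.increasing _ (hf.circ_mem θ) r hr)
  periodic r θ := by simp only [circ, Real.cos_add_two_pi, Real.sin_add_two_pi]

variable (g : Fin 12 ≃ tetrahedralGroup) (f : Fin 8 ≃ cube)

lemma rot_one_index (u : E3) : rot (g (g.symm 1)) u = u := by
  rw [Equiv.apply_symm_apply]
  exact rot_one u

/-- A solution of the reduced equation lifts to the full system: the cube vertices are at rest, and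
each moving vortex is a fixed rotation of `w`. -/
lemma hasDerivAt_symConfig {w : ℝ → E3} {t : ℝ} (hreg : IsRegular (w t))
    (hw : HasDerivAt w (cross (gradPsi (w t)) (w t)) t) (j : Fin 20) :
    HasDerivAt (fun s => symConfig g f (w s) j) (vortexField (symConfig g f (w t)) j) t := by
  revert j
  refine Fin.addCases (m := 12) (n := 8) (fun j => ?_) fun k => ?_
  · rw [vortexField_castAdd, symField_self g f hreg]
    simp only [symConfig_castAdd]
    exact (rotL (g j)).hasFDerivAt.comp_hasDerivAt t hw
  · rw [vortexField_natAdd]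
    simp only [symConfig_natAdd]
    exact hasDerivAt_const t _

lemma dist_symConfig_le (u v : E3) : dist (symConfig g f u) (symConfig g f v) ≤ dist u v := by
  refine (dist_pi_le_iff dist_nonneg).2 ?_
  refine Fin.addCases (m := 12) (n := 8) (fun j => ?_) fun k => ?_
  · rw [symConfig_castAdd, symConfig_castAdd, dist_rot (g j).2]
  · rw [symConfig_natAdd, symConfig_natAdd, dist_self]
    exact dist_nonneg

/-- The periodic solutions of the reduced equation of motion on the level curves around an
extremum of the reduced Hamiltonian, parametrised by the level `s` of `η` times the energy. -/
theorem IsPolarExtremum.exists_flow {η r₀ : ℝ} (hext : IsPolarExtremum u₀ η r₀) {J : Set ℝ}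
    (hJ : IsOpen J)
    (hlow : ∀ s ∈ J, ∀ e ∈ tangentCircle u₀, ∃ r ∈ Ioo 0 r₀,
      η * energy (symConfig g f (geo u₀ e r)) < s)
    (hhigh : ∀ s ∈ J, ∀ e ∈ tangentCircle u₀, ∃ r ∈ Ioo 0 r₀,
      s < η * energy (symConfig g f (geo u₀ e r))) :
    ∃ (U : ℝ → ℝ → E3) (τ : ℝ → ℝ),
      ContinuousOn (fun p : ℝ × ℝ => U p.1 p.2) (J ×ˢ univ) ∧ ∀ s ∈ J,
      (∀ t, IsRegular (U s t) ∧ η * energy (symConfig g f (U s t)) = s ∧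
        HasDerivAt (U s) (cross (gradPsi (U s t)) (U s t)) t) ∧
      IsLoopAround (U s) (τ s) u₀ ∧
      range (U s) = {x | ∃ e ∈ tangentCircle u₀, ∃ r ∈ Ioo 0 r₀,
        geo u₀ e r = x ∧ η * energy (symConfig g f x) = s} ∧
      ∀ r₁ ∈ Ioo 0 r₀, (∀ e ∈ tangentCircle u₀, s < η * energy (symConfig g f (geo u₀ e r₁))) →
        (∀ t, dist (U s t) u₀ < r₁) ∧
        ∀ B > 0, (∀ r ∈ Ioo 0 r₁, ∀ e ∈ tangentCircle u₀,
          B ≤ η * inner ℝ (gradPsi (geo u₀ e r)) (geoDir u₀ e r) / Real.sin r) →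
          τ s ≤ 2 * Real.pi * B⁻¹ := by
  obtain ⟨C, hC⟩ := exists_energy_eq g f
  -- The orientation `-η` makes the angle increase with time at minima and at maxima alike.
  obtain ⟨e₁, e₂, hf⟩ := exists_isFrame hext.mem_S2 (σ := -η) (by rw [neg_sq, hext.sq_eq])
  have hE := hext.polarData hf C
  set E : ℝ → ℝ → ℝ := fun r θ => η * (12 * psi (geo u₀ (circ e₁ e₂ θ) r) + C) with hEdef
  have hEen : ∀ r ∈ Ioo 0 r₀, ∀ θ, E r θ = η * energy (symConfig g f (geo u₀ (circ e₁ e₂ θ) r)) :=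
    fun r hr θ => by rw [hC _ (hext.regular _ (hf.circ_mem θ) r hr)]
  obtain ⟨R, hR, hRper, hRcont, hRder⟩ := hE.exists_level hJ
    (fun s hs θ => by
      obtain ⟨r, hr, hlt⟩ := hlow s hs _ (hf.circ_mem θ)
      exact ⟨r, hr, by rwa [hEen r hr]⟩)
    (fun s hs θ => by
      obtain ⟨r, hr, hlt⟩ := hhigh s hs _ (hf.circ_mem θ)
      exact ⟨r, hr, by rwa [hEen r hr]⟩)
  set Λ : ℝ → ℝ → ℝ := fun r θ => η * inner ℝ (gradPsi (geo u₀ (circ e₁ e₂ θ) r))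
    (geoDir u₀ (circ e₁ e₂ θ) r) with hΛ
  have hΛpos : ∀ s ∈ J, ∀ θ, 0 < Λ (R s θ) θ := fun s hs θ =>
    hext.increasing _ (hf.circ_mem θ) _ (hR s hs θ).1
  have hRpi : ∀ s ∈ J, ∀ θ, R s θ ∈ Ioo 0 Real.pi := fun s hs θ =>
    ⟨(hR s hs θ).1.1, (hR s hs θ).1.2.trans hext.lt_pi⟩
  have hsin : ∀ s ∈ J, ∀ θ, 0 < Real.sin (R s θ) := fun s hs θ =>
    Real.sin_pos_of_mem_Ioo (hRpi s hs θ)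
  have hreg : ∀ s ∈ J, ∀ θ, IsRegular (geo u₀ (circ e₁ e₂ θ) (R s θ)) := fun s hs θ =>
    hext.regular _ (hf.circ_mem θ) _ (hR s hs θ).1
  have hgeocont : ContinuousOn (fun p : ℝ × ℝ => geo u₀ (circ e₁ e₂ p.2) (R p.1 p.2))
      (J ×ˢ univ) := by
    unfold geo circ
    fun_prop
  have hΛcont : ContinuousOn (fun p : ℝ × ℝ => Λ (R p.1 p.2) p.2) (J ×ˢ univ) := by
    refine ContinuousOn.mul continuousOn_const (ContinuousOn.inner ?_ ?_)
    · exact continuousOn_gradPsi.comp hgeocont fun p hp => (hreg p.1 hp.1 p.2).2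
    · unfold geoDir circ
      fun_prop
  -- Along a level curve `θ' = Λ / sin R`; its reciprocal is the integrand of the time function.
  obtain ⟨Θ, τ, hΘcont, hΘ⟩ := exists_circle_flow (J := J)
    (q := fun s θ => Real.sin (R s θ) / Λ (R s θ) θ)
    (ContinuousOn.div (Real.continuous_sin.comp_continuousOn hRcont) hΛcont
      fun p hp => (hΛpos p.1 hp.1 p.2).ne')
    (fun s hs θ => div_pos (hsin s hs θ) (hΛpos s hs θ))
    (fun s hs θ => by
      simp only [hΛ, hRper s hs, circ, Real.cos_add_two_pi, Real.sin_add_two_pi])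
  set U : ℝ → ℝ → E3 := fun s t => geo u₀ (circ e₁ e₂ (Θ s t)) (R s (Θ s t)) with hU
  have hUreg : ∀ s ∈ J, ∀ t, IsRegular (U s t) := fun s hs t => hreg s hs _
  have hUen : ∀ s ∈ J, ∀ t, η * energy (symConfig g f (U s t)) = s := fun s hs t => by
    rw [← hEen _ (hR s hs _).1, (hR s hs _).2]
  have hUder : ∀ s ∈ J, ∀ t, HasDerivAt (U s) (cross (gradPsi (U s t)) (U s t)) t :=
    fun s hs t => by
      obtain ⟨-, -, -, -, -, hder⟩ := hΘ s hs
      have h1 := (hRder s hs (Θ s t)).comp t (hder t)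
      have h2 := (hasFDerivAt_polar u₀ e₁ e₂ (R s (Θ s t), Θ s t)).comp_hasDerivAt t
        (h1.prodMk (hder t))
      refine h2.congr_deriv ?_
      have hs0 := (hsin s hs (Θ s t)).ne'
      have hl0 := (hΛpos s hs (Θ s t)).ne'
      have h3 : gradPsi (U s t) = η • (η • gradPsi (U s t)) := by
        rw [smul_smul, ← sq, hext.sq_eq, one_smul]
      have h4 := hf.cross_circDir_geoDir (R s (Θ s t)) (Θ s t)
      rw [neg_neg] at h4
      -- The coefficient of the angular vector is `Λ = θ' sin r`, that of the radial vector is `r' =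
      -- -η⟨∇ψ, circDir⟩`, in agreement with the slope of `R`.
      have h5 : cross (gradPsi (U s t)) (U s t) =
          η • (inner ℝ (gradPsi (U s t)) (geoDir u₀ (circ e₁ e₂ (Θ s t)) (R s (Θ s t))) •
            circDir e₁ e₂ (Θ s t) - inner ℝ (gradPsi (U s t)) (circDir e₁ e₂ (Θ s t)) •
            geoDir u₀ (circ e₁ e₂ (Θ s t)) (R s (Θ s t))) := by
        rw [← cross_cross_eq, h4, cross_smul_right, smul_smul, ← sq, hext.sq_eq, one_smul]
      rw [h5]
      simp only [add_apply, ContinuousLinearMap.smulRight_apply,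
        ContinuousLinearMap.coe_fst', ContinuousLinearMap.coe_snd', inner_smul_right, inv_div]
      change _ • _ + (Λ _ _ / _) • _ = _
      have h6 : Λ (R s (Θ s t)) (Θ s t) = η * inner ℝ (gradPsi (U s t))
        (geoDir u₀ (circ e₁ e₂ (Θ s t)) (R s (Θ s t))) := rfl
      rw [smul_smul, div_mul_cancel₀ _ hs0, smul_sub, smul_smul, ← h6, smul_smul, sub_eq_add_neg,
        add_comm, ← neg_smul]
      congr 2
      change -(12 * (η * (Real.sin (R s (Θ s t)) * _)) / (12 * Λ _ _)) * (Λ _ _ / _) = _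
      field_simp
      rfl
  have hUrange : ∀ s ∈ J, range (U s) = {x | ∃ e ∈ tangentCircle u₀, ∃ r ∈ Ioo 0 r₀,
      geo u₀ e r = x ∧ η * energy (symConfig g f x) = s} := fun s hs => by
    ext x
    constructor
    · rintro ⟨t, rfl⟩
      exact ⟨_, hf.circ_mem _, _, (hR s hs _).1, rfl, hUen s hs t⟩
    · rintro ⟨e, he, r, hr, rfl, hen⟩
      obtain ⟨θ, rfl⟩ := hf.exists_circ_eq he
      obtain ⟨t, rfl⟩ := (hΘ s hs).2.2.2.1 θ
      refine ⟨t, ?_⟩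
      -- Each ray meets the level only once, so the orbit is the entire level set in the punctured
      -- disc.
      have : R s (Θ s t) = r := (hE.strictMonoOn (Θ s t)).injOn (hR s hs _).1 hr (by
        rw [(hR s hs _).2, hEen r hr, hen])
      simp only [hU, this]
  have hUdist : ∀ s ∈ J, ∀ t, dist (U s t) u₀ ≤ R s (Θ s t) := fun s hs t =>
    dist_geo_le hext.mem_S2 (hf.circ_mem _) (hR s hs _).1.1.le
  have hRc : ∀ s ∈ J, Continuous (R s) := fun s hs =>
    hRcont.comp_continuous (f := fun θ : ℝ => (s, θ)) (by fun_prop) fun θ => ⟨hs, mem_univ _⟩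
  refine ⟨U, τ, ?_, fun s hs => ⟨fun t => ⟨hUreg s hs t, hUen s hs t, hUder s hs t⟩, ?_,
    hUrange s hs, fun r₁ hr₁ hlt => ?_⟩⟩
  · exact hgeocont.comp (f := fun q : ℝ × ℝ => (q.1, Θ q.1 q.2))
      (ContinuousOn.prodMk (by fun_prop) hΘcont) fun q hq => ⟨hq.1, mem_univ _⟩
  · obtain ⟨hτ, -, hmono, hsurj, hΘτ, hder⟩ := hΘ s hs
    exact hf.isLoopAround (hRc s hs) (hRpi s hs) (hRper s hs)
      (continuous_iff_continuousAt.2 fun t => (hder t).continuousAt) hmono hsurj hτ hΘτ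
  · have hsmall : ∀ θ, R s θ < r₁ := fun θ => by
      have h1 := hR s hs θ
      rw [← (hE.strictMonoOn θ).lt_iff_lt h1.1 hr₁, h1.2, hEen r₁ hr₁]
      exact hlt _ (hf.circ_mem θ)
    refine ⟨fun t => (hUdist s hs t).trans_lt (hsmall _), fun B hB hbound => ?_⟩
    refine (hΘ s hs).2.1 B⁻¹ fun θ => ?_
    have h1 := hbound _ ⟨(hR s hs θ).1.1, hsmall θ⟩ _ (hf.circ_mem θ)
    have h2 := inv_anti₀ hB h1
    rwa [inv_div] at h2

/-- The flow of `exists_flow` is reparametrised by the energy `h = ηs`. `hlow` and `hhigh` make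
every ray cross the level, `hlim` shrinks the level to `u₀`, and `hsep` keeps the discs about
distinct orbit points disjoint. The final clause turns a lower bound on the angular velocity near
`u₀` into an upper bound on the period. -/
theorem exists_periodicFamily {η r₀ : ℝ} (hext : IsPolarExtremum u₀ η r₀) {I : Set ℝ}
    (hI : IsOpen I) {l : Filter ℝ} (hIl : ∀ᶠ h in l, h ∈ I)
    (hsep : ∀ j k, rot (g j) u₀ ≠ rot (g k) u₀ → 2 * r₀ ≤ dist (rot (g j) u₀) (rot (g k) u₀))
    (hlow : ∀ h ∈ I, ∀ e ∈ tangentCircle u₀, ∃ r ∈ Ioo 0 r₀,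
      η * energy (symConfig g f (geo u₀ e r)) < η * h)
    (hhigh : ∀ h ∈ I, ∀ e ∈ tangentCircle u₀, ∃ r ∈ Ioo 0 r₀,
      η * h < η * energy (symConfig g f (geo u₀ e r)))
    (hlim : ∀ r ∈ Ioo 0 r₀, ∀ᶠ h in l, ∀ e ∈ tangentCircle u₀,
      η * h < η * energy (symConfig g f (geo u₀ e r))) :
    ∃ (u : ℝ → ℝ → E3) (τ : ℝ → ℝ), IsPeriodicFamily g f u₀ I l u τ ∧
      ∀ B > 0, (∃ r₁ ∈ Ioo 0 r₀, ∀ r ∈ Ioo 0 r₁, ∀ e ∈ tangentCircle u₀,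
        B ≤ η * inner ℝ (gradPsi (geo u₀ e r)) (geoDir u₀ e r) / Real.sin r) →
        ∀ᶠ h in l, τ h ≤ 2 * Real.pi * B⁻¹ := by
  have hηη : ∀ x : ℝ, η * (η * x) = x := fun x => by
    rw [← mul_assoc, ← sq, hext.sq_eq, one_mul]
  set J : Set ℝ := {s | η * s ∈ I} with hJdef
  have hJ : IsOpen J := hI.preimage (by fun_prop)
  have hmemJ : ∀ h ∈ I, η * h ∈ J := fun h hh => by
    simp only [hJdef, Set.mem_ofPred_eq, hηη]
    exact hh
  obtain ⟨U, τ, hUcont, hU⟩ := hext.exists_flow g f hJ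
    (fun s hs e he => by simpa only [hηη] using hlow _ hs e he)
    (fun s hs e he => by simpa only [hηη] using hhigh _ hs e he)
  have hsmall : ∀ r₁ ∈ Ioo 0 r₀, ∀ᶠ h in l, h ∈ I ∧ ∀ t, dist (U (η * h) t) u₀ < r₁ :=
    fun r₁ hr₁ => by
      filter_upwards [hIl, hlim r₁ hr₁] with h hh hlt
      exact ⟨hh, ((hU _ (hmemJ h hh)).2.2.2 r₁ hr₁ hlt).1⟩
  have hr₀ : ∀ s ∈ J, ∀ t, dist (U s t) u₀ < r₀ := fun s hs t => by
    obtain ⟨e, he, r, hr, heq, -⟩ := (hU s hs).2.2.1 ▸ mem_range_self (f := U s) t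
    rw [← heq]
    exact (dist_geo_le hext.mem_S2 he hr.1.le).trans_lt hr.2
  -- A rotation fixing `u₀` permutes the geodesics from `u₀` and preserves the energy, so it maps
  -- the full level set to itself.
  have hsub : ∀ s ∈ J, ∀ γ : tetrahedralGroup, rot γ u₀ = u₀ → ∀ t, rot γ (U s t) ∈ range (U s) :=
    fun s hs γ hγ t => by
      obtain ⟨e, he, r, hr, heq, hen⟩ := (hU s hs).2.2.1 ▸ mem_range_self (f := U s) t
      rw [(hU s hs).2.2.1]
      refine ⟨_, rot_mem_tangentCircle γ.2 he hγ, r, hr, ?_, ?_⟩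
      · rw [← heq, rot_geo, hγ]
      · rw [energy_symConfig_rot, hen]
  have hincl : ∀ s ∈ J, ∀ j k, rot (g j) u₀ = rot (g k) u₀ →
      range (fun t => rot (g j) (U s t)) ⊆ range fun t => rot (g k) (U s t) := by
    rintro s hs j k hjk _ ⟨t, rfl⟩
    obtain ⟨t', ht'⟩ := hsub s hs ((g k)⁻¹ * g j) (by
      rw [Subgroup.coe_mul, rot_mul, hjk]; exact rot_inv_rot _ _) t
    refine ⟨t', ?_⟩
    simp only
    rw [ht', Subgroup.coe_mul, rot_mul]
    exact rot_rot_inv _ _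
  refine ⟨fun h t => U (η * h) t, fun h => τ (η * h), ⟨?_, ?_, ?_, ?_, ?_, ?_, ?_, ?_⟩, ?_⟩
  · intro h hh t
    obtain ⟨hreg, -, hder⟩ := (hU _ (hmemJ h hh)).1 t
    exact ⟨hreg.isCollisionFree g f, hasDerivAt_symConfig g f hreg hder⟩
  · intro h hh t
    rw [← hηη (energy _), ((hU _ (hmemJ h hh)).1 t).2.1, hηη]
  · intro h hh
    have hl := (hU _ (hmemJ h hh)).2.1
    refine ⟨⟨hl.pos, fun t => ?_⟩, fun s hs => ?_⟩
    · simp only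
      rw [hl.periodic t]
    -- A shorter period would identify two points of the simple loop; the moving vortex labelled by
    -- the identity reveals it.
    · by_contra hlt
      have h1 := congrFun (hs.2 0) (Fin.castAdd 8 (g.symm 1))
      simp only at h1
      rw [symConfig_castAdd, symConfig_castAdd, rot_one_index, rot_one_index, zero_add] at h1
      have h2 := hl.simple ⟨hs.1.le, not_le.1 hlt⟩ ⟨le_rfl, hl.pos⟩ h1
      exact hs.1.ne' h2
  · exact hUcont.comp (f := fun q : ℝ × ℝ => (η * q.1, q.2)) (by fun_prop)
      fun q hq => ⟨hmemJ _ hq.1, mem_univ _⟩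
  · rw [Metric.tendstoUniformly_iff]
    intro ε hε
    have hm : 0 < min ε r₀ := lt_min hε hext.pos
    filter_upwards [hsmall (min ε r₀ / 2) ⟨by linarith, by linarith [min_le_right ε r₀]⟩] with h hh t
    rw [dist_comm]
    exact (dist_symConfig_le g f _ _).trans_lt
      ((hh.2 t).trans (by linarith [min_le_left ε r₀]))
  · exact fun h hh j => isLoopAround_rot (hU _ (hmemJ h hh)).2.1 (g j).2
  · exact fun h hh j k hjk =>
      (hincl _ (hmemJ h hh) j k hjk).antisymm (hincl _ (hmemJ h hh) k j hjk.symm)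
  -- A common point would lie within distance less than `r₀` of two centres that are at least `2 r₀`
  -- apart.
  · intro h hh j k hjk
    rw [Set.disjoint_left]
    rintro _ ⟨t, rfl⟩ ⟨t', ht'⟩
    simp only at ht'
    have h1 := hr₀ _ (hmemJ h hh) t
    have h2 := hr₀ _ (hmemJ h hh) t'
    have h5 := dist_triangle_left (rot (g j) u₀) (rot (g k) u₀) (rot (g j) (U (η * h) t))
    rw [dist_rot (g j).2, ← ht', dist_rot (g k).2] at h5
    linarith [hsep j k hjk]
  · rintro B hB ⟨r₁, hr₁, hbound⟩
    filter_upwards [hIl, hlim r₁ hr₁] with h hh hlt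
    exact ((hU _ (hmemJ h hh)).2.2.2 r₁ hr₁ hlt).2 B hB hbound

end SphereVortex

namespace SphereVortex

/-! ### Calculus along geodesics and separation of the orbit. -/

lemma isCompact_tangentCircle (u₀ : E3) : IsCompact (tangentCircle u₀) :=
  (isCompact_sphere (0 : E3) 1).inter_right
    (isClosed_eq (f := fun e : E3 => inner ℝ u₀ e) (g := fun _ => 0) (by fun_prop) (by fun_prop))

lemma geo_zero (u₀ e : E3) : geo u₀ e 0 = u₀ := by simp [geo]

lemma geoDir_zero (u₀ e : E3) : geoDir u₀ e 0 = e := by simp [geoDir]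

lemma hasDerivAt_geo (u₀ e : E3) (r : ℝ) : HasDerivAt (geo u₀ e) (geoDir u₀ e r) r :=
  ((Real.hasDerivAt_cos r).smul_const u₀).add ((Real.hasDerivAt_sin r).smul_const e)

lemma hasDerivAt_geoDir (u₀ e : E3) (r : ℝ) : HasDerivAt (geoDir u₀ e) (-geo u₀ e r) r := by
  refine (((Real.hasDerivAt_sin r).neg.smul_const u₀).add
    ((Real.hasDerivAt_cos r).smul_const e)).congr_deriv ?_
  simp only [geo]
  module

variable {u₀ : E3}

lemma hasDerivAt_psi_geo {e : E3} {r : ℝ} (h : IsRegular (geo u₀ e r)) :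
    HasDerivAt (fun r => psi (geo u₀ e r))
      (inner ℝ (gradPsi (geo u₀ e r)) (geoDir u₀ e r)) r :=
  (hasFDerivAt_psi h).comp_hasDerivAt r (hasDerivAt_geo u₀ e r)

lemma inner_gradPsi (x v : E3) : inner ℝ (gradPsi x) v =
    ∑ k, 2 * weight k * inner ℝ (axis k) x / (1 - inner ℝ (axis k) x ^ 2) * inner ℝ (axis k) v := by
  simp only [gradPsi, sum_inner, inner_smul_left, RCLike.conj_to_real]

variable (g : Fin 12 ≃ tetrahedralGroup) (f : Fin 8 ≃ cube)

/-- The points of the orbit of `u₀` are separated. -/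
lemma exists_separation (u₀ : E3) : ∃ δ > 0, ∀ j k, rot (g j) u₀ ≠ rot (g k) u₀ →
    δ ≤ dist (rot (g j) u₀) (rot (g k) u₀) := by
  have h : ∀ᶠ δ in 𝓝[>] (0 : ℝ), ∀ j k, rot (g j) u₀ ≠ rot (g k) u₀ →
      δ ≤ dist (rot (g j) u₀) (rot (g k) u₀) := by
    rw [eventually_all]
    intro j
    rw [eventually_all]
    intro k
    by_cases hne : rot (g j) u₀ = rot (g k) u₀
    · simp [hne]
    · filter_upwards [Ioo_mem_nhdsGT (dist_pos.2 hne)] with δ hδ _ using hδ.2.le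
  obtain ⟨δ, hδ, hpos⟩ := (h.and self_mem_nhdsWithin).exists
  exact ⟨δ, hpos, hδ⟩

lemma IsPolarExtremum.continuousOn_energy {η r₀ r : ℝ} (h : IsPolarExtremum u₀ η r₀)
    (hr : r ∈ Ioo 0 r₀) :
    ContinuousOn (fun e => energy (symConfig g f (geo u₀ e r))) (tangentCircle u₀) := by
  obtain ⟨C, hC⟩ := exists_energy_eq g f
  have h1 : ContinuousOn (fun e => 12 * psi (geo u₀ e r) + C) (tangentCircle u₀) := by
    refine ContinuousOn.add (continuousOn_const.mul fun e he => ?_) continuousOn_const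
    refine ContinuousAt.continuousWithinAt ?_
    refine ContinuousAt.comp (f := fun e => geo u₀ e r) (g := psi)
      (hasFDerivAt_psi (h.regular e he r hr)).continuousAt ?_
    unfold geo
    fun_prop
  exact h1.congr fun e he => hC _ (h.regular e he r hr)

/-! ### Families which emanate from a collision on a rotation axis -/

/-- A point on a rotation axis is a logarithmic singularity of the reduced Hamiltonian. -/
lemma exists_isPolarExtremum_of_axis {k₀ : Fin 3 ⊕ Fin 4} {ε : ℝ} (hε : ε ^ 2 = 1)
    (hu : u₀ = ε • axis k₀) (hne : ∀ k, k ≠ k₀ → inner ℝ (axis k) u₀ ^ 2 < 1) :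
    ∃ r₀ c, r₀ ≤ 1 ∧ 0 < c ∧ IsPolarExtremum u₀ (-1) r₀ ∧
      (∀ e ∈ tangentCircle u₀, ∀ r ∈ Ioo 0 r₀,
        c ≤ -1 * inner ℝ (gradPsi (geo u₀ e r)) (geoDir u₀ e r) * Real.sin r) ∧
      ∀ e ∈ tangentCircle u₀, ∀ r ∈ Ioo 0 r₀,
        -weight k₀ * (2 * Real.log r) ≤ psi (geo u₀ e r) := by
  have hax : axis k₀ = ε • u₀ := by rw [hu, smul_smul, ← sq, hε, one_smul]
  have hS : u₀ ∈ S2 := by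
    have : ‖u₀‖ ^ 2 = 1 := by
      rw [hu, norm_smul, norm_axis, mul_one, Real.norm_eq_abs, sq_abs, hε]
    rw [mem_S2_iff]
    nlinarith [norm_nonneg u₀]
  have hw := weight_pos k₀
  -- The radial derivative without its singular term; it is continuous near `r = 0`, so its product
  -- with `sin r` tends to `0`.
  set rest : ℝ → E3 → ℝ := fun r e => ∑ k ∈ Finset.univ.erase k₀, 2 * weight k *
    inner ℝ (axis k) (geo u₀ e r) / (1 - inner ℝ (axis k) (geo u₀ e r) ^ 2) *
      inner ℝ (axis k) (geoDir u₀ e r) with hrest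
  -- Compactness of the circle of directions gives one radius that works for all of them.
  have htube : ∀ᶠ r in 𝓝 (0 : ℝ), ∀ e ∈ tangentCircle u₀,
      (∀ k, k ≠ k₀ → inner ℝ (axis k) (geo u₀ e r) ^ 2 < 1) ∧
        rest r e * Real.sin r < weight k₀ / 2 := by
    refine (isCompact_tangentCircle u₀).eventually_forall_of_forall_eventually
      (P := fun r e => (∀ k, k ≠ k₀ → inner ℝ (axis k) (geo u₀ e r) ^ 2 < 1) ∧
        rest r e * Real.sin r < weight k₀ / 2) fun e he => ?_
    have hc : ∀ k, ContinuousAt (fun z : ℝ × E3 => inner ℝ (axis k) (geo u₀ z.2 z.1)) (0, e) :=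
      fun k => by unfold geo; fun_prop
    have hc' : ∀ k, ContinuousAt (fun z : ℝ × E3 => inner ℝ (axis k) (geoDir u₀ z.2 z.1)) (0, e) :=
      fun k => by unfold geoDir; fun_prop
    refine Eventually.and ?_ ?_
    · rw [eventually_all]
      intro k
      by_cases hk : k = k₀
      · simp [hk]
      · have := ((hc k).pow 2).eventually_lt (continuousAt_const (y := (1 : ℝ)))
          (by simpa only [Pi.pow_apply, geo_zero] using hne k hk)
        filter_upwards [this] with z hz _ using hz
    · have hcont : ContinuousAt (fun z : ℝ × E3 => rest z.1 z.2 * Real.sin z.1) (0, e) := by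
        refine ContinuousAt.mul ?_ (by fun_prop)
        refine tendsto_finsetSum _ fun k hk => ?_
        refine ((continuousAt_const.mul (hc k)).div (continuousAt_const.sub ((hc k).pow 2)) ?_).mul
          (hc' k)
        have := hne k (Finset.ne_of_mem_erase hk)
        simp only [Pi.sub_apply, Pi.pow_apply, geo_zero]
        linarith
      exact hcont.eventually_lt (continuousAt_const (y := weight k₀ / 2)) (by simp [hw])
  obtain ⟨δ, hδ, hball⟩ := Metric.eventually_nhds_iff.1 htube
  have hmin : 0 < min δ (1 / 2) := lt_min hδ (by norm_num)
  have hr : ∀ r ∈ Ioo 0 (min δ (1 / 2)), r < 1 / 2 ∧ ∀ e ∈ tangentCircle u₀,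
      (∀ k, k ≠ k₀ → inner ℝ (axis k) (geo u₀ e r) ^ 2 < 1) ∧
        rest r e * Real.sin r < weight k₀ / 2 := fun r hr => by
    refine ⟨hr.2.trans_le (min_le_right _ _), hball ?_⟩
    rw [Real.dist_0_eq_abs, abs_of_pos hr.1]
    exact hr.2.trans_le (min_le_left _ _)
  have hsin : ∀ r ∈ Ioo 0 (min δ (1 / 2)), 0 < Real.sin r := fun r hr' =>
    Real.sin_pos_of_mem_Ioo ⟨hr'.1, by linarith [(hr r hr').1, Real.pi_gt_three]⟩
  have hq : ∀ e ∈ tangentCircle u₀, ∀ r, 1 - inner ℝ (axis k₀) (geo u₀ e r) ^ 2 = Real.sin r ^ 2 :=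
    fun e he r => by
      rw [hax, inner_smul_left, inner_geo hS he, mul_pow]
      simp only [RCLike.conj_to_real]
      rw [hε]
      linarith [Real.sin_sq_add_cos_sq r]
  have hreg : ∀ e ∈ tangentCircle u₀, ∀ r ∈ Ioo 0 (min δ (1 / 2)), IsRegular (geo u₀ e r) :=
    fun e he r hr' => ⟨geo_mem_S2 hS he r, fun k => by
      by_cases hk : k = k₀
      · rw [hk]
        have := hq e he r
        nlinarith [hsin r hr']
      · exact ((hr r hr').2 e he).1 k hk⟩
  have hbound : ∀ e ∈ tangentCircle u₀, ∀ r ∈ Ioo 0 (min δ (1 / 2)),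
      weight k₀ ≤ -1 * inner ℝ (gradPsi (geo u₀ e r)) (geoDir u₀ e r) * Real.sin r :=
    fun e he r hr' => by
      have h1 := ((hr r hr').2 e he).2
      have hs := (hsin r hr').ne'
      have h2 : inner ℝ (axis k₀) (geoDir u₀ e r) = -(ε * Real.sin r) := by
        rw [hax, inner_smul_left, geoDir, inner_add_right, inner_smul_right, inner_smul_right, he.2,
          real_inner_self_eq_norm_sq, mem_S2_iff.1 hS]
        simp
      have h3 : inner ℝ (axis k₀) (geo u₀ e r) = ε * Real.cos r := by
        rw [hax, inner_smul_left, inner_geo hS he]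
        simp
      have h4 : inner ℝ (gradPsi (geo u₀ e r)) (geoDir u₀ e r) * Real.sin r =
          -(2 * weight k₀ * Real.cos r) + rest r e * Real.sin r := by
        rw [inner_gradPsi, ← Finset.add_sum_erase _ _ (Finset.mem_univ k₀), add_mul, hq e he r, h2,
          h3]
        congr 1
        field_simp
        linear_combination (-Real.cos r) * hε
      have h5 := Real.one_sub_sq_div_two_le_cos (x := r)
      have h6 := (hr r hr').1
      -- The singular term contributes at least `2w · 7/8` and the rest takes away at most `w/2`,
      -- leaving more than `w = weight k₀`.
      have h7 : 7 / 8 ≤ Real.cos r := by nlinarith [hr'.1]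
      nlinarith
  refine ⟨min δ (1 / 2), weight k₀, (min_le_right _ _).trans (by norm_num), hw, ⟨hS, by norm_num,
    hmin, by linarith [min_le_right δ (1 / 2), Real.pi_gt_three], hreg, fun e he r hr' => ?_⟩,
    hbound, fun e he r hr' => ?_⟩
  · exact pos_of_mul_pos_left (hw.trans_le (hbound e he r hr')) (hsin r hr').le
  · have hlog : Real.log (1 - inner ℝ (axis k₀) (geo u₀ e r) ^ 2) ≤ 2 * Real.log r := by
      rw [hq e he r, Real.log_pow]
      have := Real.log_le_log (hsin r hr') (Real.sin_lt hr'.1).le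
      push_cast
      linarith
    rw [psi, ← Finset.add_sum_erase _ _ (Finset.mem_univ k₀)]
    -- The other axes only raise `psi`, since their logarithms have arguments at most `1`.
    have h8 : ∑ k ∈ Finset.univ.erase k₀, weight k *
        Real.log (1 - inner ℝ (axis k) (geo u₀ e r) ^ 2) ≤ 0 :=
      Finset.sum_nonpos fun k _ => mul_nonpos_of_nonneg_of_nonpos (weight_pos k).le
        (Real.log_nonpos (by linarith [(hreg e he r hr').2 k])
          (by linarith [sq_nonneg (inner ℝ (axis k) (geo u₀ e r))]))
    nlinarith

/-- The energy rises to `+∞` towards `u₀`, so every level above its maximum on some small circle is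
a loop around `u₀`. The angular velocity is at least `c / sin² r`, which forces the periods to `0`.
-/
theorem exists_periodicFamily_of_axis {k₀ : Fin 3 ⊕ Fin 4} {ε : ℝ} (hε : ε ^ 2 = 1)
    (hu : u₀ = ε • axis k₀) (hne : ∀ k, k ≠ k₀ → inner ℝ (axis k) u₀ ^ 2 < 1) :
    ∃ (h₁ : ℝ) (u : ℝ → ℝ → E3) (τ : ℝ → ℝ),
      IsPeriodicFamily g f u₀ (Ioi h₁) atTop u τ ∧ Tendsto τ atTop (𝓝 0) := by
  obtain ⟨r', c, hr'1, hc, hext', hbound', hlog'⟩ := exists_isPolarExtremum_of_axis hε hu hne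
  obtain ⟨δ, hδ, hsep⟩ := exists_separation g u₀
  obtain ⟨C, hC⟩ := exists_energy_eq g f
  set r₀ := min r' (δ / 2) with hr₀
  have hle : r₀ ≤ r' := min_le_left _ _
  have hext : IsPolarExtremum u₀ (-1) r₀ := hext'.mono (lt_min hext'.pos (by linarith)) hle
  have hpos := hext.pos
  have hsub : ∀ {r}, r ∈ Ioo 0 r₀ → r ∈ Ioo 0 r' := fun hr => ⟨hr.1, hr.2.trans_le hle⟩
  have hmax : ∀ r ∈ Ioo 0 r₀, ∃ M, ∀ e ∈ tangentCircle u₀,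
      energy (symConfig g f (geo u₀ e r)) ≤ M := fun r hr => by
    obtain ⟨e, -, he⟩ := (isCompact_tangentCircle u₀).exists_isMaxOn (exists_mem_tangentCircle u₀)
      (hext.continuousOn_energy g f hr)
    exact ⟨_, fun e' he' => he he'⟩
  obtain ⟨h₁, hh₁⟩ := hmax (r₀ / 2) ⟨by linarith, by linarith⟩
  obtain ⟨u, τ, hfam, hτ⟩ := exists_periodicFamily g f hext (I := Ioi h₁) isOpen_Ioi
    (l := atTop) (Ioi_mem_atTop h₁)
    (fun j k hjk => by linarith [hsep j k hjk, min_le_right r' (δ / 2)])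
    (fun h hh e he => by
      -- The threshold solves `-24 w log r + C > h`, where the left side bounds the energy from
      -- below.
      have hev : ∀ᶠ r in 𝓝[>] (0 : ℝ), Real.log r < -(h - C) / (24 * weight k₀) :=
        Real.tendsto_log_nhdsGT_zero.eventually_lt_atBot _
      obtain ⟨r, hr1, hr2⟩ := (hev.and (Ioo_mem_nhdsGT hpos)).exists
      refine ⟨r, hr2, ?_⟩
      have h2 := hlog' e he r (hsub hr2)
      have hw := weight_pos k₀
      rw [lt_div_iff₀ (by positivity)] at hr1
      rw [hC _ (hext.regular e he r hr2)]
      linarith)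
    (fun h hh e he => ⟨r₀ / 2, ⟨by linarith, by linarith⟩, by
      have := hh₁ e he
      have hh' : h₁ < h := hh
      linarith⟩)
    (fun r hr => by
      obtain ⟨M, hM⟩ := hmax r hr
      filter_upwards [Ioi_mem_atTop M] with h hh e he
      have := hM e he
      have hh' : M < h := hh
      linarith)
  refine ⟨h₁, u, τ, hfam, ?_⟩
  rw [Metric.tendsto_nhds]
  intro ε' hε'
  have hpi := Real.pi_pos
  -- With `B = 4π/ε'` the period bound `2π/B` equals `ε'/2`. The radius is cut down so that `B sin²
  -- r ≤ B r ≤ c`.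
  have hB : 0 < 4 * Real.pi / ε' := by positivity
  have hr₁ : 0 < min (r₀ / 2) (c / (4 * Real.pi / ε')) := lt_min (by linarith) (by positivity)
  filter_upwards [hτ (4 * Real.pi / ε') hB ⟨min (r₀ / 2) (c / (4 * Real.pi / ε')),
    ⟨hr₁, (min_le_left _ _).trans_lt (by linarith)⟩, fun r hr e he => by
      have hra : r < r₀ / 2 := hr.2.trans_le (min_le_left _ _)
      have hrb : r < c / (4 * Real.pi / ε') := hr.2.trans_le (min_le_right _ _)
      have hr2 : r ∈ Ioo 0 r' := ⟨hr.1, by linarith⟩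
      have hs : 0 < Real.sin r := Real.sin_pos_of_mem_Ioo ⟨hr.1, by linarith [Real.pi_gt_three]⟩
      have hsr := Real.sin_lt hr.1
      have h1 := hbound' e he r hr2
      rw [lt_div_iff₀ hB] at hrb
      rw [le_div_iff₀ hs]
      refine le_of_mul_le_mul_right (le_trans ?_ h1) hs
      have h2 : Real.sin r * Real.sin r ≤ r := by nlinarith
      calc 4 * Real.pi / ε' * Real.sin r * Real.sin r
          = (Real.sin r * Real.sin r) * (4 * Real.pi / ε') := by ring
        _ ≤ r * (4 * Real.pi / ε') := mul_le_mul_of_nonneg_right h2 hB.le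
        _ ≤ c := hrb.le⟩, Ioi_mem_atTop h₁] with h hh hI
  have hτpos := (hfam.loop h hI 0).pos
  rw [Real.dist_0_eq_abs, abs_of_pos hτpos]
  refine hh.trans_lt ?_
  rw [inv_div]
  have : 2 * Real.pi * (ε' / (4 * Real.pi)) = ε' / 2 := by field_simp; ring
  linarith

/-! ### Families which emanate from a nondegenerate minimum -/

/-- The second derivative of the reduced Hamiltonian along the geodesic through `x` with
velocity `v`. -/
def hessPsi (x v : E3) : ℝ :=
  ∑ k, 2 * weight k * ((inner ℝ (axis k) v ^ 2 * (1 + inner ℝ (axis k) x ^ 2) -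
    inner ℝ (axis k) x ^ 2 * (1 - inner ℝ (axis k) x ^ 2)) / (1 - inner ℝ (axis k) x ^ 2) ^ 2)

/-- The negative term in `hessPsi` arises from the geodesic equation `γ'' = -γ`. -/
lemma hasDerivAt_inner_gradPsi {e : E3} {r : ℝ} (h : IsRegular (geo u₀ e r)) :
    HasDerivAt (fun r => inner ℝ (gradPsi (geo u₀ e r)) (geoDir u₀ e r))
      (hessPsi (geo u₀ e r) (geoDir u₀ e r)) r := by
  simp only [inner_gradPsi, hessPsi]
  refine HasDerivAt.fun_sum fun k _ => ?_
  have h1 : HasDerivAt (fun r => inner ℝ (axis k) (geo u₀ e r))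
      (inner ℝ (axis k) (geoDir u₀ e r)) r :=
    (innerSL ℝ (axis k)).hasFDerivAt.comp_hasDerivAt r (hasDerivAt_geo u₀ e r)
  have h2 : HasDerivAt (fun r => inner ℝ (axis k) (geoDir u₀ e r))
      (-inner ℝ (axis k) (geo u₀ e r)) r := by
    have := (innerSL ℝ (axis k)).hasFDerivAt.comp_hasDerivAt r (hasDerivAt_geoDir u₀ e r)
    exact this.congr_deriv (by simp)
  have h0 : 1 - inner ℝ (axis k) (geo u₀ e r) ^ 2 ≠ 0 := by linarith [h.2 k]
  refine (((h1.const_mul (2 * weight k)).div ((h1.pow 2).const_sub 1) h0).mul h2).congr_deriv ?_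
  simp only [Pi.pow_apply, Pi.div_apply]
  field_simp
  ring

/-- Positivity of the second derivative on the compact circle of directions persists for small `r`;
the radial derivative then increases strictly from the value `0`. -/
lemma exists_isPolarExtremum_of_min (hreg : IsRegular u₀)
    (hcrit : ∀ e ∈ tangentCircle u₀, inner ℝ (gradPsi u₀) e = 0)
    (hhess : ∀ e ∈ tangentCircle u₀, 0 < hessPsi u₀ e) :
    ∃ r₀, IsPolarExtremum u₀ 1 r₀ := by
  have htube : ∀ᶠ r in 𝓝 (0 : ℝ), ∀ e ∈ tangentCircle u₀,
      (∀ k, inner ℝ (axis k) (geo u₀ e r) ^ 2 < 1) ∧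
        0 < hessPsi (geo u₀ e r) (geoDir u₀ e r) := by
    refine (isCompact_tangentCircle u₀).eventually_forall_of_forall_eventually
      (P := fun r e => (∀ k, inner ℝ (axis k) (geo u₀ e r) ^ 2 < 1) ∧
        0 < hessPsi (geo u₀ e r) (geoDir u₀ e r)) fun e he => ?_
    have hc : ∀ k, ContinuousAt (fun z : ℝ × E3 => inner ℝ (axis k) (geo u₀ z.2 z.1)) (0, e) :=
      fun k => by unfold geo; fun_prop
    have hc' : ∀ k, ContinuousAt (fun z : ℝ × E3 => inner ℝ (axis k) (geoDir u₀ z.2 z.1)) (0, e) :=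
      fun k => by unfold geoDir; fun_prop
    refine Eventually.and ?_ ?_
    · rw [eventually_all]
      intro k
      exact ((hc k).pow 2).eventually_lt (continuousAt_const (y := (1 : ℝ)))
        (by simpa only [Pi.pow_apply, geo_zero] using hreg.2 k)
    · have hcont : ContinuousAt (fun z : ℝ × E3 => hessPsi (geo u₀ z.2 z.1) (geoDir u₀ z.2 z.1))
          (0, e) := by
        refine tendsto_finsetSum _ fun k hk => ?_
        refine continuousAt_const.mul (ContinuousAt.div
          ((((hc' k).pow 2).mul (continuousAt_const.add ((hc k).pow 2))).sub
            (((hc k).pow 2).mul (continuousAt_const.sub ((hc k).pow 2))))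
          ((continuousAt_const.sub ((hc k).pow 2)).pow 2) (pow_ne_zero 2 ?_))
        have := hreg.2 k
        simp only [geo_zero]
        linarith
      exact (continuousAt_const (y := (0 : ℝ))).eventually_lt hcont
        (by simpa only [geo_zero, geoDir_zero] using hhess e he)
  obtain ⟨δ, hδ, hball⟩ := Metric.eventually_nhds_iff.1 htube
  have hmin : 0 < min δ 1 := lt_min hδ one_pos
  have hr : ∀ r ∈ Ico 0 (min δ 1), ∀ e ∈ tangentCircle u₀,
      (∀ k, inner ℝ (axis k) (geo u₀ e r) ^ 2 < 1) ∧
        0 < hessPsi (geo u₀ e r) (geoDir u₀ e r) := fun r hr => by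
    refine hball ?_
    rw [Real.dist_0_eq_abs, abs_of_nonneg hr.1]
    exact hr.2.trans_le (min_le_left _ _)
  have hreg' : ∀ e ∈ tangentCircle u₀, ∀ r ∈ Ico 0 (min δ 1), IsRegular (geo u₀ e r) :=
    fun e he r hr' => ⟨geo_mem_S2 hreg.1 he r, (hr r hr' e he).1⟩
  refine ⟨min δ 1, hreg.1, by norm_num, hmin, by linarith [min_le_right δ 1, Real.pi_gt_three],
    fun e he r hr' => hreg' e he r ⟨hr'.1.le, hr'.2⟩, fun e he r hr' => ?_⟩
  have hmono : StrictMonoOn (fun r => inner ℝ (gradPsi (geo u₀ e r)) (geoDir u₀ e r))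
      (Ico 0 (min δ 1)) := by
    apply strictMonoOn_of_deriv_pos (convex_Ico _ _)
    · exact fun r hr => (hasDerivAt_inner_gradPsi (hreg' e he r hr)).continuousAt.continuousWithinAt
    · intro r hr''
      have hr3 := interior_subset hr''
      rw [(hasDerivAt_inner_gradPsi (hreg' e he r hr3)).deriv]
      exact (hr r hr3 e he).2
  have h1 := hmono ⟨le_rfl, hmin⟩ ⟨hr'.1.le, hr'.2⟩ hr'.1
  simp only [geo_zero, geoDir_zero, hcrit e he] at h1
  rwa [one_mul]

theorem exists_periodicFamily_of_min (hreg : IsRegular u₀)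
    (hcrit : ∀ e ∈ tangentCircle u₀, inner ℝ (gradPsi u₀) e = 0)
    (hhess : ∀ e ∈ tangentCircle u₀, 0 < hessPsi u₀ e) :
    ∃ ε > 0, ∃ (u : ℝ → ℝ → E3) (τ : ℝ → ℝ),
      IsPeriodicFamily g f u₀
        (Ioo (energy (symConfig g f u₀)) (energy (symConfig g f u₀) + ε))
        (𝓝[>] (energy (symConfig g f u₀))) u τ := by
  obtain ⟨r', hext'⟩ := exists_isPolarExtremum_of_min hreg hcrit hhess
  obtain ⟨δ, hδ, hsep⟩ := exists_separation g u₀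
  obtain ⟨C, hC⟩ := exists_energy_eq g f
  set r₀ := min r' (δ / 2) with hr₀
  have hext : IsPolarExtremum u₀ 1 r₀ :=
    hext'.mono (lt_min hext'.pos (by linarith)) (min_le_left _ _)
  have hpos := hext.pos
  set h₀ := energy (symConfig g f u₀) with hh₀
  have hen₀ : h₀ = 12 * psi u₀ + C := hC _ hreg
  have hregI : ∀ e ∈ tangentCircle u₀, ∀ r ∈ Ico 0 r₀, IsRegular (geo u₀ e r) :=
    fun e he r hr => by
      rcases hr.1.eq_or_lt with h | h
      · rwa [← h, geo_zero]
      · exact hext.regular e he r ⟨h, hr.2⟩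
  have hgt : ∀ r ∈ Ioo 0 r₀, ∀ e ∈ tangentCircle u₀, h₀ < energy (symConfig g f (geo u₀ e r)) :=
    fun r hr e he => by
      have hmono : StrictMonoOn (fun r => psi (geo u₀ e r)) (Ico 0 r₀) := by
        apply strictMonoOn_of_deriv_pos (convex_Ico _ _)
        · exact fun r hr => (hasDerivAt_psi_geo (hregI e he r hr)).continuousAt.continuousWithinAt
        · intro r hr
          rw [interior_Ico] at hr
          rw [(hasDerivAt_psi_geo (hext.regular e he r hr)).deriv]
          simpa using hext.increasing e he r hr
      have h1 := hmono ⟨le_rfl, hpos⟩ ⟨hr.1.le, hr.2⟩ hr.1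
      simp only [geo_zero] at h1
      rw [hC _ (hext.regular e he r hr), hen₀]
      linarith
  have hmin : ∀ r ∈ Ioo 0 r₀, ∃ m > h₀, ∀ e ∈ tangentCircle u₀,
      m ≤ energy (symConfig g f (geo u₀ e r)) := fun r hr => by
    obtain ⟨e, he, hle⟩ := (isCompact_tangentCircle u₀).exists_isMinOn (exists_mem_tangentCircle u₀)
      (hext.continuousOn_energy g f hr)
    exact ⟨_, hgt r hr e he, fun e' he' => hle he'⟩
  -- The levels strictly between `h₀` and the minimum energy on the circle of radius `r₀ / 2` are
  -- loops inside that circle, so `ε = m - h₀`.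
  obtain ⟨m, hm, hme⟩ := hmin (r₀ / 2) ⟨by linarith, by linarith⟩
  refine ⟨m - h₀, by linarith, ?_⟩
  rw [add_sub_cancel]
  obtain ⟨u, τ, hfam, -⟩ := exists_periodicFamily g f hext (I := Ioo h₀ m) isOpen_Ioo
    (l := 𝓝[>] h₀) (Ioo_mem_nhdsGT hm)
    (fun j k hjk => by linarith [hsep j k hjk, min_le_right r' (δ / 2)])
    (fun h hh e he => by
      have hc : ContinuousAt (fun r => 12 * psi (geo u₀ e r) + C) 0 :=
        (continuousAt_const.mul (hasDerivAt_psi_geo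
          (hregI e he 0 ⟨le_rfl, hpos⟩)).continuousAt).add continuousAt_const
      have hev : ∀ᶠ r in 𝓝 (0 : ℝ), 12 * psi (geo u₀ e r) + C < h :=
        hc.eventually_lt (continuousAt_const (y := h)) (by
          rw [geo_zero, ← hen₀]; exact hh.1)
      obtain ⟨r, hr1, hr2⟩ := (Filter.Eventually.and (nhdsWithin_le_nhds hev)
        (Ioo_mem_nhdsGT hpos)).exists
      refine ⟨r, hr2, ?_⟩
      rw [hC _ (hext.regular e he r hr2), one_mul, one_mul]
      exact hr1)
    (fun h hh e he => ⟨r₀ / 2, ⟨by linarith, by linarith⟩, by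
      linarith [hme e he, hh.2]⟩)
    (fun r hr => by
      obtain ⟨m', hm', hle⟩ := hmin r hr
      filter_upwards [Ioo_mem_nhdsGT hm'] with h hh e he
      linarith [hle e he, hh.2])
  exact ⟨u, τ, hfam⟩

end SphereVortex

namespace SphereVortex

/-! ### Counting the vortices which collide -/

/-- An integer vector as a point of Euclidean space. -/
def castVec (v : Fin 3 → ℤ) : E3 := WithLp.toLp 2 fun i => (v i : ℝ)

lemma vert_eq (a : Fin 4) : vert a = (1 / √3 : ℝ) • castVec (sgn a) := rfl

/-- Passing to integer vectors makes the count of coinciding vortices a finite decidable problem. -/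
lemma rot_tetElt_castVec {c : ℝ} (hc : c ≠ 0) (p : Fin 3 × Fin 4) (v w : Fin 3 → ℤ) :
    rot (tetElt p) (c • castVec v) = c • castVec w ↔ ∀ i, sgn p.2 i * v (i + p.1) = w i := by
  rw [rot_smul]
  constructor
  · intro h i
    have h1 := congrArg (fun x : E3 => x i) (smul_right_injective _ hc h)
    simp only [rot_tetElt, castVec] at h1
    exact_mod_cast h1
  · intro h
    congr 1
    ext i
    rw [rot_tetElt]
    simp only [castVec]
    exact_mod_cast h i

variable (g : Fin 12 ≃ tetrahedralGroup) (f : Fin 8 ≃ cube)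

lemma ncard_rot_eq {c : ℝ} (hc : c ≠ 0) (v w : Fin 3 → ℤ) :
    {j | rot (g j) (c • castVec v) = c • castVec w}.ncard =
      (Finset.univ.filter fun p : Fin 3 × Fin 4 => ∀ i, sgn p.2 i * v (i + p.1) = w i).card := by
  rw [← ncard_coe_finset]
  have h : {j | rot (g j) (c • castVec v) = c • castVec w} = (g.trans tetEquiv.symm) ⁻¹'
      ((Finset.univ.filter fun p : Fin 3 × Fin 4 => ∀ i, sgn p.2 i * v (i + p.1) = w i :
        Finset (Fin 3 × Fin 4)) : Set (Fin 3 × Fin 4)) := by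
    ext j
    obtain ⟨p, hp⟩ := tetEquiv.surjective (g j)
    simp only [mem_preimage, Equiv.trans_apply, ← hp, Equiv.symm_apply_apply,
      Finset.coe_filter, Finset.mem_univ, true_and]
    change rot (g j) _ = _ ↔ _
    rw [← hp, coe_tetEquiv, rot_tetElt_castVec hc]
    rfl
  rw [h, ncard_preimage_of_injective_subset_range (Equiv.injective _) (by simp)]

lemma ncard_rot_vert_eq {c : ℝ} (hc : c ≠ 0) (a b : Fin 4) :
    {j | rot (g j) (c • castVec (sgn a)) = c • castVec (sgn b)}.ncard = 3 := by
  rw [ncard_rot_eq g hc]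
  revert a b
  decide

/-- The vertices of the octahedron. -/
def octVec : Fin 6 → Fin 3 → ℤ :=
  ![![1, 0, 0], ![-1, 0, 0], ![0, 1, 0], ![0, -1, 0], ![0, 0, 1], ![0, 0, -1]]

lemma exists_octVec {x : E3} (hx : x ∈ octahedron) : ∃ a, x = (1 : ℝ) • castVec (octVec a) := by
  have e : ∀ (v : Fin 3 → ℤ) (a b c : ℝ), a = v 0 → b = v 1 → c = v 2 →
      !₂[a, b, c] = (1 : ℝ) • castVec v := fun v a b c h0 h1 h2 => by
    apply ext_three <;> simp [castVec, *]
  rcases hx with rfl | rfl | rfl | rfl | rfl | rfl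
  · exact ⟨0, e _ _ _ _ (by simp [octVec]) (by simp [octVec]) (by simp [octVec])⟩
  · exact ⟨1, e _ _ _ _ (by simp [octVec]) (by simp [octVec]) (by simp [octVec])⟩
  · exact ⟨2, e _ _ _ _ (by simp [octVec]) (by simp [octVec]) (by simp [octVec])⟩
  · exact ⟨3, e _ _ _ _ (by simp [octVec]) (by simp [octVec]) (by simp [octVec])⟩
  · exact ⟨4, e _ _ _ _ (by simp [octVec]) (by simp [octVec]) (by simp [octVec])⟩
  · exact ⟨5, e _ _ _ _ (by simp [octVec]) (by simp [octVec]) (by simp [octVec])⟩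

lemma ncard_rot_oct_eq {x y : E3} (hx : x ∈ octahedron) (hy : y ∈ octahedron) :
    {j | rot (g j) x = y}.ncard = 2 := by
  obtain ⟨a, rfl⟩ := exists_octVec hx
  obtain ⟨b, rfl⟩ := exists_octVec hy
  rw [ncard_rot_eq g one_ne_zero]
  clear hx hy
  revert a b
  decide

lemma inner_axis_axis_sq_lt {k l : Fin 3 ⊕ Fin 4} (h : k ≠ l) :
    inner ℝ (axis k) (axis l) ^ 2 < (1 : ℝ) := by
  have hs : ∀ a i, (sgn a i : ℝ) ^ 2 = 1 := fun a i => by rw [sq, sgn_mul_self_real]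
  rcases k with i | a <;> rcases l with j | b
  · rw [inner_axis_inl]
    have : i ≠ j := fun hij => h (by rw [hij])
    simp [axis, this]
  · rw [inner_axis_inl]
    change vert b i ^ 2 < 1
    rw [vert_apply, mul_pow, one_div_sqrt_three_sq, hs]
    norm_num
  · rw [real_inner_comm, inner_axis_inl]
    change vert a j ^ 2 < 1
    rw [vert_apply, mul_pow, one_div_sqrt_three_sq, hs]
    norm_num
  · change inner ℝ (vert a) (vert b) ^ 2 < (1 : ℝ)
    have : a ≠ b := fun hab => h (by rw [hab])
    rw [inner_vert_vert, if_neg this]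
    norm_num

theorem exists_periodicFamily_axis (k : Fin 3 ⊕ Fin 4) {ε : ℝ} (hε : ε ^ 2 = 1) :
    ∃ (h₁ : ℝ) (u : ℝ → ℝ → E3) (τ : ℝ → ℝ),
      IsPeriodicFamily g f (ε • axis k) (Ioi h₁) atTop u τ ∧ Tendsto τ atTop (𝓝 0) :=
  exists_periodicFamily_of_axis g f hε rfl fun l hl => by
    rw [inner_smul_right, mul_pow, hε, one_mul]
    exact inner_axis_axis_sq_lt hl

lemma exists_axis_of_mem_octahedron {x : E3} (hx : x ∈ octahedron) :
    ∃ (i : Fin 3) (ε : ℝ), ε ^ 2 = 1 ∧ x = ε • axis (Sum.inl i) := by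
  rcases hx with rfl | rfl | rfl | rfl | rfl | rfl
  · exact ⟨0, 1, by norm_num, by apply ext_three <;> simp [axis]⟩
  · exact ⟨0, -1, by norm_num, by apply ext_three <;> simp [axis]⟩
  · exact ⟨1, 1, by norm_num, by apply ext_three <;> simp [axis]⟩
  · exact ⟨1, -1, by norm_num, by apply ext_three <;> simp [axis]⟩
  · exact ⟨2, 1, by norm_num, by apply ext_three <;> simp [axis]⟩
  · exact ⟨2, -1, by norm_num, by apply ext_three <;> simp [axis]⟩

/-! ### The dodecahedron -/

/-- The set of points with one coordinate `0` and the next two of absolute values `α` and `β`. -/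
def cyclicPoints (α β : ℝ) : Set E3 := {x | ∃ i : Fin 3, x i = 0 ∧ |x (i + 1)| = α ∧ |x (i + 2)| = β}

/-- Parity determines only the third sign, and there the coordinate will be `0`; the other two signs
are free. -/
lemma exists_sgn : ∀ (i : Fin 3) (s t : Bool), ∃ c : Fin 4,
    sgn c (i + 1) = (if s then 1 else -1) ∧ sgn c (i + 2) = (if t then 1 else -1) := by
  decide

lemma exists_sign_of_abs_eq {a b : ℝ} (h : |a| = |b|) :
    ∃ s : Bool, a = ((if s then 1 else -1 : ℤ) : ℝ) * b := by
  rcases abs_eq_abs.1 h with h | h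
  · exact ⟨true, by simp [h]⟩
  · exact ⟨false, by simp [h]⟩

lemma fin_three_cases (i j : Fin 3) : j = i ∨ j = i + 1 ∨ j = i + 2 := by
  revert i j
  decide

/-- Cyclic shifts move the zero to any place, and by `exists_sgn` all signs of the other two
coordinates occur, so the orbit is everything. -/
lemma range_rot_eq_cyclicPoints {α β : ℝ} {u₀ : E3} (hu : u₀ ∈ cyclicPoints α β) :
    (range fun j => rot (g j) u₀) = cyclicPoints α β := by
  obtain ⟨i, h0, h1, h2⟩ := hu
  have habs : ∀ a i, |(sgn a i : ℝ)| = 1 := fun a i => by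
    have h := sgn_mul_self_real a i
    rw [← abs_mul_abs_self] at h
    nlinarith [abs_nonneg (sgn a i : ℝ)]
  ext x
  constructor
  · rintro ⟨j, rfl⟩
    obtain ⟨⟨k, a⟩, hp⟩ := tetEquiv.surjective (g j)
    simp only
    rw [← hp, coe_tetEquiv]
    refine ⟨i - k, ?_, ?_, ?_⟩ <;> rw [rot_tetElt]
    · simp [h0]
    · simp only
      rw [abs_mul, habs, one_mul, add_right_comm, sub_add_cancel, h1]
    · simp only
      rw [abs_mul, habs, one_mul, add_right_comm, sub_add_cancel, h2]
  · rintro ⟨i', h0', h1', h2'⟩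
    obtain ⟨s, hs⟩ := exists_sign_of_abs_eq (h1'.trans h1.symm)
    obtain ⟨t, ht⟩ := exists_sign_of_abs_eq (h2'.trans h2.symm)
    obtain ⟨c, hc1, hc2⟩ := exists_sgn i' s t
    refine ⟨g.symm (tetEquiv (i - i', c)), ?_⟩
    simp only [Equiv.apply_symm_apply, coe_tetEquiv]
    ext j
    rw [rot_tetElt]
    simp only
    rcases fin_three_cases i' j with rfl | rfl | rfl
    · rw [add_sub_cancel, h0, h0', mul_zero]
    · rw [hc1, hs, show i' + 1 + (i - i') = i + 1 by abel]
    · rw [hc2, ht, show i' + 2 + (i - i') = i + 2 by abel]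

lemma range_symConfig (u₀ : E3) :
    range (symConfig g f u₀) = (range fun j => rot (g j) u₀) ∪ cube := by
  ext x
  constructor
  · rintro ⟨i, rfl⟩
    revert i
    refine Fin.addCases (m := 12) (n := 8) (fun j => ?_) fun k => ?_
    · rw [symConfig_castAdd]
      exact Or.inl ⟨j, rfl⟩
    · rw [symConfig_natAdd]
      exact Or.inr (f k).2
  · rintro (⟨j, rfl⟩ | hx)
    · exact ⟨_, symConfig_castAdd g f u₀ j⟩
    · exact ⟨Fin.natAdd 12 (f.symm ⟨x, hx⟩), by rw [symConfig_natAdd, Equiv.apply_symm_apply]⟩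

lemma standardDodecahedron_eq : standardDodecahedron =
    cube ∪ cyclicPoints (Real.goldenRatio⁻¹ / √3) (Real.goldenRatio / √3) := rfl

/-- The reflection which exchanges the last two coordinates. -/
def swapIsometry : E3 ≃ₗᵢ[ℝ] E3 :=
  LinearIsometryEquiv.piLpCongrLeft 2 ℝ ℝ (Equiv.swap (1 : Fin 3) 2)

lemma swapIsometry_apply (x : E3) (i : Fin 3) :
    swapIsometry x i = x (Equiv.swap (1 : Fin 3) 2 i) := by
  simp [swapIsometry, LinearIsometryEquiv.piLpCongrLeft_apply, Equiv.piCongrLeft'_apply]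

lemma swapIsometry_swapIsometry (x : E3) : swapIsometry (swapIsometry x) = x := by
  ext i
  rw [swapIsometry_apply, swapIsometry_apply, Equiv.swap_apply_self]

lemma image_swapIsometry_eq {S T : Set E3} (hST : ∀ x ∈ S, swapIsometry x ∈ T)
    (hTS : ∀ x ∈ T, swapIsometry x ∈ S) : swapIsometry '' S = T := by
  ext x
  constructor
  · rintro ⟨y, hy, rfl⟩
    exact hST y hy
  · exact fun hx => ⟨_, hTS x hx, swapIsometry_swapIsometry x⟩

lemma swapIsometry_mem_cyclicPoints {α β : ℝ} {x : E3} (hx : x ∈ cyclicPoints α β) :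
    swapIsometry x ∈ cyclicPoints β α := by
  obtain ⟨i, h0, h1, h2⟩ := hx
  refine ⟨Equiv.swap (1 : Fin 3) 2 i, ?_⟩
  simp only [swapIsometry_apply]
  have e : ∀ i : Fin 3, Equiv.swap (1 : Fin 3) 2 (Equiv.swap (1 : Fin 3) 2 i) = i ∧
      Equiv.swap (1 : Fin 3) 2 (Equiv.swap (1 : Fin 3) 2 i + 1) = i + 2 ∧
      Equiv.swap (1 : Fin 3) 2 (Equiv.swap (1 : Fin 3) 2 i + 2) = i + 1 := by decide
  obtain ⟨e0, e1, e2⟩ := e i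
  rw [e0, e1, e2]
  exact ⟨h0, h2, h1⟩

lemma exists_sgn_swap : ∀ a : Fin 4, ∃ b, ∀ i, sgn a (Equiv.swap (1 : Fin 3) 2 i) = sgn b i := by
  decide

lemma swapIsometry_mem_cube {x : E3} (hx : x ∈ cube) : swapIsometry x ∈ cube := by
  have h : ∀ a, ∃ b, swapIsometry (vert a) = vert b := fun a => by
    obtain ⟨b, hb⟩ := exists_sgn_swap a
    refine ⟨b, ?_⟩
    ext i
    rw [swapIsometry_apply, vert_apply, vert_apply, hb]
  rw [← range_cubeVert] at *
  obtain ⟨a | a, rfl⟩ := hx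
  · obtain ⟨b, hb⟩ := h a
    exact ⟨Sum.inl b, hb.symm⟩
  · obtain ⟨b, hb⟩ := h a
    exact ⟨Sum.inr b, by simp [cubeVert, hb]⟩

lemma dodecahedralPoints_cases {x : E3} (hx : x ∈ dodecahedralPoints) :
    x ∈ cyclicPoints (Real.goldenRatio⁻¹ / √3) (Real.goldenRatio / √3) ∨
      x ∈ cyclicPoints (Real.goldenRatio / √3) (Real.goldenRatio⁻¹ / √3) := by
  obtain ⟨σ, h0, h1, h2⟩ := hx
  have hσ : ∀ σ : Equiv.Perm (Fin 3), (σ 1 = σ 2 + 1 ∧ σ 0 = σ 2 + 2) ∨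
      (σ 0 = σ 2 + 1 ∧ σ 1 = σ 2 + 2) := by decide
  rcases hσ σ with ⟨e1, e0⟩ | ⟨e0, e1⟩
  · exact Or.inl ⟨σ 2, h2, e1 ▸ h1, e0 ▸ h0⟩
  · exact Or.inr ⟨σ 2, h2, e0 ▸ h0, e1 ▸ h1⟩

/-- The dodecahedral points form two `𝕋`-orbits. One completes the cube to the standard
dodecahedron, the other to its image under the exchange of two coordinates. -/
lemma isRegularDodecahedron_range {u₀ : E3} (hu : u₀ ∈ dodecahedralPoints) :
    IsRegularDodecahedron (range (symConfig g f u₀)) := by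
  rw [range_symConfig]
  rcases dodecahedralPoints_cases hu with h | h <;> rw [range_rot_eq_cyclicPoints g h, union_comm]
  · exact ⟨LinearIsometryEquiv.refl ℝ E3, by rw [standardDodecahedron_eq]; simp⟩
  · refine ⟨swapIsometry, ?_⟩
    rw [standardDodecahedron_eq, image_union,
      image_swapIsometry_eq (fun _ => swapIsometry_mem_cube) fun _ => swapIsometry_mem_cube,
      image_swapIsometry_eq (fun _ => swapIsometry_mem_cyclicPoints)
        fun _ => swapIsometry_mem_cyclicPoints]

/-! ### The reduced Hamiltonian at the dodecahedral points -/

/-- The contribution of an axis to the gradient. -/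
def gradTerm (D S V : ℝ) : ℝ := S / (D - S ^ 2) * V

/-- The contribution of an axis to the second derivative. -/
def hessTerm (D S V : ℝ) : ℝ := (V ^ 2 * (D + S ^ 2) - S ^ 2 * (D - S ^ 2)) / (D - S ^ 2) ^ 2

/-- The sum of the contributions of the axes, in coordinates. -/
def axisSum (T : ℝ → ℝ → ℝ → ℝ) (x y z a b c : ℝ) : ℝ :=
  1 / 2 * (T 1 x a + T 1 y b + T 1 z c) + 2 * (T 3 (x + y + z) (a + b + c) +
    T 3 (x - y - z) (a - b - c) + T 3 (-x + y - z) (-a + b - c) + T 3 (-x - y + z) (-a - b + c))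

/-- Using `(±1, ±1, ±1)` unnormalised, with `D = 3` in place of `1`, removes `√3`; the factors `1/2`
and `2` are twice the weights. -/
lemma inner_gradPsi_eq (x v : E3) :
    inner ℝ (gradPsi x) v = axisSum gradTerm (x 0) (x 1) (x 2) (v 0) (v 1) (v 2) := by
  have h3 : (√3 : ℝ) ^ 2 = 3 := Real.sq_sqrt (by norm_num)
  have hn : ∀ S V : ℝ, 2 * 1 * (1 / √3 * S) / (1 - S ^ 2 / 3) * (1 / √3 * V) =
      2 * gradTerm 3 S V := fun S V => by
    have h4 : (1 - S ^ 2 / 3) = (3 - S ^ 2) / 3 := by ring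
    rw [h4, gradTerm, div_div_eq_mul_div]
    linear_combination (2 * S * V * 3 / (3 - S ^ 2)) * one_div_sqrt_three_sq
  rw [inner_gradPsi, Fintype.sum_sum_type, Fin.sum_univ_three, Fin.sum_univ_four]
  simp only [inner_axis_inl, inner_axis_inr, inner_vert_sq]
  simp only [inner_vert, weight, Sum.elim_inl, Sum.elim_inr, hn]
  simp only [sgn, Matrix.cons_val, gradTerm, axisSum]
  push_cast
  ring

lemma hessPsi_eq (x v : E3) :
    hessPsi x v = axisSum hessTerm (x 0) (x 1) (x 2) (v 0) (v 1) (v 2) := by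
  have hn : ∀ S V : ℝ, (V ^ 2 / 3 * (1 + S ^ 2 / 3) - S ^ 2 / 3 * (1 - S ^ 2 / 3)) /
      (1 - S ^ 2 / 3) ^ 2 = hessTerm 3 S V := fun S V => by
    have h4 : (1 - S ^ 2 / 3) = (3 - S ^ 2) / 3 := by ring
    rw [h4, hessTerm, div_pow, div_div_eq_mul_div]
    ring
  rw [hessPsi, Fintype.sum_sum_type, Fin.sum_univ_three, Fin.sum_univ_four]
  simp only [inner_axis_inl, inner_axis_inr, inner_vert_sq, weight, Sum.elim_inl, Sum.elim_inr, hn]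
  simp only [sgn, Matrix.cons_val, hessTerm, axisSum]
  push_cast
  ring

/-- A cyclic shift permutes the axes, so the vanishing coordinate can be assumed to be the last. -/
lemma axisSum_gradTerm_cyclic (x y z a b c : ℝ) :
    axisSum gradTerm x y z a b c = axisSum gradTerm y z x b c a := by
  unfold axisSum gradTerm
  ring

lemma axisSum_hessTerm_cyclic (x y z a b c : ℝ) :
    axisSum hessTerm x y z a b c = axisSum hessTerm y z x b c a := by
  unfold axisSum hessTerm
  ring

lemma hessTerm_of_sq_eq {D S V s : ℝ} (h : S ^ 2 = s) :
    hessTerm D S V = (V ^ 2 * (D + s) - s * (D - s)) / (D - s) ^ 2 := by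
  rw [hessTerm, h]

section Dodecahedral

variable {p q a b c : ℝ}

/-- Here `1 - p² = q²`, whose inverse is `9p²`; the denominators vanish from the computation without
mention of the golden ratio. -/
lemma inv_one_sub_sq (hpq : p ^ 2 + q ^ 2 = 1) (h9 : p ^ 2 * q ^ 2 = 1 / 9) :
    (1 - p ^ 2)⁻¹ = 9 * p ^ 2 := by
  have : 1 - p ^ 2 ≠ 0 := fun h => by
    rw [show q ^ 2 = 0 by linarith] at h9
    norm_num at h9
  rw [inv_eq_one_div, div_eq_iff this]
  linear_combination (9 * p ^ 2) * hpq - 9 * h9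

lemma mul_eq_or (h9 : p ^ 2 * q ^ 2 = 1 / 9) : p * q = 1 / 3 ∨ p * q = -1 / 3 := by
  have : (p * q - 1 / 3) * (p * q + 1 / 3) = 0 := by linear_combination h9
  rcases mul_eq_zero.1 this with h | h
  · left; linarith
  · right; linarith

/-- The sign of `pq = ±1/3` decides which of `(p + q)²`, `(p - q)²` equals `5/3` and which `1/3`; in
either case the derivative is a multiple of `pa + qb`. -/
lemma axisSum_gradTerm_eq_zero (hpq : p ^ 2 + q ^ 2 = 1) (h9 : p ^ 2 * q ^ 2 = 1 / 9)
    (hab : p * a + q * b = 0) : axisSum gradTerm p q 0 a b c = 0 := by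
  have hqp : q ^ 2 + p ^ 2 = 1 := by linarith
  have h9' : q ^ 2 * p ^ 2 = 1 / 9 := by linarith
  have i1 := inv_one_sub_sq hpq h9
  have i2 := inv_one_sub_sq hqp h9'
  simp only [axisSum, gradTerm, div_eq_mul_inv, i1, i2, add_zero, sub_zero]
  rcases mul_eq_or h9 with h | h
  · rw [show 3 - (p + q) ^ 2 = 4 / 3 by linear_combination -hpq - 2 * h,
      show 3 - (p - q) ^ 2 = 8 / 3 by linear_combination -hpq + 2 * h,
      show 3 - (-p + q) ^ 2 = 8 / 3 by linear_combination -hpq + 2 * h,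
      show 3 - (-p - q) ^ 2 = 4 / 3 by linear_combination -hpq - 2 * h]
    linear_combination (9 / 2 * (p * a + q * b)) * hpq - (9 / 2 * (q * a + p * b)) * h + 9 * hab
  · rw [show 3 - (p + q) ^ 2 = 8 / 3 by linear_combination -hpq - 2 * h,
      show 3 - (p - q) ^ 2 = 4 / 3 by linear_combination -hpq + 2 * h,
      show 3 - (-p + q) ^ 2 = 4 / 3 by linear_combination -hpq + 2 * h,
      show 3 - (-p - q) ^ 2 = 8 / 3 by linear_combination -hpq - 2 * h]
    linear_combination (9 / 2 * (p * a + q * b)) * hpq - (9 / 2 * (q * a + p * b)) * h + 9 * hab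

lemma axisSum_hessTerm_eq (hpq : p ^ 2 + q ^ 2 = 1) (h9 : p ^ 2 * q ^ 2 = 1 / 9)
    (hab : p * a + q * b = 0) (habc : a ^ 2 + b ^ 2 + c ^ 2 = 1) :
    axisSum hessTerm p q 0 a b c = 45 / 8 - 7 / 4 * c ^ 2 := by
  have hqp : q ^ 2 + p ^ 2 = 1 := by linarith
  have h9' : q ^ 2 * p ^ 2 = 1 / 9 := by linarith
  -- The plane part of a tangent vector is a multiple of `(-q, p)`, with factor `pb - qa`.
  obtain ⟨m, rfl, rfl⟩ : ∃ m, a = -q * m ∧ b = p * m :=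
    ⟨p * b - q * a, by linear_combination -a * hpq + p * hab,
      by linear_combination -b * hpq + q * hab⟩
  have hm : m ^ 2 + c ^ 2 = 1 := by linear_combination habc - m ^ 2 * hpq
  have t1 : hessTerm 1 p (-q * m) + hessTerm 1 q (p * m) = 16 * m ^ 2 - 7 := by
    simp only [hessTerm, div_eq_mul_inv, ← inv_pow, inv_one_sub_sq hpq h9, inv_one_sub_sq hqp h9']
    grind
  have t2 : hessTerm 1 0 c = c ^ 2 := by simp [hessTerm]
  rw [axisSum, t1, t2]
  rcases mul_eq_or h9 with h | h
  · have s1 : (p + q + 0) ^ 2 = 5 / 3 := by linear_combination hpq + 2 * h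
    have s2 : (p - q - 0) ^ 2 = 1 / 3 := by linear_combination hpq - 2 * h
    have s3 : (-p + q - 0) ^ 2 = 1 / 3 := by linear_combination hpq - 2 * h
    have s4 : (-p - q + 0) ^ 2 = 5 / 3 := by linear_combination hpq + 2 * h
    rw [hessTerm_of_sq_eq s1, hessTerm_of_sq_eq s2, hessTerm_of_sq_eq s3, hessTerm_of_sq_eq s4]
    grind
  · have s1 : (p + q + 0) ^ 2 = 1 / 3 := by linear_combination hpq + 2 * h
    have s2 : (p - q - 0) ^ 2 = 5 / 3 := by linear_combination hpq - 2 * h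
    have s3 : (-p + q - 0) ^ 2 = 5 / 3 := by linear_combination hpq - 2 * h
    have s4 : (-p - q + 0) ^ 2 = 1 / 3 := by linear_combination hpq + 2 * h
    rw [hessTerm_of_sq_eq s1, hessTerm_of_sq_eq s2, hessTerm_of_sq_eq s3, hessTerm_of_sq_eq s4]
    grind

end Dodecahedral

end SphereVortex

namespace SphereVortex

/-! ### The dodecahedral equilibria -/

lemma axisSum_shift {T : ℝ → ℝ → ℝ → ℝ}
    (hT : ∀ x y z a b c, axisSum T x y z a b c = axisSum T y z x b c a) (x v : E3) (i : Fin 3) :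
    axisSum T (x 0) (x 1) (x 2) (v 0) (v 1) (v 2) =
      axisSum T (x (i + 1)) (x (i + 2)) (x i) (v (i + 1)) (v (i + 2)) (v i) := by
  fin_cases i
  · exact hT _ _ _ _ _ _
  · exact (hT _ _ _ _ _ _).trans (hT _ _ _ _ _ _)
  · rfl

lemma sum_shift {M : Type*} [AddCommMonoid M] (F : Fin 3 → M) (i : Fin 3) :
    F 0 + F 1 + F 2 = F (i + 1) + F (i + 2) + F i := by
  rw [← Fin.sum_univ_three, ← Equiv.sum_comp (Equiv.addLeft (i + 1)), Fin.sum_univ_three]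
  simp only [Equiv.coe_addLeft, add_zero]
  congr 2
  · rw [add_assoc]; rfl
  · rw [add_assoc, show (1 + 2 : Fin 3) = 0 from rfl, add_zero]

/-- The relations come from `φ² + φ⁻² = 3` and `φ φ⁻¹ = 1`, and are all that is used of the golden
ratio afterwards. -/
lemma exists_coords_of_mem_dodecahedralPoints {u₀ : E3} (hu : u₀ ∈ dodecahedralPoints) :
    ∃ i : Fin 3, u₀ i = 0 ∧ u₀ (i + 1) ^ 2 + u₀ (i + 2) ^ 2 = 1 ∧
      u₀ (i + 1) ^ 2 * u₀ (i + 2) ^ 2 = 1 / 9 := by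
  have hsq : √3 ^ 2 = (3 : ℝ) := Real.sq_sqrt (by norm_num)
  have hφ2 := Real.goldenRatio_sq
  have hinv : Real.goldenRatio⁻¹ = Real.goldenRatio - 1 := by
    rw [inv_eq_of_mul_eq_one_right]
    linear_combination hφ2
  have h1 : (Real.goldenRatio / √3) ^ 2 + (Real.goldenRatio⁻¹ / √3) ^ 2 = 1 := by
    rw [hinv, div_pow _ (√3), div_pow (_ - 1), hsq]
    linear_combination (2 / 3) * hφ2
  have h2 : (Real.goldenRatio / √3) ^ 2 * (Real.goldenRatio⁻¹ / √3) ^ 2 = 1 / 9 := by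
    rw [hinv, div_pow _ (√3), div_pow (_ - 1), hsq]
    linear_combination ((Real.goldenRatio ^ 2 - Real.goldenRatio + 1) / 9) * hφ2
  rcases dodecahedralPoints_cases hu with ⟨i, hi, ha, hb⟩ | ⟨i, hi, ha, hb⟩ <;>
    refine ⟨i, hi, ?_, ?_⟩ <;> rw [← sq_abs (u₀ (i + 1)), ← sq_abs (u₀ (i + 2)), ha, hb] <;> linarith

section Dodecahedral

variable {u₀ : E3} {i : Fin 3}

lemma isRegular_of_coords (hi : u₀ i = 0)
    (hpq : u₀ (i + 1) ^ 2 + u₀ (i + 2) ^ 2 = 1)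
    (h9 : u₀ (i + 1) ^ 2 * u₀ (i + 2) ^ 2 = 1 / 9) : IsRegular u₀ := by
  have hsum : ∀ F : Fin 3 → ℝ, F 0 + F 1 + F 2 = F (i + 1) + F (i + 2) + F i := fun F =>
    sum_shift F i
  refine ⟨?_, ?_⟩
  · rw [mem_S2_iff_coord, hsum fun j => u₀ j ^ 2, hi]
    linarith
  · rintro (j | a)
    · rw [inner_axis_inl]
      rcases fin_three_cases i j with rfl | rfl | rfl <;> nlinarith
    · rw [inner_axis_inr, inner_vert_sq, hsum fun j => sgn a j * u₀ j, hi]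
      have s1 := sgn_mul_self_real a (i + 1)
      have s2 := sgn_mul_self_real a (i + 2)
      have h1 : (sgn a (i + 1) * u₀ (i + 1)) ^ 2 = u₀ (i + 1) ^ 2 := by
        linear_combination u₀ (i + 1) ^ 2 * s1
      have h2 : (sgn a (i + 2) * u₀ (i + 2)) ^ 2 = u₀ (i + 2) ^ 2 := by
        linear_combination u₀ (i + 2) ^ 2 * s2
      nlinarith [sq_nonneg (sgn a (i + 1) * u₀ (i + 1) - sgn a (i + 2) * u₀ (i + 2))]

lemma inner_gradPsi_eq_zero_of_coords (hi : u₀ i = 0)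
    (hpq : u₀ (i + 1) ^ 2 + u₀ (i + 2) ^ 2 = 1)
    (h9 : u₀ (i + 1) ^ 2 * u₀ (i + 2) ^ 2 = 1 / 9)
    {e : E3} (he : e ∈ tangentCircle u₀) :
    inner ℝ (gradPsi u₀) e = 0 := by
  rw [inner_gradPsi_eq, axisSum_shift axisSum_gradTerm_cyclic u₀ e i, hi]
  apply axisSum_gradTerm_eq_zero hpq h9
  have h := he.2
  rw [inner_eq, sum_shift (fun j => u₀ j * e j) i, hi] at h
  linarith

lemma hessPsi_pos_of_coords (hi : u₀ i = 0)
    (hpq : u₀ (i + 1) ^ 2 + u₀ (i + 2) ^ 2 = 1)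
    (h9 : u₀ (i + 1) ^ 2 * u₀ (i + 2) ^ 2 = 1 / 9)
    {e : E3} (he : e ∈ tangentCircle u₀) : 0 < hessPsi u₀ e := by
  have h := he.2
  have h' := mem_S2_iff_coord.1 he.1
  rw [inner_eq, sum_shift (fun j => u₀ j * e j) i, hi] at h
  rw [sum_shift (fun j => e j ^ 2) i] at h'
  rw [hessPsi_eq, axisSum_shift axisSum_hessTerm_cyclic u₀ e i, hi,
    axisSum_hessTerm_eq hpq h9 (by linarith) h']
  -- Since `c² ≤ 1`, the value `45/8 - 7c²/4` is at least `31/8`.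
  nlinarith [sq_nonneg (e (i + 1)), sq_nonneg (e (i + 2))]

end Dodecahedral

variable (g : Fin 12 ≃ tetrahedralGroup) (f : Fin 8 ≃ cube)

/-- At a critical point `∇ψ` is parallel to `u₀`, so `∇ψ × u₀ = 0`. -/
lemma isEquilibrium_of_critical {u₀ : E3} (hreg : IsRegular u₀)
    (hcrit : ∀ e ∈ tangentCircle u₀, inner ℝ (gradPsi u₀) e = 0) :
    IsEquilibrium (symConfig g f u₀) := by
  refine ⟨hreg.isCollisionFree g f, ?_⟩
  refine Fin.addCases (m := 12) (n := 8) (fun j => ?_) fun k => vortexField_natAdd g f u₀ k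
  obtain ⟨e₁, e₂, hf⟩ := exists_isFrame hreg.1 (σ := 1) (by norm_num)
  have h1 := hf.eq_sum (gradPsi u₀)
  rw [real_inner_comm _ e₁, real_inner_comm _ e₂,
    hcrit e₁ ⟨mem_S2_iff.2 hf.norm₁, hf.inner₀₁⟩,
    hcrit e₂ ⟨mem_S2_iff.2 hf.norm₂, hf.inner₀₂⟩, zero_smul, zero_smul, add_zero, add_zero] at h1
  rw [vortexField_castAdd, symField_self g f hreg, h1, cross_smul_left, cross_self_eq, smul_zero,
    rot_zero]

theorem dodecahedral_family {u₀ : E3} (hu : u₀ ∈ dodecahedralPoints) :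
    IsEquilibrium (symConfig g f u₀) ∧ ∃ ε > 0, ∃ (u : ℝ → ℝ → E3) (τ : ℝ → ℝ),
      IsPeriodicFamily g f u₀
        (Ioo (energy (symConfig g f u₀)) (energy (symConfig g f u₀) + ε))
        (𝓝[>] (energy (symConfig g f u₀))) u τ := by
  obtain ⟨i, hi, hpq, h9⟩ := exists_coords_of_mem_dodecahedralPoints hu
  have hreg := isRegular_of_coords hi hpq h9
  have hcrit : ∀ e ∈ tangentCircle u₀, inner ℝ (gradPsi u₀) e = 0 := fun e he =>
    inner_gradPsi_eq_zero_of_coords hi hpq h9 he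
  exact ⟨isEquilibrium_of_critical g f hreg hcrit, exists_periodicFamily_of_min g f hreg hcrit
    fun e he => hessPsi_pos_of_coords hi hpq h9 he⟩

/-! ### The collisions at the two tetrahedra (`c = 1` and `c = -1`), and the full statement. -/

theorem tetrahedral_family {c : ℝ} (hc : c ^ 2 = 1) {P : Set E3}
    (hP : P = range fun a => c • vert a) {u₀ : E3} (hu : u₀ ∈ P) :
    (∀ p ∈ P, {j | rot (g j) u₀ = p}.ncard = 3) ∧
      ∃ (h₁ : ℝ) (u : ℝ → ℝ → E3) (τ : ℝ → ℝ),
        IsPeriodicFamily g f u₀ (Ioi h₁) atTop u τ ∧ Tendsto τ atTop (𝓝 0) := by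
  subst hP
  obtain ⟨a, rfl⟩ := hu
  refine ⟨?_, exists_periodicFamily_axis g f (Sum.inr a) hc⟩
  rintro _ ⟨b, rfl⟩
  have hc0 : c * (1 / √3) ≠ 0 := mul_ne_zero (fun h => by simp [h] at hc) (by positivity)
  simp only [vert_eq, smul_smul]
  exact ncard_rot_vert_eq g hc0 a b

end SphereVortex

end

theorem corollary7p2 (g : Fin 12 ≃ tetrahedralGroup) (f : Fin 8 ≃ cube) :
    (∀ u₀ ∈ dodecahedralPoints,
      IsEquilibrium (symConfig g f u₀) ∧
      IsRegularDodecahedron (Set.range (symConfig g f u₀)) ∧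
      ∃ ε > 0, ∃ (u : ℝ → ℝ → E3) (τ : ℝ → ℝ),
        IsPeriodicFamily g f u₀
          (Ioo (energy (symConfig g f u₀)) (energy (symConfig g f u₀) + ε))
          (𝓝[>] (energy (symConfig g f u₀))) u τ) ∧
    (∀ P : Set E3, P = tetrahedron₁ ∨ P = tetrahedron₂ → ∀ u₀ ∈ P,
      (∀ p ∈ P, {j | rot (g j) u₀ = p}.ncard = 3) ∧
      ∃ (h₁ : ℝ) (u : ℝ → ℝ → E3) (τ : ℝ → ℝ),
        IsPeriodicFamily g f u₀ (Ioi h₁) atTop u τ ∧ Tendsto τ atTop (𝓝 0)) ∧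
    (∀ u₀ ∈ octahedron,
      (∀ p ∈ octahedron, {j | rot (g j) u₀ = p}.ncard = 2) ∧
      ∃ (h₁ : ℝ) (u : ℝ → ℝ → E3) (τ : ℝ → ℝ),
        IsPeriodicFamily g f u₀ (Ioi h₁) atTop u τ ∧ Tendsto τ atTop (𝓝 0)) := by
  refine ⟨fun u₀ hu => ?_, fun P hP u₀ hu => ?_, fun u₀ hu => ?_⟩
  · obtain ⟨h1, h2⟩ := dodecahedral_family g f hu
    exact ⟨h1, isRegularDodecahedron_range g f hu, h2⟩
  · rcases hP with rfl | rfl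
    · exact tetrahedral_family g f (c := 1) (by norm_num) (by simp [← range_vert]) hu
    · exact tetrahedral_family g f (c := -1) (by norm_num) (by simp [← range_neg_vert]) hu
  · refine ⟨fun p hp => ncard_rot_oct_eq g hu hp, ?_⟩
    obtain ⟨i, ε, hε, rfl⟩ := exists_axis_of_mem_octahedron hu
    exact exists_periodicFamily_axis g f (Sum.inl i) hε
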